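/- Let $g\ge 0$ and let $W$ be a $2g$-dimensional real symplectic space with symplectic basis $e_1,\dots,e_{2g}$ ($\langle e_i,e_{g+i}\rangle=1=-\langle e_{g+i},e_i\rangle$ for $1\le i\le g$, all other pairings $0$). Write $x=\sum_{j=1}^{2g}\sum_{n\ge1}x_{j,-n}e_jt^{-n}$ (a finite sum) for the elements of $W[t^{-1}]t^{-1}$, and let $C^\infty(W[t^{-1}]t^{-1})$ be the space of complex functions on $W[t^{-1}]t^{-1}$ whose restriction to every finite-dimensional subspace is smooth, with the linear topology in which the kernels of the restriction maps to $Wt^{-1}+\dots+Wt^{-n}$ ($n\ge0$) form a basis of neighbourhoods of $0$. Let $\mathfrak h=W_{\mathbb C}((t))\oplus\mathbb C$ be the (complexified) Heisenberg Lie algebra, with $\mathbb C$ central and $[a f(t),b h(t)]=\langle a,b\rangle\operatorname{Res}(f h)$. It acts on $C^\infty(W[t^{-1}]t^{-1})$ by $$e_jt^{-n}=\partial_{x_{j,-n}}\ (1\le j\le 2g),\qquad e_it^{n-1}=-2\pi i\,x_{g+i,-n},\quad e_{g+i}t^{n-1}=2\pi i\,x_{i,-n}\ (1\le i\le g),\qquad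 n\ge1,$$ with $c\in\mathbb C$ acting as $2\pi i c$ (in the coefficients $2\pi i$ the letter $i$ is the imaginary unit). For $1\le k\le g$, $n\ge1$ put $\beta_k(n-1)=e_{g+k}t^{-n}$, $\beta_k(-n)=-e_{g+k}t^{n-1}$, $\gamma_k(n-1)=e_kt^{-n}$, $\gamma_k(-n)=-e_kt^{n-1}$. Let $V$ be the vertex algebra of the $\beta$–$\gamma$ system, i.e. the Fock space generated from the vacuum by free fields $\beta_k(z)=\sum_n\beta_k(n)z^{-n-1}$, $\gamma_k(z)=\sum_n\gamma_k(n)z^{-n-1}$ with $\beta_k(z)\beta_j(w)\sim0$, $\gamma_k(z)\gamma_j(w)\sim0$, $\beta_k(z)\gamma_j(w)\sim 2\pi i\,\delta_{kj}/(z-w)$, with vertex operators given by normally ordered products. A linear topological module over $V$ is a complete Hausdorff linear topological space $M$ over $\mathbb C$ (translation-invariant topology, a basis of neighbourhoods of $0$ consisting of subspaces, every Cauchy sequence converges) with a linear map $a\mapsto Y_M(a,z)=\sum_n a_M(n)z^{-n-1}$ such that each $a_M(n)$ is continuous; for each $a\in V$ and each neighbourhood $U$ of $0$, $\operatorname{Im}a_M(-n)\subset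 U$ for all large $n$; $Y_M(1,z)=\mathrm{Id}$; the Borcherds identity $Y_M(a_{(l)}b,z)=Y_M(a,z)_{(l)}Y_M(b,z)$ holds for all $a,b\in V$, $l\in\mathbb Z$; and $Y_M(Ta,z)=\frac{d}{dz}Y_M(a,z)$. The linear topological submodule generated by $v\in M$ is the smallest closed subspace that contains $v$ and is stable under all $a_M(n)$. An isomorphism of linear topological modules is a linear homeomorphism that intertwines all the operators $a(n)$, $a\in V$, $n\in\mathbb Z$. Let $\mathfrak s\subset\mathfrak h$ be the Lie subalgebra spanned by the operators $x_{j,-n}+\partial_{x_{j,-n}}$ ($1\le j\le2g$, $n\ge1$), viewed as elements of $\mathfrak h$ through the formulas above, and the center. Let $\mathbb C_\chi$ be the one-dimensional $\mathfrak s$-module on which these operators act as $0$ and $c\in\mathbb C$ acts as $2\pi i c$. Let $M=U(\mathfrak h)\otimes_{U(\mathfrak s)}\mathbb C_\chi$ be the induced module, and let $\tilde M$ be its completion with respect to the subspaces $U_n=t^nW_{\mathbb C}[[t]]\cdot M$, $n\ge0$. Then the action of the modes $\beta_k(n),\gamma_k(n)$ on $M$ extends to a unique structure of a linear topological module over $V$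 on $\tilde M$, and their action on $C^\infty(W[t^{-1}]t^{-1})$ is that of a unique structure of a linear topological module over $V$. Moreover the linear topological submodule of $C^\infty(W[t^{-1}]t^{-1})$ generated by $$f(x)=e^{-\frac12\sum_{j=1}^{2g}\sum_{n\ge1}x_{j,-n}^2}$$ is itself a linear topological module over $V$, and $\tilde M$ is isomorphic to it as a linear topological module over $V$. -/

import Mathlib

open scoped ContDiff TensorProduct

noncomputable section

namespace BetaGamma

/-! ### Linear topological modules over a vertex algebra -/

/-- The operations of a vertex algebra `V`: the vacuum and the products `a_(n) b`.
The axioms of a module over a vertex algebra refer only to these. -/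
class VertexOperations (V : Type*) where
  vac : V
  nprod : V → ℤ → V → V

/-- The infinitesimal translation `T a = a_(-2) 1`. -/
def translation {V : Type*} [VertexOperations V] (a : V) : V :=
  VertexOperations.nprod a (-2) VertexOperations.vac

/-- The `i`-th term
`(-1)^i (l choose i) a_(l-i) b_(n+i) x - (-1)^(l+i) (l choose i) b_(n+l-i) a_(i) x`
of the series that defines the `n`-th mode, applied to `x`, of the `l`-th normal product of
`a(z) = ∑ a_(n) z^(-n-1)` and `b(z) = ∑ b_(n) z^(-n-1)`. -/
def normalProductTerm {M : Type*} [AddCommGroup M] [Module ℂ M] (a b : ℤ → M → M)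
    (l n : ℤ) (x : M) (i : ℕ) : M :=
  ((-1 : ℂ) ^ i * (Ring.choose l i : ℤ)) • a (l - i) (b (n + i) x)
    - ((-1 : ℂ) ^ (l + i) * (Ring.choose l i : ℤ)) • b (n + l - i) (a i x)

/-- `a(z) = ∑ a_(n) z^(-n-1)` is a field on the linear topological space `M`. -/
def IsField {M : Type*} [AddCommGroup M] [Module ℂ M] [TopologicalSpace M]
    (a : ℤ → Module.End ℂ M) : Prop :=
  (∀ n, Continuous (a n)) ∧
  ∀ U ∈ nhds (0 : M), ∃ N : ℤ, ∀ n ≥ N, ∀ x, a (-n) x ∈ U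

/-- `M` is a complete (Hausdorff) linear topological space over `ℂ`: the topology is invariant
under translations, has a basis of neighbourhoods of `0` consisting of subspaces, and every
Cauchy sequence converges. -/
structure IsCompleteLinear (M : Type*) [AddCommGroup M] [Module ℂ M] [TopologicalSpace M] :
    Prop where
  isTopologicalAddGroup : IsTopologicalAddGroup M
  isLinearTopology : IsLinearTopology ℂ M
  t2 : T2Space M
  complete : ∀ v : ℕ → M,
    (∀ U ∈ nhds (0 : M), ∃ N, ∀ i ≥ N, ∀ j ≥ N, v i - v j ∈ U) →
      ∃ x, Filter.Tendsto v Filter.atTop (nhds x)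

/-- `Y a n = a_M(n)`, i.e. `Y_M(a, z) = ∑ a_M(n) z^(-n-1)`, makes `M` a complete linear
topological module over the vertex algebra `V`. -/
structure IsLinearTopologicalModule {V M : Type*} [AddCommGroup V] [Module ℂ V]
    [VertexOperations V] [AddCommGroup M] [Module ℂ M] [TopologicalSpace M]
    (Y : V →ₗ[ℂ] ℤ → Module.End ℂ M) : Prop where
  completeLinear : IsCompleteLinear M
  field : ∀ a, IsField (Y a)
  vacuum : ∀ n, Y VertexOperations.vac n = if n = -1 then LinearMap.id else 0
  borcherds : ∀ (a b : V) (l n : ℤ) (x : M),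
    Filter.Tendsto
      (fun N : ℕ => ∑ i ∈ Finset.range N,
        normalProductTerm (fun m => ⇑(Y a m)) (fun m => ⇑(Y b m)) l n x i)
      Filter.atTop (nhds (Y (VertexOperations.nprod a l b) n x))
  derivative : ∀ (a : V) (n : ℤ), Y (translation a) n = (-(n : ℂ)) • Y a (n - 1)

/-- An isomorphism of linear topological modules: a linear homeomorphism that intertwines the
two actions. -/
def Isomorphic {V M N : Type*} [AddCommGroup V] [Module ℂ V]
    [AddCommGroup M] [Module ℂ M] [TopologicalSpace M]
    [AddCommGroup N] [Module ℂ N] [TopologicalSpace N]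
    (Y : V →ₗ[ℂ] ℤ → Module.End ℂ M) (Z : V →ₗ[ℂ] ℤ → Module.End ℂ N) : Prop :=
  ∃ Φ : M ≃L[ℂ] N, ∀ a n x, Φ (Y a n x) = Z a n (Φ x)

section Generated

variable {V M : Type*} [AddCommGroup V] [Module ℂ V]
  [AddCommGroup M] [Module ℂ M] [TopologicalSpace M]

/-- A linear topological submodule: a closed (equivalently, complete) subspace that is stable
under all the operators `a_M(n)`. -/
def IsClosedSubmodule (Y : V →ₗ[ℂ] ℤ → Module.End ℂ M) (S : Submodule ℂ M) : Prop :=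
  IsClosed (S : Set M) ∧ ∀ a n, ∀ x ∈ S, Y a n x ∈ S

/-- The linear topological submodule generated by `v`: the smallest one that contains `v`. -/
def generated (Y : V →ₗ[ℂ] ℤ → Module.End ℂ M) (v : M) : Submodule ℂ M :=
  sInf {S | IsClosedSubmodule Y S ∧ v ∈ S}

theorem generated_stable (Y : V →ₗ[ℂ] ℤ → Module.End ℂ M) (v : M) (a : V) (n : ℤ) :
    ∀ x ∈ generated Y v, Y a n x ∈ generated Y v := by
  intro x hx
  rw [generated, Submodule.mem_sInf] at hx ⊢
  exact fun S hS => hS.1.2 a n x (hx S hS)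

/-- The action on the submodule generated by `v`. -/
def generatedAction (Y : V →ₗ[ℂ] ℤ → Module.End ℂ M) (v : M) :
    V →ₗ[ℂ] ℤ → Module.End ℂ (generated Y v) where
  toFun a n := (Y a n).restrict (generated_stable Y v a n)
  map_add' a b := by
    funext n
    ext x
    simp [LinearMap.restrict_apply]
  map_smul' c a := by
    funext n
    ext x
    simp [LinearMap.restrict_apply]

end Generated

/-! ### The topology of a decreasing sequence of subspaces, and the completion -/

section Filtration

variable {M : Type*} [AddCommGroup M] [Module ℂ M]

/-- The linear topology defined by a sequence of subspaces `U n` (the coarsest topology for which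
all the maps to the discrete spaces `M / U n` are continuous). -/
@[reducible]
def filtrationTopology (U : ℕ → Submodule ℂ M) : TopologicalSpace M :=
  ⨅ n, TopologicalSpace.induced (U n).mkQ ⊥

/-- The Cauchy sequences. -/
def cauchySeqs (U : ℕ → Submodule ℂ M) : Submodule ℂ (ℕ → M) where
  carrier := {v | ∀ n, ∃ N, ∀ i ≥ N, ∀ j ≥ N, v i - v j ∈ U n}
  add_mem' := by
    intro v w hv hw n
    obtain ⟨N, hN⟩ := hv n
    obtain ⟨N', hN'⟩ := hw n
    refine ⟨max N N', fun i hi j hj => ?_⟩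
    have := (U n).add_mem (hN i (le_of_max_le_left hi) j (le_of_max_le_left hj))
      (hN' i (le_of_max_le_right hi) j (le_of_max_le_right hj))
    simpa [add_sub_add_comm] using this
  zero_mem' := fun n => ⟨0, by simp⟩
  smul_mem' := by
    intro r v hv n
    obtain ⟨N, hN⟩ := hv n
    refine ⟨N, fun i hi j hj => ?_⟩
    simpa [smul_sub] using (U n).smul_mem r (hN i hi j hj)

/-- The Cauchy sequences that eventually lie in `V`. -/
def eventuallyIn (U : ℕ → Submodule ℂ M) (V : Submodule ℂ M) : Submodule ℂ (cauchySeqs U) where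
  carrier := {v | ∃ N, ∀ i ≥ N, (v : ℕ → M) i ∈ V}
  add_mem' := by
    rintro v w ⟨N, hN⟩ ⟨N', hN'⟩
    exact ⟨max N N', fun i hi =>
      V.add_mem (hN i (le_of_max_le_left hi)) (hN' i (le_of_max_le_right hi))⟩
  zero_mem' := ⟨0, fun _ _ => V.zero_mem⟩
  smul_mem' := by
    rintro c v ⟨N, hN⟩
    exact ⟨N, fun i hi => V.smul_mem c (hN i hi)⟩

/-- The completion of `M` with respect to the subspaces `U n`: Cauchy sequences modulo those that
tend to `0`. -/
def Completion (U : ℕ → Submodule ℂ M) : Type _ :=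
  cauchySeqs U ⧸ (⨅ n, eventuallyIn U (U n))

instance (U : ℕ → Submodule ℂ M) : AddCommGroup (Completion U) :=
  inferInstanceAs (AddCommGroup (cauchySeqs U ⧸ (⨅ n, eventuallyIn U (U n))))

instance (U : ℕ → Submodule ℂ M) : Module ℂ (Completion U) :=
  inferInstanceAs (Module ℂ (cauchySeqs U ⧸ (⨅ n, eventuallyIn U (U n))))

/-- The class of a Cauchy sequence. -/
def Completion.mk (U : ℕ → Submodule ℂ M) : cauchySeqs U →ₗ[ℂ] Completion U :=
  (⨅ n, eventuallyIn U (U n)).mkQ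

/-- The classes of Cauchy sequences in `U n`; these are a fundamental system of neighbourhoods of
`0` in the completion. -/
def Completion.closureFiltration (U : ℕ → Submodule ℂ M) (n : ℕ) : Submodule ℂ (Completion U) :=
  (eventuallyIn U (U n)).map (Completion.mk U)

instance (U : ℕ → Submodule ℂ M) : TopologicalSpace (Completion U) :=
  filtrationTopology (Completion.closureFiltration U)

/-- The canonical map of `M` to its completion (constant sequences). -/
def Completion.of (U : ℕ → Submodule ℂ M) (m : M) : Completion U :=
  Completion.mk U ⟨fun _ => m, fun n => ⟨0, by simp⟩⟩

end Filtration

/-! ### The vertex algebra of the `β`-`γ` system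

It is realised on its Fock space, the polynomial algebra in the creation operators
`β_i(-k-1)`, `γ_i(-k-1)` (`k ≥ 0`) applied to the vacuum. -/

/-- Indices of the generators: `Sum.inl i` stands for `β_i`, `Sum.inr i` for `γ_i`. -/
abbrev Gen (g : ℕ) : Type := Fin g ⊕ Fin g

/-- The Fock space; `X (φ, k)` is the state `φ(-k-1) 1`. -/
def Fock (g : ℕ) : Type := MvPolynomial (Gen g × ℕ) ℂ

instance (g : ℕ) : CommRing (Fock g) := inferInstanceAs (CommRing (MvPolynomial (Gen g × ℕ) ℂ))
instance (g : ℕ) : Algebra ℂ (Fock g) :=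
  inferInstanceAs (Algebra ℂ (MvPolynomial (Gen g × ℕ) ℂ))

/-- The modes `φ(n)` of the free fields on the Fock space, with
`[β_k(m), γ_j(n)] = 2πi δ_{k,j} δ_{m+n+1,0}` and `[β, β] = [γ, γ] = 0`. -/
def mode {g : ℕ} : Gen g → ℤ → MvPolynomial (Gen g × ℕ) ℂ →ₗ[ℂ] MvPolynomial (Gen g × ℕ) ℂ
  | φ, Int.negSucc k => LinearMap.mulLeft ℂ (MvPolynomial.X (φ, k))
  | Sum.inl i, Int.ofNat k =>
      (2 * Real.pi * Complex.I : ℂ) • (MvPolynomial.pderiv (Sum.inr i, k)).toLinearMap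
  | Sum.inr i, Int.ofNat k =>
      (-(2 * Real.pi * Complex.I) : ℂ) • (MvPolynomial.pderiv (Sum.inl i, k)).toLinearMap

/-- The modes of the vertex operator of the state `φ₁(-k₁-1) ⋯ φ_r(-k_r-1) 1`, that is, of the
iterated normal product `φ₁(z)_(-k₁-1) (φ₂(z)_(-k₂-1) (⋯ (φ_r(z)_(-k_r-1) Id)))`, the normally
ordered product of the derivatives `∂^k φ / k!`. The sums are finite on every vector. -/
def monomialMode {g : ℕ} : List (Gen g × ℕ) → ℤ →
    MvPolynomial (Gen g × ℕ) ℂ → MvPolynomial (Gen g × ℕ) ℂ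
  | [], n, b => if n = -1 then b else 0
  | (φ, k) :: s, n, b =>
      ∑ᶠ i : ℕ, normalProductTerm (fun m => ⇑(mode φ m)) (monomialMode s) (Int.negSucc k) n b i

/-- The state-field correspondence of the `β`-`γ` system. The order of the factors of a monomial is
immaterial. -/
instance (g : ℕ) : VertexOperations (Fock g) where
  vac := (1 : MvPolynomial (Gen g × ℕ) ℂ)
  nprod := fun (a : MvPolynomial (Gen g × ℕ) ℂ) n (b : MvPolynomial (Gen g × ℕ) ℂ) =>
    (∑ s ∈ a.support, a.coeff s • monomialMode s.toMultiset.toList n b :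
      MvPolynomial (Gen g × ℕ) ℂ)

/-- The state `φ(-1) 1`, i.e. the generator `β_i` or `γ_i`. -/
def genState {g : ℕ} (φ : Gen g) : Fock g := (MvPolynomial.X (φ, 0) : MvPolynomial (Gen g × ℕ) ℂ)

/-! ### The space `C^∞(W[t⁻¹]t⁻¹)`

`W` is identified with `ℝ^{2g}` by a symplectic basis `e_1, …, e_{2g}`. -/

/-- Indices of the symplectic basis: `Sum.inl i` stands for `e_i`, `Sum.inr i` for `e_{g+i}`. -/
abbrev Idx (g : ℕ) : Type := Fin g ⊕ Fin g

/-- The space `W[t⁻¹]t⁻¹`; the value of `x` at `(j, k)` is the coordinate `x_{j,-k-1}`. -/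
abbrev Loop (g : ℕ) : Type := (Idx g × ℕ) →₀ ℝ

/-- `f` is smooth on every finite dimensional subspace (every such subspace is the image of a
linear map from some `ℝ^m`). -/
def IsSmooth {g : ℕ} (f : Loop g → ℂ) : Prop :=
  ∀ (m : ℕ) (L : (Fin m → ℝ) →ₗ[ℝ] Loop g), ContDiff ℝ ∞ (fun y => f (L y))

/-- `C^∞(W[t⁻¹]t⁻¹)` as a space of functions. -/
def smoothSubmodule (g : ℕ) : Submodule ℂ (Loop g → ℂ) where
  carrier := {f | IsSmooth f}
  add_mem' := fun hf hh m L => (hf m L).add (hh m L)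
  zero_mem' := fun _ _ => contDiff_const
  smul_mem' := fun _ _ hf m L => contDiff_const.smul (hf m L)

/-- `C^∞(W[t⁻¹]t⁻¹)` as a type; its topology is given below and is not that of pointwise
convergence. -/
def Smooth (g : ℕ) : Type := smoothSubmodule g

instance (g : ℕ) : AddCommGroup (Smooth g) := inferInstanceAs (AddCommGroup (smoothSubmodule g))
instance (g : ℕ) : Module ℂ (Smooth g) := inferInstanceAs (Module ℂ (smoothSubmodule g))

/-- The vector `e_j t^(-k-1)`. -/
def basisVec {g : ℕ} (p : Idx g × ℕ) : Loop g := Finsupp.single p 1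

theorem IsSmooth.line {g : ℕ} {f : Loop g → ℂ} (hf : IsSmooth f) (x v : Loop g) :
    ContDiff ℝ ∞ (fun s : ℝ => f (x + s • v)) := by
  have h := hf 2 (Fintype.linearCombination ℝ ![x, v])
  have h2 : ContDiff ℝ ∞ (fun s : ℝ => (![1, s] : Fin 2 → ℝ)) := by
    rw [contDiff_pi]
    intro i
    fin_cases i
    · exact contDiff_const
    · exact contDiff_id
  have := h.comp h2
  simpa [Function.comp_def, Fintype.linearCombination_apply, Fin.sum_univ_two] using this

theorem IsSmooth.lineDeriv {g : ℕ} {f : Loop g → ℂ} (hf : IsSmooth f) (v : Loop g) :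
    IsSmooth (fun x => deriv (fun s : ℝ => f (x + s • v)) 0) := by
  intro m L
  let L' : (Fin (m + 1) → ℝ) →ₗ[ℝ] Loop g :=
    (LinearMap.toSpanSingleton ℝ _ v).comp (LinearMap.proj 0)
      + L.comp (LinearMap.funLeft ℝ ℝ Fin.succ)
  have h := hf (m + 1) L'
  let e : (Fin m → ℝ) → (Fin (m + 1) → ℝ) := fun y => Fin.cons 0 y
  let d : Fin (m + 1) → ℝ := Fin.cons 1 0
  have he : ContDiff ℝ ∞ e := by
    rw [contDiff_pi]
    intro i
    refine Fin.cases ?_ (fun i => ?_) i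
    · exact contDiff_const
    · exact contDiff_apply ℝ ℝ i
  have key : (fun y => deriv (fun s : ℝ => f (L y + s • v)) 0)
      = fun y => fderiv ℝ (fun z => f (L' z)) (e y) d := by
    funext y
    have h1 : (fun s : ℝ => f (L y + s • v)) = fun s : ℝ => f (L' (e y + s • d)) := by
      funext s
      congr 1
      have : LinearMap.funLeft ℝ ℝ Fin.succ (e y + s • d) = y := by
        funext i
        simp [e, d, LinearMap.funLeft_apply]
      simp only [L', LinearMap.add_apply, LinearMap.comp_apply, this]
      simp [e, d, add_comm]
    rw [h1]
    have hd : DifferentiableAt ℝ (fun z => f (L' z)) (e y) :=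
      (h.differentiable (by simp)) _
    exact (hd.lineDeriv_eq_fderiv (v := d))
  change ContDiff ℝ ∞ (fun y => deriv (fun s : ℝ => f (L y + s • v)) 0)
  rw [key]
  exact ((h.fderiv_right (m := ∞) (by simp)).comp he).clm_apply contDiff_const

/-- The operator `∂/∂x_{j,-k-1}`. -/
def partialOp {g : ℕ} (p : Idx g × ℕ) : Module.End ℂ (Smooth g) where
  toFun f := ⟨fun x => deriv (fun s : ℝ => f.1 (x + s • basisVec p)) 0,
    IsSmooth.lineDeriv f.2 (basisVec p)⟩
  map_add' f h := by
    refine Subtype.ext (funext fun x => ?_)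
    have hf := ((IsSmooth.line f.2 x (basisVec p)).differentiable (by simp)) 0
    have hh := ((IsSmooth.line h.2 x (basisVec p)).differentiable (by simp)) 0
    exact deriv_add hf hh
  map_smul' c f := by
    refine Subtype.ext (funext fun x => ?_)
    have hf := ((IsSmooth.line f.2 x (basisVec p)).differentiable (by simp)) 0
    exact deriv_const_smul c hf

/-- The operator of multiplication by the coordinate `x_{j,-k-1}`. -/
def coordOp {g : ℕ} (p : Idx g × ℕ) : Module.End ℂ (Smooth g) where
  toFun f := ⟨fun x => (x p : ℂ) * f.1 x, fun m L => by
    have h1 : ContDiff ℝ ∞ (fun y => L y p) :=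
      (LinearMap.toContinuousLinearMap ((Finsupp.lapply p).comp L)).contDiff
    exact (Complex.ofRealCLM.contDiff.comp h1).mul (f.2 m L)⟩
  map_add' f h := by
    refine Subtype.ext (funext fun x => ?_)
    exact mul_add _ _ _
  map_smul' c f := by
    refine Subtype.ext (funext fun x => ?_)
    exact mul_left_comm _ _ _

/-- The kernel of the restriction to `W t⁻¹ + ⋯ + W t⁻ⁿ`. -/
def restrictionKernel (g n : ℕ) : Submodule ℂ (Smooth g) where
  carrier := {f | ∀ x : Loop g, (∀ j k, n ≤ k → x (j, k) = 0) → f.1 x = 0}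
  add_mem' := by
    intro f h hf hh x hx
    change f.1 x + h.1 x = 0
    rw [hf x hx, hh x hx, add_zero]
  zero_mem' := fun _ _ => rfl
  smul_mem' := by
    intro c f hf x hx
    change c * f.1 x = 0
    rw [hf x hx, mul_zero]

instance (g : ℕ) : TopologicalSpace (Smooth g) := filtrationTopology (restrictionKernel g)

/-- The modes `β_i(n)`, `γ_i(n)` on `C^∞(W[t⁻¹]t⁻¹)`. -/
def smoothMode {g : ℕ} : Gen g → ℤ → Module.End ℂ (Smooth g)
  | Sum.inl i, Int.ofNat k => partialOp (Sum.inr i, k)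
  | Sum.inl i, Int.negSucc k => (-(2 * Real.pi * Complex.I) : ℂ) • coordOp (Sum.inl i, k)
  | Sum.inr i, Int.ofNat k => partialOp (Sum.inl i, k)
  | Sum.inr i, Int.negSucc k => (2 * Real.pi * Complex.I : ℂ) • coordOp (Sum.inr i, k)

/-- The Gaussian `exp(-½ ∑ x_{j,-n}²)`. -/
def gaussian (g : ℕ) : Smooth g :=
  ⟨fun x => Complex.exp (-(1 / 2) * (x.sum fun _ r => (r : ℂ) ^ 2)), by
    intro m L
    refine ContDiff.cexp (contDiff_const.mul ?_)
    classical
    let S : Finset (Idx g × ℕ) :=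
      Finset.univ.biUnion fun i : Fin m => (L (Pi.single i 1)).support
    have hS : ∀ y, (L y).support ⊆ S := by
      intro y p hp
      by_contra hpS
      have h0 : ∀ i, L (Pi.single i 1) p = 0 := by
        intro i
        by_contra hi
        exact hpS (Finset.mem_biUnion.2 ⟨i, Finset.mem_univ i, Finsupp.mem_support_iff.2 hi⟩)
      have : L y p = 0 := by
        rw [LinearMap.pi_apply_eq_sum_univ L y, Finsupp.finsetSum_apply]
        refine Finset.sum_eq_zero fun i _ => ?_
        have h1 : (fun j => if i = j then (1 : ℝ) else 0) = Pi.single i 1 := by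
          funext j
          simp [Pi.single_apply, eq_comm]
        rw [h1, Finsupp.smul_apply, h0 i, smul_zero]
      exact (Finsupp.mem_support_iff.1 hp) this
    have hsum : (fun y => (L y).sum fun _ r => (r : ℂ) ^ 2)
        = fun y => ∑ p ∈ S, ((L y p : ℝ) : ℂ) ^ 2 := by
      funext y
      exact Finsupp.sum_of_support_subset _ (hS y) _ (by simp)
    rw [hsum]
    refine ContDiff.sum fun p _ => ContDiff.pow ?_ 2
    have h1 : ContDiff ℝ ∞ (fun y => L y p) :=
      (LinearMap.toContinuousLinearMap ((Finsupp.lapply p).comp L)).contDiff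
    exact Complex.ofRealCLM.contDiff.comp h1⟩

/-! ### The Heisenberg algebra and the induced module -/

/-- The complexification of the Heisenberg Lie algebra `W((t)) × ℝ`; `(u, c)` is the element
`∑_j u_j e_j + c` with `u_j ∈ ℂ((t))` and `c` central. -/
def Heis (g : ℕ) : Type := (Idx g → LaurentSeries ℂ) × ℂ

instance (g : ℕ) : AddCommGroup (Heis g) :=
  inferInstanceAs (AddCommGroup ((Idx g → LaurentSeries ℂ) × ℂ))
instance (g : ℕ) : Module ℂ (Heis g) :=
  inferInstanceAs (Module ℂ ((Idx g → LaurentSeries ℂ) × ℂ))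

/-- The form `⟨a f, b h⟩ = ⟨a, b⟩ Res(f h)`, where `⟨e_i, e_{g+i}⟩ = 1 = -⟨e_{g+i}, e_i⟩`. -/
def resForm {g : ℕ} (u v : Idx g → LaurentSeries ℂ) : ℂ :=
  ∑ i : Fin g, ((u (Sum.inl i) * v (Sum.inr i)).coeff (-1)
    - (u (Sum.inr i) * v (Sum.inl i)).coeff (-1))

instance (g : ℕ) : LieRing (Heis g) where
  bracket x y := (0, resForm x.1 y.1)
  add_lie x y z := by
    refine Prod.ext (by exact (add_zero 0).symm) ?_
    change resForm (x.1 + y.1) z.1 = resForm x.1 z.1 + resForm y.1 z.1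
    simp only [resForm, ← Finset.sum_add_distrib, Pi.add_apply, add_mul, HahnSeries.coeff_add]
    exact Finset.sum_congr rfl fun i _ => by ring
  lie_add x y z := by
    refine Prod.ext (by exact (add_zero 0).symm) ?_
    change resForm x.1 (y.1 + z.1) = resForm x.1 y.1 + resForm x.1 z.1
    simp only [resForm, ← Finset.sum_add_distrib, Pi.add_apply, mul_add, HahnSeries.coeff_add]
    exact Finset.sum_congr rfl fun i _ => by ring
  lie_self x := by
    refine Prod.ext rfl ?_
    change resForm x.1 x.1 = 0
    exact Finset.sum_eq_zero fun i _ => by rw [mul_comm, sub_self]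
  leibniz_lie x y z := by
    have h1 : ∀ u : Idx g → LaurentSeries ℂ, resForm u 0 = 0 := fun u => by simp [resForm]
    have h2 : ∀ u : Idx g → LaurentSeries ℂ, resForm 0 u = 0 := fun u => by simp [resForm]
    refine Prod.ext (by exact (add_zero 0).symm) ?_
    change resForm x.1 0 = resForm 0 z.1 + resForm y.1 0
    rw [h1, h2, h1, add_zero]

instance (g : ℕ) : LieAlgebra ℂ (Heis g) where
  lie_smul c x y := by
    refine Prod.ext (by exact (smul_zero c).symm) ?_
    change resForm x.1 (c • y.1) = c * resForm x.1 y.1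
    have h : ∀ a b : LaurentSeries ℂ, (a * (c • b)).coeff (-1) = c * (a * b).coeff (-1) := by
      intro a b
      rw [← HahnSeries.C_mul_eq_smul, mul_left_comm, HahnSeries.C_mul_eq_smul,
        HahnSeries.coeff_smul, smul_eq_mul]
    rw [resForm, resForm, Finset.mul_sum]
    refine Finset.sum_congr rfl fun i _ => ?_
    rw [mul_sub, ← h, ← h]
    rfl

/-- The element `e_j t^n`. -/
def heisVec {g : ℕ} (j : Idx g) (n : ℤ) : Heis g := (Pi.single j (HahnSeries.single n 1), 0)

/-- The central element `c`. -/
def heisCentral {g : ℕ} (c : ℂ) : Heis g := (0, c)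

/-- The modes `β_i(n)`, `γ_i(n)` as elements of the Heisenberg algebra:
`β_i(n-1) = e_{g+i} t⁻ⁿ`, `β_i(-n) = -e_{g+i} t^(n-1)`, `γ_i(n-1) = e_i t⁻ⁿ`,
`γ_i(-n) = -e_i t^(n-1)` for `n ≥ 1`. -/
def heisMode {g : ℕ} : Gen g → ℤ → Heis g
  | Sum.inl i, Int.ofNat k => heisVec (Sum.inr i) (-(k : ℤ) - 1)
  | Sum.inl i, Int.negSucc k => -heisVec (Sum.inr i) k
  | Sum.inr i, Int.ofNat k => heisVec (Sum.inl i) (-(k : ℤ) - 1)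
  | Sum.inr i, Int.negSucc k => -heisVec (Sum.inl i) k

/-- The element of the Heisenberg algebra that acts on functions as multiplication by
`x_{j,-k-1}`: on functions, `e_{g+i} t^k` is `2πi x_{i,-k-1}` and `e_i t^k` is
`-2πi x_{g+i,-k-1}`. -/
def heisCoord {g : ℕ} : Idx g → ℕ → Heis g
  | Sum.inl i, k => (2 * Real.pi * Complex.I : ℂ)⁻¹ • heisVec (Sum.inr i) k
  | Sum.inr i, k => (-(2 * Real.pi * Complex.I) : ℂ)⁻¹ • heisVec (Sum.inl i) k

/-- The subalgebra `𝔰` spanned by the operators `x_{j,-k-1} + ∂/∂x_{j,-k-1}` (where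
`∂/∂x_{j,-k-1}` is `e_j t^(-k-1)`) and the center. -/
def subS (g : ℕ) : LieSubalgebra ℂ (Heis g) where
  toSubmodule := Submodule.span ℂ
    (Set.range (fun p : Idx g × ℕ => heisCoord p.1 p.2 + heisVec p.1 (-(p.2 : ℤ) - 1))
      ∪ Set.range heisCentral)
  lie_mem' := by
    intro x y _ _
    exact Submodule.subset_span (Or.inr ⟨resForm x.1 y.1, rfl⟩)

/-- The character of `𝔰` by which the operators `x_{j,-k-1} + ∂/∂x_{j,-k-1}` act as `0` and the
central element `c` acts as `2πi c`. -/
def charS {g : ℕ} (y : subS g) : ℂ := 2 * Real.pi * Complex.I * (y : Heis g).2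

/-- The universal enveloping algebra of the Heisenberg algebra. -/
abbrev UHeis (g : ℕ) : Type := UniversalEnvelopingAlgebra ℂ (Heis g)

/-- The relations `u y ⊗ c = u ⊗ χ(y) c`, `y ∈ 𝔰`. -/
def inducedRel (g : ℕ) : Submodule (UHeis g) (UHeis g ⊗[ℂ] ℂ) :=
  Submodule.span (UHeis g)
    {z | ∃ (u : UHeis g) (y : subS g) (c : ℂ),
      z = (u * UniversalEnvelopingAlgebra.ι ℂ (y : Heis g)) ⊗ₜ[ℂ] c - u ⊗ₜ[ℂ] (charS y * c)}

/-- The induced module `U(𝔥) ⊗_{U(𝔰)} ℂ_χ`. -/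
abbrev Induced (g : ℕ) : Type := (UHeis g ⊗[ℂ] ℂ) ⧸ inducedRel g

/-- The action of an element of the Heisenberg algebra on the induced module. -/
def heisAct {g : ℕ} (v : Heis g) (m : Induced g) : Induced g :=
  UniversalEnvelopingAlgebra.ι ℂ v • m

/-- The subspace `U_n = tⁿ W[[t]] · M` of the induced module `M`. -/
def inducedFiltration (g n : ℕ) : Submodule ℂ (Induced g) :=
  Submodule.span ℂ {z | ∃ (u : Idx g → LaurentSeries ℂ) (m : Induced g),
    (∀ j, ∀ k < (n : ℤ), (u j).coeff k = 0) ∧ z = heisAct ((u, 0) : Heis g) m}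

/-- The completion of the induced module. -/
abbrev CompletedInduced (g : ℕ) : Type := Completion (inducedFiltration g)

/-- `Y` makes the completed induced module a linear topological module over the `β`-`γ` system, by
extension of the action of the modes `β_i(n)`, `γ_i(n)` on the induced module. -/
def IsInducedStructure {g : ℕ} (Y : Fock g →ₗ[ℂ] ℤ → Module.End ℂ (CompletedInduced g)) : Prop :=
  IsLinearTopologicalModule Y ∧
    ∀ (φ : Gen g) (n : ℤ) (m : Induced g),
      Y (genState φ) n (Completion.of (inducedFiltration g) m)
        = Completion.of (inducedFiltration g) (heisAct (heisMode φ n) m)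

/-- `Z` makes `C^∞(W[t⁻¹]t⁻¹)` a linear topological module over the `β`-`γ` system, under the action
of the modes `β_i(n)`, `γ_i(n)` by derivations and multiplications. -/
def IsSmoothStructure {g : ℕ} (Z : Fock g →ₗ[ℂ] ℤ → Module.End ℂ (Smooth g)) : Prop :=
  IsLinearTopologicalModule Z ∧
    ∀ (φ : Gen g) (n : ℤ), Z (genState φ) n = smoothMode φ n

end BetaGamma

end

noncomputable section

namespace BetaGamma

open Filter Topology

/-! ### Summation in complete linear topological spaces -/

/-! The first half is a general fact: on a complete linear topological space, fields satisfying the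
free commutation relations `FreeRelations` define exactly one module structure over the `β`-`γ`
system. In a linear topology a series whose terms tend to zero converges unconditionally, and null
double series may be reordered, so all products `a_(l) b` of fields exist (`Fields.prod`). A state
is a polynomial in creation operators; `vertexField` sends a monomial to the iterated normally
ordered product, whose factors commute (`create_commute`). The Borcherds identity
`vertexField_nprod` follows by induction on the factors of the first state.
`Fields.hasSum_create_prod` splits `(φ_(-k-1) a)_(l) b` into a part where `φ` stands outermost or
innermost and finitely many contractions of `φ` with `b`. The Fock space obeys the same recursion,
and the two are matched by locality (`exists_local`, `Fields.Local.prod_shift`). Uniqueness holds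
because the generators create every state from the vacuum (`intertwines`).

Both concrete spaces carry operators `D_p`, `X_p` with the canonical commutation relations for which
`X_p` tends to zero as its second index grows, so the general fact applies to each.

The Gaussian is annihilated by all `x_p + ∂_p`, so there is a homomorphism `F` from the induced
module to the smooth functions that sends the cyclic vector to it (`exists_inducedMap`). The
decisive point is that the preimage under `F` of the `n`-th restriction kernel is exactly `U_n`
(`IsInducedMap.mem_of_map_mem`): modulo `U_n` every element is a polynomial in finitely many
coordinates applied to the cyclic vector (`exists_polynomial`), and a polynomial times the nowhere
vanishing Gaussian vanishes on a real subspace only if the polynomial is zero. Hence `F` extends to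
a homeomorphism of the completion onto a closed subspace. That subspace is the submodule generated
by the Gaussian, because the cyclic vector topologically generates the completion
(`closedSubmodule_eq_top`). -/

/-- Class version of `IsCompleteLinear`. -/
class CompleteLinear (M : Type*) [AddCommGroup M] [Module ℂ M] [TopologicalSpace M] : Prop
    extends IsTopologicalAddGroup M, IsLinearTopology ℂ M, T2Space M where
  complete : ∀ v : ℕ → M,
    (∀ U ∈ nhds (0 : M), ∃ N, ∀ i ≥ N, ∀ j ≥ N, v i - v j ∈ U) →
      ∃ x, Filter.Tendsto v Filter.atTop (nhds x)

theorem CompleteLinear.isCompleteLinear (M : Type*) [AddCommGroup M] [Module ℂ M]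
    [TopologicalSpace M] [h : CompleteLinear M] : IsCompleteLinear M :=
  ⟨h.toIsTopologicalAddGroup, h.toIsLinearTopology, h.toT2Space, h.complete⟩

section Sums

section

variable {M : Type*} [AddCommGroup M] [TopologicalSpace M]

theorem hasSum_mod [IsTopologicalAddGroup M] {ι : Type*} {F : ι → M}
    {S : M} (h : HasSum F S) {V : Set M} (hV : V ∈ 𝓝 (0 : M)) :
      ∃ s₀ : Finset ι, ∀ s ⊇ s₀, ∑ i ∈ s, F i - S ∈ V := by
  have h1 : Tendsto (fun s : Finset ι => ∑ i ∈ s, F i - S) atTop (𝓝 0) := by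
    have h2 : Tendsto (fun s : Finset ι => ∑ i ∈ s, F i) atTop (𝓝 S) := h
    simpa using h2.sub_const S
  obtain ⟨s₀, hs₀⟩ := mem_atTop_sets.1 (h1 hV)
  exact ⟨s₀, fun s hs => hs₀ s hs⟩

/-- Summation of a double series by antidiagonals. -/
theorem hasSum_antidiagonal [IsTopologicalAddGroup M] {F : ℕ × ℕ → M} {S : M} (h : HasSum F S) :
    HasSum (fun q => ∑ p ∈ Finset.HasAntidiagonal.antidiagonal q, F p) S := by
  have h1 := (Finset.HasAntidiagonal.sigmaAntidiagonalEquivProd (A := ℕ)).hasSum_iff.2 h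
  refine h1.sigma fun q => ?_
  have := hasSum_fintype (fun p : Finset.HasAntidiagonal.antidiagonal q => F p)
  rw [Finset.sum_coe_sort (Finset.HasAntidiagonal.antidiagonal q) F] at this
  exact this

end

variable {M : Type*} [AddCommGroup M] [Module ℂ M] [TopologicalSpace M]

theorem exists_submodule_subset [IsLinearTopology ℂ M] {U : Set M} (hU : U ∈ 𝓝 (0 : M)) :
    ∃ V : Submodule ℂ M, (V : Set M) ∈ 𝓝 (0 : M) ∧ (V : Set M) ⊆ U := by
  obtain ⟨V, hV, h⟩ := (IsLinearTopology.hasBasis_submodule ℂ (M := M)).mem_iff.1 hU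
  exact ⟨V, hV, h⟩

theorem submodule_isOpen [IsTopologicalAddGroup M] {V : Submodule ℂ M}
    (hV : (V : Set M) ∈ 𝓝 (0 : M)) : IsOpen (V : Set M) :=
  V.toAddSubgroup.isOpen_of_mem_nhds hV

theorem submodule_isClosed [IsTopologicalAddGroup M] {V : Submodule ℂ M}
    (hV : (V : Set M) ∈ 𝓝 (0 : M)) : IsClosed (V : Set M) :=
  V.toAddSubgroup.isClosed_of_isOpen (submodule_isOpen hV)

/-- Only multiplication by a fixed scalar is claimed: open subspaces are stable under scalars, while
joint continuity for the usual topology of `ℂ` fails on a nonzero Hausdorff space of this kind. -/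
theorem continuousConstSMul_of_linear [IsTopologicalAddGroup M] [IsLinearTopology ℂ M] :
    ContinuousConstSMul ℂ M := by
  refine ⟨fun c => ?_⟩
  refine continuous_of_continuousAt_zero (DistribSMul.toAddMonoidHom M c) ?_
  intro U hU
  simp only [map_zero] at hU
  obtain ⟨V, hV, hVU⟩ := exists_submodule_subset hU
  exact mem_map.2 (mem_of_superset hV fun x hx => hVU (V.smul_mem c hx))

instance [CompleteLinear M] : ContinuousConstSMul ℂ M := continuousConstSMul_of_linear

theorem linear_continuous {N : Type*} [AddCommGroup N] [Module ℂ N] [TopologicalSpace N]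
    [IsTopologicalAddGroup M] [IsTopologicalAddGroup N] [IsLinearTopology ℂ N]
    (T : M →ₗ[ℂ] N)
    (h : ∀ V : Submodule ℂ N, (V : Set N) ∈ 𝓝 (0 : N) → ∀ᶠ x in 𝓝 (0 : M), T x ∈ V) :
    Continuous T := by
  refine continuous_of_continuousAt_zero T ?_
  intro U hU
  rw [map_zero] at hU
  obtain ⟨V, hV, hVU⟩ := exists_submodule_subset hU
  filter_upwards [h V hV] with x hx using hVU hx

theorem eventually_mem_of_continuous {N : Type*} [AddCommGroup N] [Module ℂ N]
    [TopologicalSpace N] {T : M →ₗ[ℂ] N} (hT : Continuous T) {V : Set N}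
    (hV : V ∈ 𝓝 (0 : N)) : ∀ᶠ x in 𝓝 (0 : M), T x ∈ V := by
  have := hT.tendsto 0
  rw [map_zero] at this
  exact this hV

/-- In a linear topology a family converges to `S` if its finite sums do so modulo every open
subspace. -/
theorem hasSum_of_mod [IsTopologicalAddGroup M] [IsLinearTopology ℂ M] {ι : Type*} {F : ι → M}
    {S : M} (h : ∀ V : Submodule ℂ M, (V : Set M) ∈ 𝓝 (0 : M) →
      ∃ s₀ : Finset ι, ∀ s ⊇ s₀, ∑ i ∈ s, F i - S ∈ V) : HasSum F S := by
  have h0 : Tendsto (fun s : Finset ι => ∑ i ∈ s, F i - S) atTop (𝓝 0) := by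
    intro U hU
    obtain ⟨V, hV, hVU⟩ := exists_submodule_subset hU
    obtain ⟨s₀, hs₀⟩ := h V hV
    exact mem_atTop_sets.2 ⟨s₀, fun s hs => hVU (hs₀ s hs)⟩
  have := h0.add_const S
  simpa [HasSum] using this

theorem hasSum_mem [IsTopologicalAddGroup M] {ι : Type*} {F : ι → M} {S : M} (h : HasSum F S)
    {V : Submodule ℂ M} (hV : (V : Set M) ∈ 𝓝 (0 : M)) (hF : ∀ i, F i ∈ V) : S ∈ V := by
  obtain ⟨s₀, hs₀⟩ := hasSum_mod h hV
  have := V.sub_mem (V.sum_mem fun i (_ : i ∈ s₀) => hF i) (hs₀ s₀ subset_rfl)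
  simpa using this

/-- A double series whose terms tend to zero is summed by its iterated sum. -/
theorem hasSum_prod_of_iterated [IsTopologicalAddGroup M] [IsLinearTopology ℂ M]
    {ι κ : Type*} {F : ι × κ → M} (h0 : Tendsto F cofinite (𝓝 0)) {r : ι → M} {S : M}
    (hr : ∀ i, HasSum (fun j => F (i, j)) (r i)) (hS : HasSum r S) : HasSum F S := by
  classical
  refine hasSum_of_mod fun V hV => ?_
  have hfin : {p | F p ∉ V}.Finite := h0 hV
  refine ⟨hfin.toFinset, fun s hs => ?_⟩
  -- Modulo `V` all terms outside this finite set vanish, so every larger partial sum has the same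
  -- class.
  have key : ∀ t : Finset (ι × κ), hfin.toFinset ⊆ t →
      ∑ p ∈ t, F p - ∑ p ∈ hfin.toFinset, F p ∈ V := by
    intro t ht
    rw [← Finset.sum_sdiff_eq_sub ht]
    refine V.sum_mem fun p hp => ?_
    by_contra hpV
    exact (Finset.mem_sdiff.1 hp).2 (hfin.mem_toFinset.2 hpV)
  obtain ⟨s₁, hs₁⟩ := hasSum_mod hS hV
  -- The rectangle `I ×ˢ K` contains every exceptional index, and its sides are long enough to reach
  -- the row sums and the sum of the rows modulo `V`.
  let I := s₁ ∪ hfin.toFinset.image Prod.fst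
  have hI := hs₁ I Finset.subset_union_left
  choose J hJ using fun i => hasSum_mod (hr i) hV
  let K := I.biUnion J ∪ hfin.toFinset.image Prod.snd
  have hrow : ∑ i ∈ I, (∑ j ∈ K, F (i, j) - r i) ∈ V := by
    refine V.sum_mem fun i hi => hJ i K ?_
    exact (Finset.subset_biUnion_of_mem J hi).trans Finset.subset_union_left
  have hIK : hfin.toFinset ⊆ I ×ˢ K := by
    intro p hp
    exact Finset.mem_product.2
      ⟨Finset.mem_union_right _ (Finset.mem_image_of_mem _ hp),
        Finset.mem_union_right _ (Finset.mem_image_of_mem _ hp)⟩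
  have h1 := key _ hIK
  have h2 := key _ hs
  rw [Finset.sum_product] at h1
  rw [Finset.sum_sub_distrib] at hrow
  have := V.add_mem (V.sub_mem h2 h1) (V.add_mem hrow hI)
  convert this using 1
  abel

/-- Fubini: each iterated sum equals the unconditional sum of the double family. -/
theorem hasSum_unique_of_swap [IsTopologicalAddGroup M] [IsLinearTopology ℂ M] [T2Space M]
    {ι κ : Type*} {F : ι → κ → M}
    (h0 : Tendsto (fun p : ι × κ => F p.1 p.2) cofinite (𝓝 0)) {r : ι → M} {c : κ → M} {S S' : M}
    (hr : ∀ i, HasSum (fun j => F i j) (r i)) (hS : HasSum r S)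
    (hc : ∀ j, HasSum (fun i => F i j) (c j)) (hS' : HasSum c S') : S = S' := by
  have h1 := hasSum_prod_of_iterated h0 hr hS
  have h0' : Tendsto (fun p : κ × ι => F p.2 p.1) cofinite (𝓝 0) :=
    h0.comp (Prod.swap_injective.tendsto_cofinite)
  have h2 := hasSum_prod_of_iterated h0' hc hS'
  exact h1.unique ((Equiv.prodComm κ ι).hasSum_iff.1 h2 : HasSum (fun p : ι × κ => F p.1 p.2) S')

/-- The nonarchimedean criterion: once the terms lie in an open subspace, so does every finite sum
of them, hence null terms already give unconditional summability. -/
theorem exists_hasSum_nat [CompleteLinear M] {F : ℕ → M} (h0 : Tendsto F atTop (𝓝 0)) :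
    Summable F := by
  have tail : ∀ (V : Submodule ℂ M), (V : Set M) ∈ 𝓝 (0 : M) → ∃ N, ∀ i ≥ N, F i ∈ V :=
    fun V hV => eventually_atTop.1 (h0 hV)
  obtain ⟨x, hx⟩ := CompleteLinear.complete (fun N => ∑ i ∈ Finset.range N, F i) (by
    intro U hU
    obtain ⟨V, hV, hVU⟩ := exists_submodule_subset hU
    obtain ⟨N, hN⟩ := tail V hV
    have key : ∀ i ≥ N, ∑ k ∈ Finset.range i, F k - ∑ k ∈ Finset.range N, F k ∈ V := by
      intro i hi
      rw [← Finset.sum_Ico_eq_sub _ hi]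
      exact V.sum_mem fun k hk => hN k (Finset.mem_Ico.1 hk).1
    refine ⟨N, fun i hi j hj => hVU ?_⟩
    have := V.sub_mem (key i hi) (key j hj)
    simpa using this)
  refine ⟨x, hasSum_of_mod fun V hV => ?_⟩
  obtain ⟨N, hN⟩ := tail V hV
  have h1 : Tendsto (fun N => ∑ i ∈ Finset.range N, F i - x) atTop (𝓝 0) := by
    simpa using hx.sub_const x
  obtain ⟨N', hN'⟩ := eventually_atTop.1 (h1 hV)
  refine ⟨Finset.range (max N N'), fun s hs => ?_⟩
  have h2 : ∑ i ∈ s, F i - ∑ i ∈ Finset.range (max N N'), F i ∈ V := by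
    rw [← Finset.sum_sdiff_eq_sub hs]
    refine V.sum_mem fun k hk => hN k ?_
    have := (Finset.mem_sdiff.1 hk).2
    rw [Finset.mem_range, not_lt] at this
    exact le_of_max_le_left this
  have := V.add_mem h2 (hN' _ (le_max_right N N'))
  simpa using this

theorem tendsto_zero_iff [IsLinearTopology ℂ M] {ι : Type*} {l : Filter ι} {F : ι → M} :
    Tendsto F l (𝓝 0) ↔ ∀ V : Submodule ℂ M, (V : Set M) ∈ 𝓝 (0 : M) → ∀ᶠ i in l, F i ∈ V := by
  refine ⟨fun h V hV => h hV, fun h U hU => ?_⟩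
  obtain ⟨V, hV, hVU⟩ := exists_submodule_subset hU
  filter_upwards [h V hV] with i hi using hVU hi

end Sums

/-! ### Products of fields -/

/-- The signed binomial coefficient `(-1)^i (l choose i)`. -/
def signedChoose (l : ℤ) (i : ℕ) : ℂ := (-1 : ℂ) ^ i * (Ring.choose l i : ℤ)

theorem normalProductTerm_eq {M : Type*} [AddCommGroup M] [Module ℂ M] (a b : ℤ → M → M)
    (l n : ℤ) (x : M) (i : ℕ) :
    normalProductTerm a b l n x i = signedChoose l i • a (l - i) (b (n + i) x)
      - ((-1 : ℂ) ^ l * signedChoose l i) • b (n + l - i) (a i x) := by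
  rw [normalProductTerm, signedChoose, zpow_add₀ (by norm_num), zpow_natCast, mul_assoc]

section Fields

variable {M : Type*} [AddCommGroup M] [Module ℂ M] [TopologicalSpace M]

theorem IsField.exists_nat {a : ℤ → Module.End ℂ M} (ha : IsField a) {U : Set M}
    (hU : U ∈ 𝓝 (0 : M)) (c : ℤ) : ∃ N : ℕ, ∀ i : ℕ, N ≤ i → ∀ x, a (c - i) x ∈ U := by
  obtain ⟨N, hN⟩ := ha.2 U hU
  refine ⟨(N + c).toNat, fun i hi x => ?_⟩
  have := hN (i - c) (by have := Int.toNat_le.1 hi; omega) x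
  rwa [neg_sub] at this

variable (M) in
/-- The subspace of fields among the families of operators on `M`. -/
def fieldSubmodule [CompleteLinear M] : Submodule ℂ (ℤ → Module.End ℂ M) where
  carrier := {a | IsField a}
  add_mem' := by
    rintro a b ⟨ha, ha'⟩ ⟨hb, hb'⟩
    refine ⟨fun n => (ha n).add (hb n), fun U hU => ?_⟩
    obtain ⟨V, hV, hVU⟩ := exists_submodule_subset hU
    obtain ⟨N, hN⟩ := ha' V hV
    obtain ⟨N', hN'⟩ := hb' V hV
    exact ⟨max N N', fun n hn x => hVU
      (V.add_mem (hN n (le_of_max_le_left hn) x) (hN' n (le_of_max_le_right hn) x))⟩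
  zero_mem' := ⟨fun _ => continuous_const, fun U hU => ⟨0, fun _ _ _ => mem_of_mem_nhds hU⟩⟩
  smul_mem' := by
    rintro c a ⟨ha, ha'⟩
    refine ⟨fun n => (ha n).const_smul c, fun U hU => ?_⟩
    obtain ⟨V, hV, hVU⟩ := exists_submodule_subset hU
    obtain ⟨N, hN⟩ := ha' V hV
    exact ⟨N, fun n hn x => hVU (V.smul_mem c (hN n hn x))⟩

variable [CompleteLinear M]

variable (M) in
/-- The space of fields on `M`. -/
abbrev Fields : Type _ := fieldSubmodule M

instance : CoeFun (Fields M) (fun _ => ℤ → Module.End ℂ M) := ⟨fun a => a.1⟩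

theorem Fields.ext {a b : Fields M} (h : ∀ n x, a n x = b n x) : a = b :=
  Subtype.ext (funext fun n => LinearMap.ext (h n))

theorem Fields.continuous (a : Fields M) (n : ℤ) : Continuous (a n) := a.2.1 n

theorem Fields.exists_nat (a : Fields M) {U : Set M} (hU : U ∈ 𝓝 (0 : M)) (c : ℤ) :
    ∃ N : ℕ, ∀ i : ℕ, N ≤ i → ∀ x, a (c - i) x ∈ U := IsField.exists_nat a.2 hU c

@[simp] theorem Fields.add_apply (a b : Fields M) (n : ℤ) (x : M) : (a + b) n x = a n x + b n x :=
  rfl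
@[simp] theorem Fields.smul_apply (c : ℂ) (a : Fields M) (n : ℤ) (x : M) :
    (c • a) n x = c • a n x := rfl
@[simp] theorem Fields.zero_apply (n : ℤ) (x : M) : (0 : Fields M) n x = 0 := rfl

theorem Fields.sum_apply {ι : Type*} (s : Finset ι) (a : ι → Fields M) (n : ℤ) (x : M) :
    (∑ i ∈ s, a i) n x = ∑ i ∈ s, a i n x := by
  classical
  induction s using Finset.induction_on with
  | empty => simp
  | insert i s hi ih => rw [Finset.sum_insert hi, Finset.sum_insert hi, Fields.add_apply, ih]

/-- The terms of the products of two fields. -/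
abbrev Fields.term (a b : Fields M) (l n : ℤ) (x : M) (i : ℕ) : M :=
  normalProductTerm (fun m => ⇑(a m)) (fun m => ⇑(b m)) l n x i

theorem Fields.term_add_arg (a b : Fields M) (l n : ℤ) (x y : M) (i : ℕ) :
    a.term b l n (x + y) i = a.term b l n x i + a.term b l n y i := by
  simp only [Fields.term, normalProductTerm_eq, map_add, smul_add]; abel

theorem Fields.term_smul_arg (a b : Fields M) (l n : ℤ) (c : ℂ) (x : M) (i : ℕ) :
    a.term b l n (c • x) i = c • a.term b l n x i := by
  simp only [Fields.term, normalProductTerm_eq, map_smul, smul_sub, smul_comm c]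

/-- In each half of the term the outer mode has index going to `-∞`, and modes of a field become
small uniformly in their argument. This uniformity in `x` makes the sum of the series continuous. -/
theorem Fields.exists_term_mem (a b : Fields M) (l n : ℤ) {V : Submodule ℂ M}
    (hV : (V : Set M) ∈ 𝓝 (0 : M)) : ∃ N, ∀ i ≥ N, ∀ x, a.term b l n x i ∈ V := by
  obtain ⟨N, hN⟩ := a.exists_nat hV l
  obtain ⟨N', hN'⟩ := b.exists_nat hV (n + l)
  refine ⟨max N N', fun i hi x => ?_⟩
  rw [Fields.term, normalProductTerm_eq]
  exact V.sub_mem (V.smul_mem _ (hN i (le_of_max_le_left hi) _))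
    (V.smul_mem _ (hN' i (le_of_max_le_right hi) _))

theorem Fields.summable_term (a b : Fields M) (l n : ℤ) (x : M) : Summable (a.term b l n x) := by
  refine exists_hasSum_nat (tendsto_zero_iff.2 fun V hV => ?_)
  obtain ⟨N, hN⟩ := a.exists_term_mem b l n hV
  exact eventually_atTop.2 ⟨N, fun i hi => hN i hi x⟩

/-- The modes of the `l`-th product of two fields. -/
def Fields.prodMode (a b : Fields M) (l n : ℤ) : Module.End ℂ M where
  toFun x := ∑' i, a.term b l n x i
  map_add' x y := by
    rw [← (a.summable_term b l n x).tsum_add (a.summable_term b l n y)]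
    exact tsum_congr fun i => a.term_add_arg b l n x y i
  map_smul' c x := by
    rw [RingHom.id_apply, ← (a.summable_term b l n x).tsum_const_smul c]
    exact tsum_congr fun i => a.term_smul_arg b l n c x i

theorem Fields.hasSum_prodMode (a b : Fields M) (l n : ℤ) (x : M) :
    HasSum (a.term b l n x) (a.prodMode b l n x) := (a.summable_term b l n x).hasSum

/-- The tail lies in `V` for all `x` at once, so modulo `V` the product is a finite sum of
continuous operators. -/
theorem Fields.prodMode_sub_mem (a b : Fields M) (l n : ℤ) {V : Submodule ℂ M}
    (hV : (V : Set M) ∈ 𝓝 (0 : M)) :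
    ∃ N, ∀ x, ∑ i ∈ Finset.range N, a.term b l n x i - a.prodMode b l n x ∈ V := by
  obtain ⟨N, hN⟩ := a.exists_term_mem b l n hV
  refine ⟨N, fun x => ?_⟩
  have h := (hasSum_nat_add_iff' N).2 (a.hasSum_prodMode b l n x)
  have := hasSum_mem h hV fun i => hN _ (Nat.le_add_left N i) x
  rw [← neg_sub]
  exact V.neg_mem this

theorem Fields.continuous_term (a b : Fields M) (l n : ℤ) (i : ℕ) :
    Continuous fun x => a.term b l n x i := by
  simp only [Fields.term, normalProductTerm_eq]
  exact (((a.continuous _).comp (b.continuous _)).const_smul _).sub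
    (((b.continuous _).comp (a.continuous _)).const_smul _)

theorem Fields.isField_prodMode (a b : Fields M) (l : ℤ) : IsField (a.prodMode b l) := by
  constructor
  · intro n
    refine linear_continuous _ fun V hV => ?_
    obtain ⟨N, hN⟩ := a.prodMode_sub_mem b l n hV
    have hc : Continuous fun x => ∑ i ∈ Finset.range N, a.term b l n x i :=
      continuous_finsetSum _ fun i _ => a.continuous_term b l n i
    have h0 : ∑ i ∈ Finset.range N, a.term b l n 0 i = 0 := by
      refine Finset.sum_eq_zero fun i _ => ?_
      simp [Fields.term, normalProductTerm_eq]
    have := hc.tendsto 0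
    rw [h0] at this
    filter_upwards [this hV] with x hx
    have := V.sub_mem hx (hN x)
    simpa using this
  · intro U hU
    obtain ⟨V, hV, hVU⟩ := exists_submodule_subset hU
    obtain ⟨I, hI⟩ := a.exists_nat hV l
    obtain ⟨N₁, hN₁⟩ := b.2.2 V hV
    -- For `i ≥ I` the outer mode `a (l - i)` already lands in `V`; for the finitely many `i < I`
    -- its continuity turns `V` into a neighbourhood that the inner modes of `b` must reach.
    have h : ∀ i : ℕ, ∃ N : ℤ, ∀ n ≥ N, ∀ x, b (-n) x ∈ (a (l - i)) ⁻¹' V := fun i =>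
      b.2.2 _ (eventually_mem_of_continuous (a.continuous (l - i)) hV)
    choose N hN using h
    -- The sum dominates every `N i + i` with `i < I`; `N₁ + |l|` serves the terms in which `b` is
    -- the outer mode.
    refine ⟨max (N₁ + |l|) (∑ i ∈ Finset.range I, (|N i| + i)), fun n hn x => hVU ?_⟩
    refine hasSum_mem (a.hasSum_prodMode b l (-n) x) hV fun i => ?_
    rw [Fields.term, normalProductTerm_eq]
    refine V.sub_mem (V.smul_mem _ ?_) (V.smul_mem _ ?_)
    · by_cases hi : I ≤ i
      · exact hI i hi _
      · have h1 : |N i| + i ≤ ∑ i ∈ Finset.range I, (|N i| + (i : ℤ)) :=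
          Finset.single_le_sum (f := fun i : ℕ => |N i| + (i : ℤ)) (fun j _ => by positivity)
            (Finset.mem_range.2 (not_le.1 hi))
        have h2 := le_of_max_le_right hn
        have h3 := le_abs_self (N i)
        have := hN i (n - i) (by omega) x
        rwa [show -(n - (i : ℤ)) = -n + i by ring] at this
    · have h2 := le_of_max_le_left hn
      have h3 := le_abs_self l
      have := hN₁ (n - l + i) (by omega) (a i x)
      rwa [show -(n - l + (i : ℤ)) = -n + l - i by ring] at this

/-- The `l`-th product of two fields. -/
def Fields.prod (l : ℤ) : Fields M →ₗ[ℂ] Fields M →ₗ[ℂ] Fields M :=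
  LinearMap.mk₂ ℂ (fun a b => ⟨a.prodMode b l, a.isField_prodMode b l⟩)
    (fun a a' b => Fields.ext fun n x => by
      refine ((a + a').hasSum_prodMode b l n x).unique ?_
      convert (a.hasSum_prodMode b l n x).add (a'.hasSum_prodMode b l n x) using 2 with i
      · simp only [Fields.term, normalProductTerm_eq, Fields.add_apply, map_add, smul_add]; abel
      · rfl)
    (fun c a b => Fields.ext fun n x => by
      refine ((c • a).hasSum_prodMode b l n x).unique ?_
      convert (a.hasSum_prodMode b l n x).const_smul c using 2 with i
      · simp only [Fields.term, normalProductTerm_eq, Fields.smul_apply, map_smul, smul_sub,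
          smul_comm c]
      · rfl)
    (fun a b b' => Fields.ext fun n x => by
      refine (a.hasSum_prodMode (b + b') l n x).unique ?_
      convert (a.hasSum_prodMode b l n x).add (a.hasSum_prodMode b' l n x) using 2 with i
      · simp only [Fields.term, normalProductTerm_eq, Fields.add_apply, map_add, smul_add]; abel
      · rfl)
    (fun c a b => Fields.ext fun n x => by
      refine (a.hasSum_prodMode (c • b) l n x).unique ?_
      convert (a.hasSum_prodMode b l n x).const_smul c using 2 with i
      · simp only [Fields.term, normalProductTerm_eq, Fields.smul_apply, map_smul, smul_sub,
          smul_comm c]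
      · rfl)

theorem Fields.hasSum_prod (a b : Fields M) (l n : ℤ) (x : M) :
    HasSum (fun i : ℕ => signedChoose l i • a (l - i) (b (n + i) x)
      - ((-1 : ℂ) ^ l * signedChoose l i) • b (n + l - i) (a i x)) (Fields.prod l a b n x) := by
  have h := a.hasSum_prodMode b l n x
  rwa [show a.term b l n x = _ from funext fun i => normalProductTerm_eq _ _ l n x i] at h

/-- Multiplication of a field by a power of the variable. -/
def Fields.shift (m : ℤ) : Fields M →ₗ[ℂ] Fields M where
  toFun a := ⟨fun n => a (m + n), fun n => a.2.1 _, fun U hU => by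
    obtain ⟨N, hN⟩ := a.2.2 U hU
    refine ⟨N + m, fun n hn x => ?_⟩
    have := hN (n - m) (by omega) x
    rwa [show -(n - m) = m + -n by ring] at this⟩
  map_add' _ _ := rfl
  map_smul' _ _ := rfl

@[simp] theorem Fields.shift_apply (m n : ℤ) (a : Fields M) : Fields.shift m a n = a (m + n) := rfl

end Fields

theorem signedChoose_zero_right (l : ℤ) : signedChoose l 0 = 1 := by
  simp [signedChoose]

theorem signedChoose_succ_succ (l : ℤ) (i : ℕ) :
    signedChoose (l + 1) (i + 1) = signedChoose l (i + 1) - signedChoose l i := by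
  simp only [signedChoose, Ring.choose_succ_succ, pow_succ]
  push_cast
  ring

/-! ### Locality and the commutator formula -/

section Locality

variable {M : Type*} [AddCommGroup M] [Module ℂ M] [TopologicalSpace M] [CompleteLinear M]

/-- The coefficient form of `(z - w)^l z^(m+1) = (z - w)^(l+1) z^m + w (z - w)^l z^m`; the factor
`w` raises `n` by one. -/
theorem Fields.prod_shift_succ (a b : Fields M) (l m n : ℤ) (x : M) :
    Fields.prod l (Fields.shift (m + 1) a) b n x
      = Fields.prod (l + 1) (Fields.shift m a) b n x
        + Fields.prod l (Fields.shift m a) b (n + 1) x := by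
  have hD := ((Fields.hasSum_prod (Fields.shift m a) b (l + 1) n x).add
    (Fields.hasSum_prod (Fields.shift m a) b l (n + 1) x)).sub
    (Fields.hasSum_prod (Fields.shift (m + 1) a) b l n x)
  have hlim := (tendsto_add_atTop_iff_nat 1).2 hD.tendsto_sum_nat
  refine (sub_eq_zero.1 (tendsto_nhds_unique hlim ?_)).symm
  -- By Pascal's rule the partial sums telescope to two boundary terms, whose outer modes tend to
  -- zero as `K` grows.
  have key : ∀ K : ℕ, (∑ i ∈ Finset.range (K + 1),
      ((signedChoose (l + 1) i • (Fields.shift m a) (l + 1 - i) (b (n + i) x)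
        - ((-1 : ℂ) ^ (l + 1) * signedChoose (l + 1) i) •
          b (n + (l + 1) - i) ((Fields.shift m a) i x))
      + (signedChoose l i • (Fields.shift m a) (l - i) (b (n + 1 + i) x)
        - ((-1 : ℂ) ^ l * signedChoose l i) • b (n + 1 + l - i) ((Fields.shift m a) i x))
      - (signedChoose l i • (Fields.shift (m + 1) a) (l - i) (b (n + i) x)
        - ((-1 : ℂ) ^ l * signedChoose l i) • b (n + l - i) ((Fields.shift (m + 1) a) i x))))
      = signedChoose l K • a (m + l - K) (b (n + 1 + K) x)
        + ((-1 : ℂ) ^ l * signedChoose l K) • b (n + l - K) (a (m + 1 + K) x) := by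
    intro K
    induction K with
    | zero =>
      simp only [zero_add, Finset.sum_range_one, signedChoose_zero_right, Fields.shift_apply,
        zpow_add_one₀ (by norm_num : (-1 : ℂ) ≠ 0), Nat.cast_zero, add_zero, sub_zero]
      rw [show m + (l + 1) = m + 1 + l by ring, show n + (l + 1) = n + 1 + l by ring]
      module
    | succ K ih =>
      rw [Finset.sum_range_succ, ih]
      simp only [signedChoose_succ_succ, Fields.shift_apply,
        zpow_add_one₀ (by norm_num : (-1 : ℂ) ≠ 0), Nat.cast_add, Nat.cast_one]
      rw [show m + (l + 1 - ((K : ℤ) + 1)) = m + l - K by ring,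
        show n + ((K : ℤ) + 1) = n + 1 + K by ring,
        show n + (l + 1) - ((K : ℤ) + 1) = n + l - K by ring,
        show n + 1 + l - ((K : ℤ) + 1) = n + l - K by ring,
        show m + ((K : ℤ) + 1) = m + 1 + K by ring,
        show m + 1 + (l - ((K : ℤ) + 1)) = m + l - K by ring,
        show m + (l - ((K : ℤ) + 1)) = m + l - (K + 1) by ring]
      module
  refine Tendsto.congr (fun K => (key K).symm) (tendsto_zero_iff.2 fun V hV => ?_)
  obtain ⟨N, hN⟩ := a.exists_nat hV (m + l)
  obtain ⟨N', hN'⟩ := b.exists_nat hV (n + l)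
  exact eventually_atTop.2 ⟨max N N', fun i hi => V.add_mem
    (V.smul_mem _ (hN i (le_of_max_le_left hi) _)) (V.smul_mem _ (hN' i (le_of_max_le_right hi) _))⟩

/-- The fields `a` and `b` are mutually local of order `N`: `(z - w)^N [a(z), b(w)] = 0`. -/
def Fields.Local (N : ℤ) (a b : Fields M) : Prop :=
  ∀ m, Fields.prod N (Fields.shift m a) b = 0

theorem Fields.Local.succ {N : ℤ} {a b : Fields M} (h : Fields.Local N a b) :
    Fields.Local (N + 1) a b := by
  intro m
  refine Fields.ext fun n x => ?_
  have := Fields.prod_shift_succ a b N m n x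
  rw [h, h] at this
  simpa using this.symm

theorem Fields.Local.mono {N N' : ℤ} (hN : N ≤ N') {a b : Fields M} (h : Fields.Local N a b) :
    Fields.Local N' a b := by
  induction N', hN using Int.leInduction with
  | base => exact h
  | succ k _ ih => exact ih.succ

theorem Fields.shift_zero (a : Fields M) : Fields.shift 0 a = a :=
  Fields.ext fun n x => by simp

/-- The commutator formula (Borcherds identity) for local fields. -/
theorem Fields.Local.prod_shift {N : ℤ} {a b : Fields M} (h : Fields.Local N a b) (J : ℕ) (l : ℤ)
    (hJ : N ≤ l + J) (m n : ℤ) (x : M) :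
    Fields.prod l (Fields.shift m a) b n x
      = ∑ j ∈ Finset.range J, ((Ring.choose m j : ℤ) : ℂ) • Fields.prod (l + j) a b (m + n - j) x := by
  induction J generalizing l m n with
  | zero =>
    have := h.mono (by simpa using hJ) m
    simp [this]
  | succ J ih =>
    -- The defect of the formula at `(m + 1, n)` equals the defect at `(m, n + 1)`. It vanishes at
    -- `m = 0`, so induction in both directions kills it for every integer `m`.
    have step : ∀ m n : ℤ, (Fields.prod l (Fields.shift (m + 1) a) b n x
        - ∑ j ∈ Finset.range (J + 1), ((Ring.choose (m + 1) j : ℤ) : ℂ) •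
            Fields.prod (l + j) a b (m + 1 + n - j) x)
        = Fields.prod l (Fields.shift m a) b (n + 1) x
        - ∑ j ∈ Finset.range (J + 1), ((Ring.choose m j : ℤ) : ℂ) •
            Fields.prod (l + j) a b (m + (n + 1) - j) x := by
      intro m n
      rw [Fields.prod_shift_succ, ih (l + 1) (by push_cast at hJ; omega), Finset.sum_range_succ',
        Finset.sum_range_succ' _ J]
      have : ∑ k ∈ Finset.range J, ((Ring.choose (m + 1) (k + 1) : ℤ) : ℂ) •
            Fields.prod (l + (k + 1 : ℕ)) a b (m + 1 + n - (k + 1 : ℕ)) x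
          = ∑ k ∈ Finset.range J, (((Ring.choose m k : ℤ) : ℂ) •
            Fields.prod (l + 1 + k) a b (m + n - k) x + ((Ring.choose m (k + 1) : ℤ) : ℂ) •
            Fields.prod (l + (k + 1 : ℕ)) a b (m + (n + 1) - (k + 1 : ℕ)) x) := by
        refine Finset.sum_congr rfl fun k _ => ?_
        rw [Ring.choose_succ_succ]
        push_cast
        rw [add_smul, show l + ((k : ℤ) + 1) = l + 1 + k by ring,
          show m + 1 + n - ((k : ℤ) + 1) = m + n - k by ring,
          show m + (n + 1) - ((k : ℤ) + 1) = m + n - k by ring]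
      rw [this, Finset.sum_add_distrib]
      simp only [Ring.choose_zero_right, show m + 1 + n = m + (n + 1) by ring]
      abel
    suffices H : ∀ m n : ℤ, (Fields.prod l (Fields.shift m a) b n x
        - ∑ j ∈ Finset.range (J + 1), ((Ring.choose m j : ℤ) : ℂ) •
            Fields.prod (l + j) a b (m + n - j) x) = 0 from sub_eq_zero.1 (H m n)
    intro m
    induction m using Int.induction_on with
    | zero =>
      intro n
      rw [Fields.shift_zero, Finset.sum_range_succ']
      have : ∀ k : ℕ, Ring.choose (0 : ℤ) (k + 1) = 0 := fun k => Ring.choose_zero_succ ℤ k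
      simp [this]
    | succ i hi =>
      intro n
      rw [step]
      exact hi (n + 1)
    | pred i hi =>
      intro n
      have := step (-(i : ℤ) - 1) (n - 1)
      rw [sub_add_cancel, hi, sub_add_cancel] at this
      exact this.symm

end Locality

/-! ### Binomial identities -/

theorem ringChoose_neg (k j : ℕ) :
    ((Ring.choose (-((k : ℤ) + 1)) j : ℤ) : ℂ) = (-1) ^ j * ((k + j).choose j : ℂ) := by
  rw [Ring.choose_neg, show (k : ℤ) + 1 + j - 1 = ((k + j : ℕ) : ℤ) by push_cast; ring,
    Ring.choose_natCast]
  simp [Int.negOnePow_def, Units.smul_def]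

theorem signedChoose_neg (k i : ℕ) :
    signedChoose (-((k : ℤ) + 1)) i = ((k + i).choose i : ℂ) := by
  rw [signedChoose, ringChoose_neg, ← mul_assoc, ← mul_pow]
  simp

theorem neg_one_zpow_neg (k : ℕ) : (-1 : ℂ) ^ (-((k : ℤ) + 1)) = -(-1) ^ k := by
  rw [zpow_neg, ← inv_zpow, zpow_add_one₀ (by norm_num), zpow_natCast]
  norm_num

/-- The Chu-Vandermonde identity. -/
theorem signedChoose_add (l r : ℤ) (q : ℕ) :
    ∑ p ∈ Finset.HasAntidiagonal.antidiagonal q, signedChoose l p.1 * signedChoose r p.2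
      = signedChoose (l + r) q := by
  simp only [signedChoose]
  rw [Ring.add_choose_eq q (Commute.all l r)]
  push_cast
  rw [Finset.mul_sum]
  refine Finset.sum_congr rfl fun p hp => ?_
  rw [← Finset.HasAntidiagonal.mem_antidiagonal.1 hp, pow_add]
  ring

/-- Both sides are the multinomial coefficient `(k + i + j)! / (k! i! j!)`. -/
theorem choose_mul_choose_left (k i j : ℕ) :
    ((k + i).choose i : ℂ) * ((k + i + j).choose j : ℂ)
      = ((k + j).choose j : ℂ) * ((k + j + i).choose i : ℂ) := by
  norm_cast
  have h1 := Nat.add_choose_mul_factorial_mul_factorial k i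
  have h2 := Nat.add_choose_mul_factorial_mul_factorial (k + i) j
  have h3 := Nat.add_choose_mul_factorial_mul_factorial k j
  have h4 := Nat.add_choose_mul_factorial_mul_factorial (k + j) i
  rw [show k + j + i = k + i + j by ring] at h4 ⊢
  have hk := Nat.factorial_pos k
  have hi := Nat.factorial_pos i
  have hj := Nat.factorial_pos j
  refine Nat.eq_of_mul_eq_mul_right (Nat.mul_pos hk (Nat.mul_pos hi hj)) ?_
  calc _ = (k + i + j).choose j * ((k + i).choose i * k.factorial * i.factorial)
        * j.factorial := by ring
    _ = (k + i + j).choose i * ((k + j).choose j * k.factorial * j.factorial)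
        * i.factorial := by rw [h1, h2, h3, h4]
    _ = _ := by ring

theorem choose_mul_choose_add (k i j : ℕ) :
    ((k + (i + j)).choose (i + j) : ℂ) * ((i + j).choose j : ℂ)
      = ((k + j).choose j : ℂ) * ((k + j + i).choose i : ℂ) := by
  norm_cast
  have h1 := Nat.add_choose_mul_factorial_mul_factorial k (i + j)
  have h2 := Nat.add_choose_mul_factorial_mul_factorial i j
  have h3 := Nat.add_choose_mul_factorial_mul_factorial k j
  have h4 := Nat.add_choose_mul_factorial_mul_factorial (k + j) i
  rw [show k + (i + j) = k + j + i by ring] at h1 ⊢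
  have hk := Nat.factorial_pos k
  have hi := Nat.factorial_pos i
  have hj := Nat.factorial_pos j
  refine Nat.eq_of_mul_eq_mul_right (Nat.mul_pos hk (Nat.mul_pos hi hj)) ?_
  calc _ = (k + j + i).choose (i + j) * k.factorial *
        ((i + j).choose j * i.factorial * j.factorial) := by ring
    _ = (k + j + i).choose i * ((k + j).choose j * k.factorial * j.factorial)
        * i.factorial := by rw [h2, h1, h3, h4]
    _ = _ := by ring

/-- Once `choose_mul_choose_left` has extracted the factor depending on `j`, this is Chu-Vandermonde
for `l` and `-(k + j + 1)`. It collects the terms of `Fields.hasSum_contraction` in which `d` acts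
last. -/
theorem sum_antidiagonal_create (l : ℤ) (k j q : ℕ) :
    ∑ p ∈ Finset.HasAntidiagonal.antidiagonal q, signedChoose l p.1 * ((k + p.2).choose p.2 : ℂ)
        * ((Ring.choose (-((k : ℤ) + 1) - p.2) j : ℤ) : ℂ)
      = (-1) ^ j * ((k + j).choose j : ℂ) * signedChoose (l - (k + 1) - j) q := by
  rw [show l - ((k : ℤ) + 1) - j = l + -(((k + j : ℕ) : ℤ) + 1) by push_cast; ring,
    ← signedChoose_add, Finset.mul_sum]
  refine Finset.sum_congr rfl fun p _ => ?_
  rw [signedChoose_neg, show -((k : ℤ) + 1) - (p.2 : ℤ) = -(((k + p.2 : ℕ) : ℤ) + 1) by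
    push_cast; ring, ringChoose_neg]
  linear_combination signedChoose l p.1 * (-1) ^ j * choose_mul_choose_left k p.2 j

/-- The factor `p.2.choose j` kills the indices below `j`; shifting `p.2` by `j` turns the rest into
Chu-Vandermonde. It collects the terms in which `d` acts first. -/
theorem sum_antidiagonal_annihilate (l : ℤ) (k j q : ℕ) :
    ∑ p ∈ Finset.HasAntidiagonal.antidiagonal (q + j),
        signedChoose l p.1 * ((k + p.2).choose p.2 : ℂ) * (p.2.choose j : ℂ)
      = ((k + j).choose j : ℂ) * signedChoose (l - (k + 1) - j) q := by
  rw [show l - ((k : ℤ) + 1) - j = l + -(((k + j : ℕ) : ℤ) + 1) by push_cast; ring,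
    ← signedChoose_add, Finset.mul_sum]
  symm
  refine Finset.sum_of_injOn (fun p => (p.1, p.2 + j)) ?_ ?_ ?_ ?_
  · rintro ⟨a, b⟩ _ ⟨c, d⟩ _ h
    simp only [Prod.mk.injEq, Nat.add_right_cancel_iff] at h
    exact Prod.ext h.1 h.2
  · rintro ⟨a, b⟩ h
    have := Finset.HasAntidiagonal.mem_antidiagonal.1 (Finset.mem_coe.1 h)
    refine Finset.mem_coe.2 (Finset.HasAntidiagonal.mem_antidiagonal.2 ?_)
    simp only at this ⊢
    omega
  · rintro ⟨a, b⟩ h h'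
    have h1 := Finset.HasAntidiagonal.mem_antidiagonal.1 h
    simp only at h1
    have : b < j := by
      by_contra hb
      refine h' ⟨(a, b - j), Finset.mem_coe.2 (Finset.HasAntidiagonal.mem_antidiagonal.2 ?_), ?_⟩
      · simp only; omega
      · simp only [Prod.mk.injEq, true_and]; omega
    simp [Nat.choose_eq_zero_of_lt this]
  · rintro ⟨a, b⟩ _
    rw [signedChoose_neg]
    linear_combination -signedChoose l a * choose_mul_choose_add k b j

/-! ### Null double families and their sums -/

section Summation

variable {M : Type*} [AddCommGroup M] [Module ℂ M] [TopologicalSpace M] [CompleteLinear M]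

theorem summable_prod_of_null {F : ℕ × ℕ → M} (h0 : Tendsto F cofinite (𝓝 0)) : Summable F := by
  have hrow : ∀ i, Summable fun j => F (i, j) := fun i => by
    refine exists_hasSum_nat ?_
    rw [← Nat.cofinite_eq_atTop]
    exact h0.comp (Function.Injective.tendsto_cofinite fun a b h => (Prod.ext_iff.1 h).2)
  have hr : Summable fun i => ∑' j, F (i, j) := by
    refine exists_hasSum_nat (tendsto_zero_iff.2 fun V hV => ?_)
    have hfin : {p | F p ∉ V}.Finite := h0 hV
    rw [← Nat.cofinite_eq_atTop]
    refine (hfin.image Prod.fst).subset fun i hi => ?_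
    by_contra h
    refine hi (hasSum_mem (hrow i).hasSum hV fun j => ?_)
    by_contra hF
    exact h ⟨(i, j), hF, rfl⟩
  exact ⟨_, hasSum_prod_of_iterated h0 (fun i => (hrow i).hasSum) hr.hasSum⟩

theorem tendsto_cofinite_of_mod {F : ℕ × ℕ → M}
    (h : ∀ V : Submodule ℂ M, (V : Set M) ∈ 𝓝 (0 : M) →
      ∃ I : ℕ, (∀ p, I ≤ p.1 → F p ∈ V) ∧ ∀ i < I, ∃ J : ℕ, ∀ j, J ≤ j → F (i, j) ∈ V) :
    Tendsto F cofinite (𝓝 0) := by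
  refine tendsto_zero_iff.2 fun V hV => ?_
  obtain ⟨I, hI, hJ⟩ := h V hV
  choose! J hJ using hJ
  refine ((Finset.range I).sigma fun i => Finset.range (J i)).finite_toSet.image
    (fun p => (p.1, p.2)) |>.subset fun p hp => ?_
  have h1 : p.1 < I := by
    by_contra h1
    exact hp (hI p (not_lt.1 h1))
  have h2 : p.2 < J p.1 := by
    by_contra h2
    exact hp (hJ p.1 h1 p.2 (not_lt.1 h2))
  exact ⟨⟨p.1, p.2⟩, Finset.mem_coe.2 (Finset.mem_sigma.2
    ⟨Finset.mem_range.2 h1, Finset.mem_range.2 h2⟩), rfl⟩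

theorem Fields.null_add (a : Fields M) (c : ℤ) (u : ℕ × ℕ → ℂ) (y : ℕ × ℕ → M) :
    Tendsto (fun p : ℕ × ℕ => u p • a (c - (p.1 + p.2 : ℕ)) (y p)) cofinite (𝓝 0) := by
  refine tendsto_cofinite_of_mod fun V hV => ?_
  obtain ⟨N, hN⟩ := a.exists_nat hV c
  exact ⟨N, fun p hp => V.smul_mem _ (hN _ (by omega) _),
    fun i _ => ⟨N, fun j hj => V.smul_mem _ (hN _ (by omega) _)⟩⟩

/-- Large `p.1` is handled by the outer field, uniformly in its argument. For each remaining `p.1`,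
continuity of the outer mode pulls `V` back to a neighbourhood reached by the inner modes of `b`. -/
theorem Fields.null_comp (a b : Fields M) (c : ℤ) (d : ℕ → ℤ) (u : ℕ × ℕ → ℂ) (y : ℕ × ℕ → M) :
    Tendsto (fun p : ℕ × ℕ => u p • a (c - p.1) (b (d p.1 - p.2) (y p))) cofinite (𝓝 0) := by
  refine tendsto_cofinite_of_mod fun V hV => ?_
  obtain ⟨N, hN⟩ := a.exists_nat hV c
  refine ⟨N, fun p hp => V.smul_mem _ (hN _ hp _), fun i _ => ?_⟩
  obtain ⟨J, hJ⟩ := b.exists_nat (eventually_mem_of_continuous (a.continuous (c - i)) hV) (d i)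
  exact ⟨J, fun j hj => V.smul_mem _ (hJ j hj _)⟩

theorem Fields.null_comp' (a b : Fields M) (c : ℤ) (d : ℕ → ℤ) (u : ℕ × ℕ → ℂ) (y : ℕ × ℕ → M) :
    Tendsto (fun p : ℕ × ℕ => u p • a (c - p.2) (b (d p.2 - p.1) (y p))) cofinite (𝓝 0) :=
  (a.null_comp b c d (fun p => u (p.2, p.1)) fun p => y (p.2, p.1)).comp
    Prod.swap_injective.tendsto_cofinite

/-- The general product at `l = -(k + 1)`, where the signs `(-1)^i` cancel: the normally ordered
product with `∂^k φ / k!`. -/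
theorem Fields.hasSum_create (φ a : Fields M) (k : ℕ) (n : ℤ) (x : M) :
    HasSum (fun i : ℕ => ((k + i).choose i : ℂ) • φ (-((k : ℤ) + 1) - i) (a (n + i) x)
      + ((-1) ^ k * ((k + i).choose i : ℂ)) • a (n - (k + 1) - i) (φ i x))
      (Fields.prod (-((k : ℤ) + 1)) φ a n x) := by
  convert Fields.hasSum_prod φ a (-((k : ℤ) + 1)) n x using 2 with i
  rw [signedChoose_neg, neg_one_zpow_neg, neg_mul, neg_smul, sub_neg_eq_add, ← sub_eq_add_neg]

end Summation

/-! ### Products with a normally ordered first factor -/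

section Associativity

variable {M : Type*} [AddCommGroup M] [Module ℂ M] [TopologicalSpace M] [CompleteLinear M]

/-- The double series of the iterated product `(φ_(-k-1) a)_(l) b`. -/
theorem Fields.hasSum_prod_create (φ a b : Fields M) (k : ℕ) (l m n : ℤ) (x : M) :
    HasSum (fun p : ℕ × ℕ =>
      (signedChoose l p.1 * ((k + p.2).choose p.2 : ℂ)) •
          φ (-((k : ℤ) + 1) - p.2) (a (m + l + p.2 - p.1) (b (n + p.1) x))
      + (signedChoose l p.1 * ((-1) ^ k * ((k + p.2).choose p.2 : ℂ))) •
          a (m + l - (k + 1) - (p.1 + p.2 : ℕ)) (φ p.2 (b (n + p.1) x))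
      - ((((-1) ^ l * signedChoose l p.1) * ((k + p.2).choose p.2 : ℂ)) •
          b (n + l - p.1) (φ (-((k : ℤ) + 1) - p.2) (a (m + p.1 + p.2) x))
        + (((-1) ^ l * signedChoose l p.1) * ((-1) ^ k * ((k + p.2).choose p.2 : ℂ))) •
          b (n + l - p.1) (a (m + p.1 - (k + 1) - p.2) (φ p.2 x))))
      (Fields.prod l (Fields.shift m (Fields.prod (-((k : ℤ) + 1)) φ a)) b n x) := by
  refine hasSum_prod_of_iterated ?_ (r := fun p => signedChoose l p •
      Fields.prod (-((k : ℤ) + 1)) φ a (m + (l - p)) (b (n + p) x)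
      - ((-1 : ℂ) ^ l * signedChoose l p) •
        b (n + l - p) (Fields.prod (-((k : ℤ) + 1)) φ a (m + p) x)) ?_ ?_
  · have h1 := φ.null_comp' a (-((k : ℤ) + 1)) (fun i => m + l + i)
      (fun p => signedChoose l p.1 * ((k + p.2).choose p.2 : ℂ)) (fun p => b (n + p.1) x)
    have h2 := a.null_add (m + l - (k + 1))
      (fun p => signedChoose l p.1 * ((-1) ^ k * ((k + p.2).choose p.2 : ℂ)))
      (fun p => φ p.2 (b (n + p.1) x))
    have h3 := b.null_comp φ (n + l) (fun _ => -((k : ℤ) + 1))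
      (fun p => ((-1) ^ l * signedChoose l p.1) * ((k + p.2).choose p.2 : ℂ))
      (fun p => a (m + p.1 + p.2) x)
    have h4 := b.null_comp a (n + l) (fun i => m + i - (k + 1))
      (fun p => ((-1) ^ l * signedChoose l p.1) * ((-1) ^ k * ((k + p.2).choose p.2 : ℂ)))
      (fun p => φ p.2 x)
    simpa using (h1.add h2).sub (h3.add h4)
  · intro p
    have h1 := (φ.hasSum_create a k (m + (l - p)) (b (n + p) x)).const_smul (signedChoose l p)
    have h2 := ((φ.hasSum_create a k (m + p) x).map (b (n + l - p)) (b.continuous _)).const_smul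
      ((-1 : ℂ) ^ l * signedChoose l p)
    convert h1.sub h2 using 2 with i
    simp only [Function.comp_apply, map_add, map_smul, smul_add, smul_smul]
    rw [show m + (l - (p : ℤ)) + i = m + l + i - p by ring,
      show m + (l - (p : ℤ)) - (k + 1) - i = m + l - (k + 1) - (p + i : ℕ) by push_cast; ring]
  · exact Fields.hasSum_prod (Fields.shift m (Fields.prod (-((k : ℤ) + 1)) φ a)) b l n x

/-- The contribution of the `j`-th product of `φ` and `b` to `(φ_(-k-1) a)_(l) b`. -/
theorem Fields.hasSum_contraction (a d : Fields M) (k j : ℕ) (l m n : ℤ) (x : M) :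
    HasSum (fun p : ℕ × ℕ =>
      (signedChoose l p.1 * ((-1) ^ k * ((k + p.2).choose p.2 : ℂ)) * (p.2.choose j : ℂ)) •
        a (m + l - (k + 1) - (p.1 + p.2 : ℕ)) (d (n + (p.1 + p.2 : ℕ) - j) x)
      + ((-1) ^ l * signedChoose l p.1 * ((k + p.2).choose p.2 : ℂ)
          * ((Ring.choose (-((k : ℤ) + 1) - p.2) j : ℤ) : ℂ)) •
        d (n + l - (k + 1) - j - (p.1 + p.2 : ℕ)) (a (m + (p.1 + p.2 : ℕ)) x))
      (((-1) ^ k * ((k + j).choose j : ℂ)) •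
        Fields.prod (l - (k + 1) - j) (Fields.shift m a) d n x) := by
  have h1 := (summable_prod_of_null (a.null_add (m + l - (k + 1))
    (fun p => signedChoose l p.1 * ((-1) ^ k * ((k + p.2).choose p.2 : ℂ)) * (p.2.choose j : ℂ))
    (fun p => d (n + (p.1 + p.2 : ℕ) - j) x))).hasSum
  have h2 := (summable_prod_of_null (d.null_add (n + l - (k + 1) - j)
    (fun p => (-1) ^ l * signedChoose l p.1 * ((k + p.2).choose p.2 : ℂ)
          * ((Ring.choose (-((k : ℤ) + 1) - p.2) j : ℤ) : ℂ))
    (fun p => a (m + (p.1 + p.2 : ℕ)) x))).hasSum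
  have h1' := hasSum_antidiagonal h1
  have e1 : ∀ q : ℕ, (∑ p ∈ Finset.HasAntidiagonal.antidiagonal q,
      (signedChoose l p.1 * ((-1) ^ k * ((k + p.2).choose p.2 : ℂ)) * (p.2.choose j : ℂ)) •
        a (m + l - (k + 1) - (p.1 + p.2 : ℕ)) (d (n + (p.1 + p.2 : ℕ) - j) x))
      = ((-1) ^ k * ∑ p ∈ Finset.HasAntidiagonal.antidiagonal q,
        signedChoose l p.1 * ((k + p.2).choose p.2 : ℂ) * (p.2.choose j : ℂ)) •
        a (m + l - (k + 1) - q) (d (n + q - j) x) := by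
    intro q
    rw [Finset.mul_sum, Finset.sum_smul]
    refine Finset.sum_congr rfl fun p hp => ?_
    rw [Finset.HasAntidiagonal.mem_antidiagonal.1 hp]
    congr 1
    ring
  -- The antidiagonals `q < j` contribute nothing, so this series may start at `q = j`.
  have h1'' := (hasSum_nat_add_iff' j).2 h1'
  rw [Finset.sum_eq_zero (s := Finset.range j), sub_zero] at h1''
  swap
  · intro q hq
    rw [e1]
    rw [Finset.sum_eq_zero (fun p hp => ?_), mul_zero, zero_smul]
    have := Finset.HasAntidiagonal.mem_antidiagonal.1 hp
    have hq := Finset.mem_range.1 hq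
    rw [Nat.choose_eq_zero_of_lt (by omega : p.2 < j), Nat.cast_zero, mul_zero]
  have h2' := hasSum_antidiagonal h2
  have h12 := h1''.add h2'
  refine (?_ : ((-1) ^ k * ((k + j).choose j : ℂ)) •
        Fields.prod (l - (k + 1) - j) (Fields.shift m a) d n x = _) ▸ h1.add h2
  refine HasSum.unique ((Fields.hasSum_prod (Fields.shift m a) d (l - (k + 1) - j) n x).const_smul
    ((-1) ^ k * ((k + j).choose j : ℂ))) ?_
  convert h12 using 2 with q
  rw [e1, sum_antidiagonal_annihilate]
  have e2 : (∑ p ∈ Finset.HasAntidiagonal.antidiagonal q,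
      ((-1) ^ l * signedChoose l p.1 * ((k + p.2).choose p.2 : ℂ)
          * ((Ring.choose (-((k : ℤ) + 1) - p.2) j : ℤ) : ℂ)) •
        d (n + l - (k + 1) - j - (p.1 + p.2 : ℕ)) (a (m + (p.1 + p.2 : ℕ)) x))
      = ((-1) ^ l * ∑ p ∈ Finset.HasAntidiagonal.antidiagonal q,
        signedChoose l p.1 * ((k + p.2).choose p.2 : ℂ)
          * ((Ring.choose (-((k : ℤ) + 1) - p.2) j : ℤ) : ℂ)) •
        d (n + l - (k + 1) - j - q) (a (m + q) x) := by
    rw [Finset.mul_sum, Finset.sum_smul]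
    refine Finset.sum_congr rfl fun p hp => ?_
    rw [Finset.HasAntidiagonal.mem_antidiagonal.1 hp]
    congr 1
    ring
  rw [e2, sum_antidiagonal_create, smul_sub, smul_smul, smul_smul, sub_eq_add_neg, ← neg_smul]
  simp only [Fields.shift_apply]
  rw [show m + (l - ((k : ℤ) + 1) - j - q) = m + l - (k + 1) - (q + j : ℕ) by push_cast; ring,
    show n + ((q + j : ℕ) : ℤ) - j = n + q by push_cast; ring,
    show n + (l - ((k : ℤ) + 1) - j) - q = n + l - (k + 1) - j - q by ring]
  congr 2
  · ring
  · have : (-1 : ℂ) ^ (l - ((k : ℤ) + 1) - j) = -((-1) ^ l * (-1) ^ k * (-1) ^ j) := by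
      rw [zpow_sub₀ (by norm_num), zpow_sub₀ (by norm_num), zpow_add_one₀ (by norm_num),
        zpow_natCast, zpow_natCast, div_eq_mul_inv, div_eq_mul_inv, ← inv_pow, mul_inv, ← inv_pow]
      norm_num
    rw [this]
    have hk : ((-1 : ℂ) ^ k) * (-1) ^ k = 1 := by rw [← mul_pow]; norm_num
    linear_combination (((k + j).choose j : ℂ) * (-1) ^ l * (-1) ^ j *
      signedChoose (l - (k + 1) - j) q) * hk

/-- The product `(φ_(-k-1) a)_(l) b` when the commutators of `φ` with `b` are given by the
fields `d j`. -/
theorem Fields.hasSum_create_prod (φ a b : Fields M) (d : ℕ → Fields M) (J : ℕ)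
    (hcomm : ∀ (p q : ℤ) (x : M), φ p (b q x) - b q (φ p x)
      = ∑ j ∈ Finset.range J, ((Ring.choose p j : ℤ) : ℂ) • d j (p + q - j) x)
    (k : ℕ) (l m n : ℤ) (x : M) :
    HasSum (fun i : ℕ => ((k + i).choose i : ℂ) •
        φ (-((k : ℤ) + 1) - i) (Fields.prod l (Fields.shift (m + i) a) b n x)
      + ((-1) ^ k * ((k + i).choose i : ℂ)) •
        Fields.prod l (Fields.shift (m - (k + 1) - i) a) b n (φ i x))
      (Fields.prod l (Fields.shift m (Fields.prod (-((k : ℤ) + 1)) φ a)) b n x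
        - ∑ j ∈ Finset.range J, ((-1) ^ k * ((k + j).choose j : ℂ)) •
          Fields.prod (l - (k + 1) - j) (Fields.shift m a) (d j) n x) := by
  have hG := (Fields.hasSum_prod_create φ a b k l m n x).sub
    (hasSum_sum fun j (_ : j ∈ Finset.range J) => a.hasSum_contraction (d j) k j l m n x)
  -- Summing over `p` first keeps the mode of `φ` fixed, so that it can be moved to the far left
  -- (creation) or to the far right (annihilation).
  have hG' := (Equiv.prodComm ℕ ℕ).hasSum_iff.2 hG
  refine hG'.prod_fiberwise fun i => ?_
  have h1 := ((Fields.hasSum_prod (Fields.shift (m + i) a) b l n x).map (φ (-((k : ℤ) + 1) - i))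
    (φ.continuous _)).const_smul ((k + i).choose i : ℂ)
  have h2 := (Fields.hasSum_prod (Fields.shift (m - (k + 1) - i) a) b l n (φ i x)).const_smul
    ((-1) ^ k * ((k + i).choose i : ℂ))
  convert h1.add h2 using 2 with p
  simp only [Function.comp_apply, Equiv.prodComm_apply, Prod.fst_swap, Prod.snd_swap,
    Fields.shift_apply, map_sub, map_smul]
  -- `c1` moves the annihilation mode `φ i` past `b` to the right, `c2` moves the creation mode past
  -- `b` to the left; the corrections are the two sums in `hs`.
  have c1 := hcomm i (n + p) x
  have c2 := hcomm (-((k : ℤ) + 1) - i) (n + l - p) (a (m + p + i) x)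
  have c1' := congrArg (a (m + l - (k + 1) - (p + i : ℕ))) c1
  rw [map_sub, map_sum] at c1'
  rw [sub_eq_iff_eq_add] at c1' c2
  have hs : (∑ j ∈ Finset.range J,
      ((signedChoose l p * ((-1) ^ k * ((k + i).choose i : ℂ)) * (i.choose j : ℂ)) •
        a (m + l - (k + 1) - (p + i : ℕ)) (d j (n + (p + i : ℕ) - j) x)
      + ((-1) ^ l * signedChoose l p * ((k + i).choose i : ℂ)
          * ((Ring.choose (-((k : ℤ) + 1) - i) j : ℤ) : ℂ)) •
        d j (n + l - (k + 1) - j - (p + i : ℕ)) (a (m + (p + i : ℕ)) x)))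
      = (signedChoose l p * ((-1) ^ k * ((k + i).choose i : ℂ))) •
          ∑ j ∈ Finset.range J, a (m + l - (k + 1) - (p + i : ℕ))
            (((Ring.choose (i : ℤ) j : ℤ) : ℂ) • d j (i + (n + p) - j) x)
        + ((-1) ^ l * signedChoose l p * ((k + i).choose i : ℂ)) •
          ∑ j ∈ Finset.range J, ((Ring.choose (-((k : ℤ) + 1) - i) j : ℤ) : ℂ) •
            d j (-((k : ℤ) + 1) - i + (n + l - p) - j) (a (m + p + i) x) := by
    rw [Finset.smul_sum, Finset.smul_sum, ← Finset.sum_add_distrib]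
    refine Finset.sum_congr rfl fun j _ => ?_
    rw [map_smul, smul_smul, smul_smul, Ring.choose_natCast]
    push_cast
    rw [show n + ((p : ℤ) + i) - j = i + (n + p) - j by ring,
      show n + l - ((k : ℤ) + 1) - j - (p + i) = -((k : ℤ) + 1) - i + (n + l - p) - j by ring,
      show m + ((p : ℤ) + i) = m + p + i by ring]
  rw [hs, c1']
  push_cast
  rw [show m + (i : ℤ) + (l - p) = m + l + i - p by ring,
    show m + (i : ℤ) + p = m + p + i by ring,
    show m - ((k : ℤ) + 1) - i + (l - p) = m + l - (k + 1) - (p + i) by ring,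
    show m - ((k : ℤ) + 1) - i + p = m + p - (k + 1) - i by ring, c2]
  module

end Associativity

/-! ### Polynomials in commuting operators -/

section PolyAction

variable {ι F : Type*} [AddCommGroup F] [Module ℂ F]

/-- The linear map that sends a monomial to the product of the operators `L p`, applied to `v`. -/
def polyAction (L : ι → Module.End ℂ F) (v : F) : MvPolynomial ι ℂ →ₗ[ℂ] F :=
  (MvPolynomial.basisMonomials ι ℂ).constr ℂ
    fun s => (Finsupp.toMultiset s).toList.foldr (fun p w => L p w) v

theorem polyAction_apply (L : ι → Module.End ℂ F) (v : F) (a : MvPolynomial ι ℂ) :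
    polyAction L v a = ∑ s ∈ a.support,
      a.coeff s • (Finsupp.toMultiset s).toList.foldr (fun p w => L p w) v := by
  rw [polyAction, Module.Basis.constr_apply]
  rfl

theorem polyAction_monomial (L : ι → Module.End ℂ F) (v : F) (s : ι →₀ ℕ) :
    polyAction L v (MvPolynomial.monomial s 1)
      = (Finsupp.toMultiset s).toList.foldr (fun p w => L p w) v := by
  have := (MvPolynomial.basisMonomials ι ℂ).constr_basis ℂ
    (fun s => (Finsupp.toMultiset s).toList.foldr (fun p w => L p w) v) s
  rwa [MvPolynomial.coe_basisMonomials] at this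

theorem polyAction_one (L : ι → Module.End ℂ F) (v : F) : polyAction L v 1 = v := by
  have := polyAction_monomial L v 0
  simpa using this

/-- `Multiset.toList` chooses an arbitrary order of the factors; commutativity of the `L p` makes
the product independent of that choice. -/
theorem polyAction_X_mul {L : ι → Module.End ℂ F} (hL : ∀ p q w, L p (L q w) = L q (L p w)) (v : F)
    (p : ι) (a : MvPolynomial ι ℂ) :
    polyAction L v (MvPolynomial.X p * a) = L p (polyAction L v a) := by
  have key : (polyAction L v).comp (LinearMap.mulLeft ℂ (MvPolynomial.X p))
      = (L p).comp (polyAction L v) := by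
    refine (MvPolynomial.basisMonomials ι ℂ).ext fun s => ?_
    rw [MvPolynomial.coe_basisMonomials]
    simp only [LinearMap.comp_apply, LinearMap.mulLeft_apply]
    rw [MvPolynomial.X, MvPolynomial.monomial_mul, one_mul, polyAction_monomial,
      polyAction_monomial]
    have : LeftCommutative (fun p w => L p w) := ⟨fun p q w => hL p q w⟩
    have hperm : (Finsupp.toMultiset (Finsupp.single p 1 + s)).toList.Perm
        (p :: (Finsupp.toMultiset s).toList) := by
      rw [← Multiset.coe_eq_coe, Multiset.coe_toList, ← Multiset.cons_coe, Multiset.coe_toList,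
        Finsupp.toMultiset_add, Finsupp.toMultiset_single, one_smul, Multiset.singleton_add]
    rw [hperm.foldr_eq]
    rfl
  exact LinearMap.congr_fun key a

end PolyAction

/-! ### Normally ordered products with free fields commute -/

theorem normalProductTerm_negSucc {M : Type*} [AddCommGroup M] [Module ℂ M] (a b : ℤ → M → M)
    (k : ℕ) (n : ℤ) (x : M) (i : ℕ) :
    normalProductTerm a b (Int.negSucc k) n x i
      = ((k + i).choose i : ℂ) • a (-((k : ℤ) + 1) - i) (b (n + i) x)
        + ((-1) ^ k * ((k + i).choose i : ℂ)) • b (n - (k + 1) - i) (a i x) := by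
  rw [normalProductTerm_eq, Int.negSucc_eq, signedChoose_neg, neg_one_zpow_neg, neg_mul, neg_smul,
    sub_neg_eq_add, ← sub_eq_add_neg]

/-- Both iterated normally ordered products expand into one double series with four parts, summed by
rows or by columns. Only creation modes among themselves and annihilation modes among themselves
need to commute. The hypotheses are stated for bare families of operators so that both the discrete
Fock space and a topological module are covered. -/
theorem create_comm {M : Type*} [AddCommGroup M] [Module ℂ M] [TopologicalSpace M]
    [CompleteLinear M] {φ ψ B B₁ B₁' : ℤ → Module.End ℂ M}
    (hφ : ∀ n, Continuous (φ n)) (hψ : ∀ n, Continuous (ψ n)) {k j : ℕ} {n : ℤ} {x S S' : M}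
    (h₁ : ∀ n x, HasSum (normalProductTerm (fun m => ⇑(φ m)) (fun m => ⇑(B m)) (Int.negSucc k) n x)
      (B₁ n x))
    (h₁' : ∀ n x, HasSum
      (normalProductTerm (fun m => ⇑(ψ m)) (fun m => ⇑(B m)) (Int.negSucc j) n x) (B₁' n x))
    (h₂ : HasSum (normalProductTerm (fun m => ⇑(ψ m)) (fun m => ⇑(B₁ m)) (Int.negSucc j) n x) S)
    (h₂' : HasSum (normalProductTerm (fun m => ⇑(φ m)) (fun m => ⇑(B₁' m)) (Int.negSucc k) n x) S')
    (hneg : ∀ (i i' : ℕ) y, ψ (-((j : ℤ) + 1) - i) (φ (-((k : ℤ) + 1) - i') y)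
      = φ (-((k : ℤ) + 1) - i') (ψ (-((j : ℤ) + 1) - i) y))
    (hpos : ∀ (i i' : ℕ) y, ψ i (φ i' y) = φ i' (ψ i y))
    (hnull₁ : Tendsto (fun p : ℕ × ℕ => (((j + p.1).choose p.1 : ℂ) * ((k + p.2).choose p.2 : ℂ)) •
      ψ (-((j : ℤ) + 1) - p.1) (φ (-((k : ℤ) + 1) - p.2) (B (n + p.1 + p.2) x))) cofinite (𝓝 0))
    (hnull₂ : Tendsto (fun p : ℕ × ℕ => (((j + p.1).choose p.1 : ℂ) *
      ((-1) ^ k * ((k + p.2).choose p.2 : ℂ))) •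
      ψ (-((j : ℤ) + 1) - p.1) (B (n + p.1 - (k + 1) - p.2) (φ p.2 x))) cofinite (𝓝 0))
    (hnull₃ : Tendsto (fun p : ℕ × ℕ => (((-1) ^ j * ((j + p.1).choose p.1 : ℂ)) *
      ((k + p.2).choose p.2 : ℂ)) •
      φ (-((k : ℤ) + 1) - p.2) (B (n + p.2 - (j + 1) - p.1) (ψ p.1 x))) cofinite (𝓝 0))
    (hnull₄ : Tendsto (fun p : ℕ × ℕ => (((-1) ^ j * ((j + p.1).choose p.1 : ℂ)) *
      ((-1) ^ k * ((k + p.2).choose p.2 : ℂ))) •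
      B (n - (j + 1) - (k + 1) - (p.1 + p.2 : ℕ)) (φ p.2 (ψ p.1 x))) cofinite (𝓝 0)) :
    S = S' := by
  have hn := ((hnull₁.add hnull₂).add (hnull₃.add hnull₄))
  simp only [add_zero] at hn
  refine hasSum_unique_of_swap (F := fun i' i =>
    ((((j + i').choose i' : ℂ) * ((k + i).choose i : ℂ)) •
      ψ (-((j : ℤ) + 1) - i') (φ (-((k : ℤ) + 1) - i) (B (n + i' + i) x))
    + (((j + i').choose i' : ℂ) * ((-1) ^ k * ((k + i).choose i : ℂ))) •
      ψ (-((j : ℤ) + 1) - i') (B (n + i' - (k + 1) - i) (φ i x)))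
    + ((((-1) ^ j * ((j + i').choose i' : ℂ)) * ((k + i).choose i : ℂ)) •
      φ (-((k : ℤ) + 1) - i) (B (n + i - (j + 1) - i') (ψ i' x))
    + (((-1) ^ j * ((j + i').choose i' : ℂ)) * ((-1) ^ k * ((k + i).choose i : ℂ))) •
      B (n - (j + 1) - (k + 1) - (i' + i : ℕ)) (φ i (ψ i' x)))) hn ?_ h₂ ?_ h₂'
  · intro i'
    rw [normalProductTerm_negSucc]
    have e1 := ((h₁ (n + i') x).map (ψ (-((j : ℤ) + 1) - i')) (hψ _)).const_smul
      ((j + i').choose i' : ℂ)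
    have e2 := (h₁ (n - (j + 1) - i') (ψ i' x)).const_smul ((-1) ^ j * ((j + i').choose i' : ℂ))
    convert e1.add e2 using 2 with i
    rw [Function.comp_apply, normalProductTerm_negSucc, normalProductTerm_negSucc, map_add,
      map_smul, map_smul, smul_add, smul_add, smul_smul, smul_smul, smul_smul, smul_smul,
      show n - ((j : ℤ) + 1) - i' + i = n + i - (j + 1) - i' by ring,
      show n - ((j : ℤ) + 1) - i' - (k + 1) - i = n - (j + 1) - (k + 1) - (i' + i : ℕ) by
        push_cast; ring]
  · intro i
    rw [normalProductTerm_negSucc]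
    have e1 := ((h₁' (n + i) x).map (φ (-((k : ℤ) + 1) - i)) (hφ _)).const_smul
      ((k + i).choose i : ℂ)
    have e2 := (h₁' (n - (k + 1) - i) (φ i x)).const_smul ((-1) ^ k * ((k + i).choose i : ℂ))
    convert e1.add e2 using 2 with i'
    rw [Function.comp_apply, normalProductTerm_negSucc, normalProductTerm_negSucc, map_add,
      map_smul, map_smul, smul_add, smul_add, smul_smul, smul_smul, smul_smul, smul_smul,
      show n - ((k : ℤ) + 1) - i + i' = n + i' - (k + 1) - i by ring,
      show n - ((k : ℤ) + 1) - i - (j + 1) - i' = n - (j + 1) - (k + 1) - (i' + i : ℕ) by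
        push_cast; ring, show n + (i : ℤ) + i' = n + i' + i by ring, hneg, hpos]
    module

/-! ### The vertex operators on the Fock space -/

/-- The polynomial algebra underlying the Fock space. -/
abbrev Poly (g : ℕ) : Type := MvPolynomial (Gen g × ℕ) ℂ

/-- The constants `c` with `φ(z) ψ(w) ∼ c / (z - w)`. -/
def pairing {g : ℕ} : Gen g → Gen g → ℂ
  | Sum.inl i, Sum.inr j => if i = j then 2 * Real.pi * Complex.I else 0
  | Sum.inr i, Sum.inl j => if i = j then -(2 * Real.pi * Complex.I) else 0
  | _, _ => 0

variable {g : ℕ}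

theorem mode_neg (φ : Gen g) (k : ℕ) (b : Poly g) :
    mode φ (-((k : ℤ) + 1)) b = MvPolynomial.X (φ, k) * b := by
  rw [← Int.negSucc_eq]
  cases φ <;> rfl

theorem mode_neg_sub (φ : Gen g) (k i : ℕ) (b : Poly g) :
    mode φ (-((k : ℤ) + 1) - i) b = MvPolynomial.X (φ, k + i) * b := by
  rw [← mode_neg]
  congr 2
  push_cast
  ring

theorem mode_nonneg_one (φ : Gen g) (j : ℕ) : mode φ (j : ℤ) (1 : Poly g) = 0 := by
  rw [← Int.ofNat_eq_natCast]
  cases φ <;> simp [mode]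

/-- The nonnegative modes are multiples of derivations; this Leibniz rule drives the inductions over
polynomials. -/
theorem mode_nonneg_X_mul (φ ψ : Gen g) (j k : ℕ) (b : Poly g) :
    mode φ (j : ℤ) (MvPolynomial.X (ψ, k) * b)
      = MvPolynomial.X (ψ, k) * mode φ (j : ℤ) b + (if j = k then pairing φ ψ else 0) • b := by
  classical
  rw [← Int.ofNat_eq_natCast]
  rcases φ with φ | φ <;> rcases ψ with ψ | ψ <;>
    simp only [mode, pairing, LinearMap.smul_apply, Derivation.coeFn_coe, MvPolynomial.pderiv_mul, MvPolynomial.pderiv_X, Pi.single_apply,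
      Prod.mk.injEq, Sum.inl.injEq, Sum.inr.injEq, reduceCtorEq, false_and, if_false, zero_mul,
      zero_add, smul_add, mul_smul_comm, ite_self, zero_smul, add_zero] <;>
    by_cases h1 : φ = ψ <;> by_cases h2 : j = k <;>
    simp [h1, h2, eq_comm, add_comm]

theorem exists_mode_eq_zero (φ : Gen g) (b : Poly g) :
    ∃ J : ℕ, ∀ j : ℕ, J ≤ j → mode φ (j : ℤ) b = 0 := by
  refine MvPolynomial.induction_on (motive := fun b => ∃ J : ℕ, ∀ j : ℕ, J ≤ j →
    mode φ (j : ℤ) b = 0) b (fun c => ⟨0, fun j _ => ?_⟩) ?_ ?_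
  · rw [MvPolynomial.C_eq_smul_one, map_smul, mode_nonneg_one, smul_zero]
  · rintro p q ⟨J, hJ⟩ ⟨J', hJ'⟩
    refine ⟨max J J', fun j hj => ?_⟩
    rw [map_add, hJ j (le_of_max_le_left hj), hJ' j (le_of_max_le_right hj), add_zero]
  · rintro p ⟨ψ, k⟩ ⟨J, hJ⟩
    refine ⟨max J (k + 1), fun j hj => ?_⟩
    have h1 := le_of_max_le_right hj
    rw [mul_comm, mode_nonneg_X_mul, hJ j (le_of_max_le_left hj), if_neg (by omega)]
    simp

theorem mode_nonneg_comm (φ ψ : Gen g) (i j : ℕ) (b : Poly g) :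
    mode φ (i : ℤ) (mode ψ (j : ℤ) b) = mode ψ (j : ℤ) (mode φ (i : ℤ) b) := by
  refine MvPolynomial.induction_on (motive := fun b => mode φ (i : ℤ) (mode ψ (j : ℤ) b)
    = mode ψ (j : ℤ) (mode φ (i : ℤ) b)) b (fun c => ?_) ?_ ?_
  · rw [MvPolynomial.C_eq_smul_one]
    simp only [map_smul, mode_nonneg_one, map_zero]
  · intro p q hp hq
    simp only [map_add, hp, hq]
  · rintro p ⟨χ, k⟩ h
    rw [mul_comm]
    simp only [mode_nonneg_X_mul, map_add, map_smul, h]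
    abel

/-- The families of operators on the Fock space that are fields in the usual sense. -/
def fockFields (g : ℕ) : Submodule ℂ (ℤ → Module.End ℂ (Poly g)) where
  carrier := {B | ∀ b, ∃ N : ℤ, ∀ n ≥ N, B n b = 0}
  add_mem' := by
    intro B B' h h' b
    obtain ⟨N, hN⟩ := h b
    obtain ⟨N', hN'⟩ := h' b
    refine ⟨max N N', fun n hn => ?_⟩
    change B n b + B' n b = 0
    rw [hN n (le_of_max_le_left hn), hN' n (le_of_max_le_right hn), add_zero]
  zero_mem' := fun _ => ⟨0, fun _ _ => rfl⟩
  smul_mem' := by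
    intro c B h b
    obtain ⟨N, hN⟩ := h b
    refine ⟨N, fun n hn => ?_⟩
    change c • B n b = 0
    rw [hN n hn, smul_zero]

/-- The terms of the normally ordered product of `∂^k φ / k!` and `B`. -/
abbrev fockTerm (p : Gen g × ℕ) (B : ℤ → Module.End ℂ (Poly g)) (n : ℤ) (b : Poly g) : ℕ → Poly g :=
  normalProductTerm (fun m => ⇑(mode p.1 m)) (fun m => ⇑(B m)) (Int.negSucc p.2) n b

theorem exists_fockTerm_eq_zero (p : Gen g × ℕ) (B : fockFields g) (n : ℤ) (b : Poly g) :
    ∃ I : ℕ, ∀ i, I ≤ i → fockTerm p B.1 n b i = 0 := by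
  obtain ⟨N, hN⟩ := B.2 b
  obtain ⟨J, hJ⟩ := exists_mode_eq_zero p.1 b
  refine ⟨max (N - n).toNat J, fun i hi => ?_⟩
  have h1 := Int.toNat_le.1 (le_of_max_le_left hi)
  rw [fockTerm, normalProductTerm_negSucc, hN _ (by omega), hJ i (le_of_max_le_right hi)]
  simp

theorem fockTerm_finite (p : Gen g × ℕ) (B : fockFields g) (n : ℤ) (b : Poly g) :
    Function.HasFiniteSupport (fockTerm p B.1 n b) := by
  obtain ⟨I, hI⟩ := exists_fockTerm_eq_zero p B n b
  refine (Finset.range I).finite_toSet.subset fun i hi => ?_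
  by_contra h
  exact hi (hI i (by simpa using h))

/-- The normally ordered product with `∂^k φ / k!`. -/
def fockCreate (p : Gen g × ℕ) : Module.End ℂ (fockFields g) where
  toFun B := ⟨fun n =>
    { toFun := fun b => ∑ᶠ i, fockTerm p B.1 n b i
      map_add' := fun b b' => by
        rw [← finsum_add_distrib (fockTerm_finite p B n b) (fockTerm_finite p B n b')]
        refine finsum_congr fun i => ?_
        simp only [fockTerm, normalProductTerm_negSucc, map_add, smul_add]
        abel
      map_smul' := fun c b => by
        rw [RingHom.id_apply, smul_finsum' c (fockTerm_finite p B n b)]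
        refine finsum_congr fun i => ?_
        simp only [fockTerm, normalProductTerm_negSucc, map_smul, smul_add, smul_comm c] }, by
    intro b
    obtain ⟨N, hN⟩ := B.2 b
    obtain ⟨J, hJ⟩ := exists_mode_eq_zero p.1 b
    choose N' hN' using fun i : ℕ => B.2 (mode p.1 (i : ℤ) b)
    -- Only the annihilation terms with `i < J` can survive, and the sum dominates each of their
    -- bounds `N' i + i`, with `p.2 + 1` added for the shift of the mode.
    refine ⟨max N (∑ i ∈ Finset.range J, (|N' i| + i) + (p.2 + 1)), fun n hn => ?_⟩
    refine finsum_eq_zero_of_forall_eq_zero fun i => ?_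
    have h1 := le_of_max_le_left hn
    have h2 := le_of_max_le_right hn
    rw [fockTerm, normalProductTerm_negSucc, hN _ (by omega), map_zero, smul_zero, zero_add]
    by_cases hi : i < J
    · have h3 : |N' i| + i ≤ ∑ i ∈ Finset.range J, (|N' i| + (i : ℤ)) :=
        Finset.single_le_sum (f := fun i : ℕ => |N' i| + (i : ℤ)) (fun j _ => by positivity)
          (Finset.mem_range.2 hi)
      have h4 := le_abs_self (N' i)
      rw [hN' i _ (by omega), smul_zero]
    · rw [hJ i (not_lt.1 hi), map_zero, smul_zero]⟩
  map_add' B B' := Subtype.ext <| funext fun n => LinearMap.ext fun b => by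
    change ∑ᶠ i, fockTerm p (B + B').1 n b i
      = ∑ᶠ i, fockTerm p B.1 n b i + ∑ᶠ i, fockTerm p B'.1 n b i
    rw [← finsum_add_distrib (fockTerm_finite p B n b) (fockTerm_finite p B' n b)]
    refine finsum_congr fun i => ?_
    simp only [fockTerm, normalProductTerm_negSucc, Submodule.coe_add, Pi.add_apply,
      LinearMap.add_apply, map_add, smul_add]
    abel
  map_smul' c B := Subtype.ext <| funext fun n => LinearMap.ext fun b => by
    change ∑ᶠ i, fockTerm p (c • B).1 n b i = c • ∑ᶠ i, fockTerm p B.1 n b i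
    rw [smul_finsum' c (fockTerm_finite p B n b)]
    refine finsum_congr fun i => ?_
    simp only [fockTerm, normalProductTerm_negSucc, Submodule.coe_smul, Pi.smul_apply,
      LinearMap.smul_apply, map_smul, smul_add, smul_comm c]

theorem fockCreate_apply (p : Gen g × ℕ) (B : fockFields g) (n : ℤ) (b : Poly g) :
    (fockCreate p B).1 n b = ∑ᶠ i, fockTerm p B.1 n b i := rfl

/-- This lets the finite sums on the Fock space be treated by the same summation lemmas, through the
discrete topology. -/
theorem completeLinear_of_discrete (M : Type*) [AddCommGroup M] [Module ℂ M] [TopologicalSpace M]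
    [DiscreteTopology M] : CompleteLinear M :=
  { complete := fun v hv => by
      obtain ⟨N, hN⟩ := hv {0} (by simp)
      refine ⟨v N, tendsto_atTop_of_eventually_const (i₀ := N) fun i hi => ?_⟩
      exact sub_eq_zero.1 (hN i hi N le_rfl) }

theorem fockCreate_comm (p q : Gen g × ℕ) (B : fockFields g) :
    fockCreate p (fockCreate q B) = fockCreate q (fockCreate p B) := by
  let _ : TopologicalSpace (Poly g) := ⊥
  have : DiscreteTopology (Poly g) := ⟨rfl⟩
  have := completeLinear_of_discrete (Poly g)
  obtain ⟨ψ, j⟩ := p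
  obtain ⟨φ, k⟩ := q
  have hs : ∀ (p : Gen g × ℕ) (B : fockFields g) (n : ℤ) (b : Poly g),
      HasSum (fockTerm p B.1 n b) ((fockCreate p B).1 n b) := by
    intro p B n b
    rw [fockCreate_apply, ← tsum_eq_finsum (L := .unconditional _) (fockTerm_finite p B n b)]
    exact (summable_of_hasFiniteSupport (fockTerm_finite p B n b)).hasSum
  refine Subtype.ext (funext fun n => LinearMap.ext fun x => ?_)
  obtain ⟨N, hN⟩ := B.2 x
  obtain ⟨I, hI⟩ := exists_mode_eq_zero φ x
  obtain ⟨J, hJ⟩ := exists_mode_eq_zero ψ x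
  have hdisc : ∀ V : Submodule ℂ (Poly g), ∀ y : Poly g, y = 0 → y ∈ V :=
    fun V y hy => hy ▸ V.zero_mem
  refine create_comm (fun _ => continuous_of_discreteTopology)
    (fun _ => continuous_of_discreteTopology) (hs (φ, k) B) (hs (ψ, j) B)
    (hs (ψ, j) (fockCreate (φ, k) B) n x) (hs (φ, k) (fockCreate (ψ, j) B) n x) ?_ ?_ ?_ ?_ ?_ ?_
  · intro i i' y
    simp only [mode_neg_sub]
    ring
  · intro i i' y
    exact mode_nonneg_comm _ _ _ _ _
  · refine tendsto_cofinite_of_mod fun V _ => ⟨(N - n).toNat, fun p hp => hdisc V _ ?_,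
      fun i _ => ⟨(N - n).toNat, fun i' hi' => hdisc V _ ?_⟩⟩
    · have := Int.toNat_le.1 hp
      rw [hN _ (by omega)]; simp
    · have := Int.toNat_le.1 hi'
      rw [hN _ (by push_cast; omega)]; simp
  -- The annihilation index `p.2` has to be bounded before the other one, so the criterion is
  -- applied to the transposed family.
  · have h : Tendsto (fun p : ℕ × ℕ => (((j + p.2).choose p.2 : ℂ) *
        ((-1) ^ k * ((k + p.1).choose p.1 : ℂ))) •
        mode ψ (-((j : ℤ) + 1) - p.2) (B.1 (n + p.2 - (k + 1) - p.1) (mode φ p.1 x)))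
        cofinite (𝓝 0) := by
      refine tendsto_cofinite_of_mod fun V _ => ⟨I, fun p hp => hdisc V _ ?_, fun i _ => ?_⟩
      · rw [hI _ hp]; simp
      · obtain ⟨N', hN'⟩ := B.2 (mode φ i x)
        refine ⟨(N' - n + (k + 1) + i).toNat, fun i' hi' => hdisc V _ ?_⟩
        have := Int.toNat_le.1 hi'
        rw [hN' _ (by push_cast; omega)]; simp
    simpa only [Function.comp_def, Prod.fst_swap, Prod.snd_swap] using
      h.comp Prod.swap_injective.tendsto_cofinite
  · refine tendsto_cofinite_of_mod fun V _ => ⟨J, fun p hp => hdisc V _ ?_, fun i _ => ?_⟩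
    · rw [hJ _ hp]; simp
    · obtain ⟨N', hN'⟩ := B.2 (mode ψ i x)
      refine ⟨(N' - n + (j + 1) + i).toNat, fun i' hi' => hdisc V _ ?_⟩
      have := Int.toNat_le.1 hi'
      rw [hN' _ (by push_cast; omega)]; simp
  · refine tendsto_cofinite_of_mod fun V _ => ⟨J, fun p hp => hdisc V _ ?_, fun i _ => ?_⟩
    · rw [hJ _ hp]; simp
    · obtain ⟨I', hI'⟩ := exists_mode_eq_zero φ (mode ψ i x)
      exact ⟨I', fun i' hi' => hdisc V _ (by rw [hI' _ hi']; simp)⟩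

/-- The vertex operator of the vacuum. -/
def fockOne (g : ℕ) : fockFields g :=
  ⟨fun n => if n = -1 then LinearMap.id else 0, fun b => ⟨0, fun n hn => by
    rw [show (fun n : ℤ => if n = -1 then LinearMap.id else (0 : Module.End ℂ (Poly g))) n = 0 from
      if_neg (by omega)]; rfl⟩⟩

/-- The state-field correspondence of the Fock space. -/
def fockY (g : ℕ) : Poly g →ₗ[ℂ] fockFields g := polyAction fockCreate (fockOne g)

theorem monomialMode_eq (s : List (Gen g × ℕ)) (n : ℤ) (b : Poly g) :
    monomialMode s n b = (s.foldr (fun p w => fockCreate p w) (fockOne g)).1 n b := by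
  induction s generalizing n b with
  | nil =>
    by_cases h : n = -1 <;> simp [monomialMode, fockOne, h]
  | cons p s ih =>
    obtain ⟨φ, k⟩ := p
    rw [monomialMode, List.foldr_cons, fockCreate_apply]
    refine finsum_congr fun i => ?_
    rw [fockTerm, show monomialMode s = _ from funext fun n => funext fun b => ih n b]

/-- Passes from the prescribed products, written with lists and monomials, to the linear map
`fockY`, on which induction over polynomials is available. -/
theorem nprod_eq (a b : Poly g) (n : ℤ) :
    (VertexOperations.nprod (V := Fock g) a n b : Poly g) = (fockY g a).1 n b := by
  rw [fockY, polyAction_apply, Submodule.coe_sum, Finset.sum_apply, LinearMap.sum_apply]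
  refine Finset.sum_congr rfl fun s _ => ?_
  rw [monomialMode_eq]
  rfl

theorem fockY_one (n : ℤ) (b : Poly g) : (fockY g 1).1 n b = if n = -1 then b else 0 := by
  rw [fockY, polyAction_one, fockOne]
  by_cases h : n = -1 <;> simp [h]

theorem fockY_X_mul_eq (p : Gen g × ℕ) (a : Poly g) :
    fockY g (MvPolynomial.X p * a) = fockCreate p (fockY g a) := by
  rw [fockY, polyAction_X_mul]
  intro p q w
  rw [fockCreate_comm]

/-- Every large truncation `J` is allowed, so that it can be matched with the cut-offs for
commutators and locality. -/
theorem fockY_X_mul (φ : Gen g) (k : ℕ) (a b : Poly g) (n : ℤ) :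
    ∃ J₀ : ℕ, ∀ J ≥ J₀, (fockY g (MvPolynomial.X (φ, k) * a)).1 n b
      = ∑ i ∈ Finset.range J, (((k + i).choose i : ℂ) •
          (MvPolynomial.X (φ, k + i) * (fockY g a).1 (n + i) b)
        + ((-1) ^ k * ((k + i).choose i : ℂ)) • (fockY g a).1 (n - (k + 1) - i) (mode φ i b)) := by
  obtain ⟨I, hI⟩ := exists_fockTerm_eq_zero (φ, k) (fockY g a) n b
  refine ⟨I, fun J hJ => ?_⟩
  have hsub : Function.support (fockTerm (φ, k) (fockY g a).1 n b) ⊆ ↑(Finset.range J) := by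
    intro i hi
    by_contra h
    exact hi (hI i (hJ.trans (by simpa using h)))
  rw [fockY_X_mul_eq, fockCreate_apply, finsum_eq_sum_of_support_subset _ hsub]
  refine Finset.sum_congr rfl fun i _ => ?_
  rw [fockTerm, normalProductTerm_negSucc, mode_neg_sub]

/-! ### The module structure defined by modes with free commutators -/

section FreeFields

variable {g : ℕ} {M : Type*} [AddCommGroup M] [Module ℂ M] [TopologicalSpace M] [CompleteLinear M]

/-- The commutation relations of the `β`-`γ` system. -/
def FreeRelations (f : Gen g → Fields M) : Prop :=
  ∀ φ ψ (m n : ℤ) (x : M), f φ m (f ψ n x) - f ψ n (f φ m x)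
    = (if m + n + 1 = 0 then pairing φ ψ else 0) • x

variable (M) in
/-- The identity field. -/
def Fields.one : Fields M :=
  ⟨fun n => if n = -1 then LinearMap.id else 0, fun n => by
    by_cases h : n = -1
    · simp only [h, if_true]; exact continuous_id
    · simp only [h, if_false]; exact continuous_const, fun U hU => ⟨2, fun n hn x => by
    have h : ¬ -n = -1 := by omega
    simp only [h, if_false]
    exact mem_of_mem_nhds hU⟩⟩

theorem Fields.one_apply (n : ℤ) (x : M) : Fields.one M n x = if n = -1 then x else 0 := by
  by_cases h : n = -1 <;> simp [Fields.one, h]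

/-- The normally ordered product with `∂^k φ / k!`. -/
def create (f : Gen g → Fields M) (p : Gen g × ℕ) : Module.End ℂ (Fields M) :=
  Fields.prod (-((p.2 : ℤ) + 1)) (f p.1)

theorem create_commute {f : Gen g → Fields M} (hf : FreeRelations f) (p q : Gen g × ℕ)
    (B : Fields M) : create f p (create f q B) = create f q (create f p B) := by
  obtain ⟨ψ, j⟩ := p
  obtain ⟨φ, k⟩ := q
  have hs : ∀ (φ : Gen g) (k : ℕ) (B : Fields M) (n : ℤ) (x : M),
      HasSum (normalProductTerm (fun m => ⇑(f φ m)) (fun m => ⇑(B m)) (Int.negSucc k) n x)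
        (create f (φ, k) B n x) := by
    intro φ k B n x
    have := (f φ).hasSum_prodMode B (Int.negSucc k) n x
    rw [Int.negSucc_eq] at this ⊢
    exact this
  have hcomm : ∀ φ ψ (m n : ℤ), m + n + 1 ≠ 0 → ∀ x, f φ m (f ψ n x) = f ψ n (f φ m x) := by
    intro φ ψ m n h x
    have := hf φ ψ m n x
    rw [if_neg h, zero_smul] at this
    exact sub_eq_zero.1 this
  refine Fields.ext fun n x => ?_
  refine create_comm (f φ).continuous (f ψ).continuous (hs φ k B) (hs ψ j B)
    (hs ψ j (create f (φ, k) B) n x) (hs φ k (create f (ψ, j) B) n x) ?_ ?_ ?_ ?_ ?_ ?_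
  · intro i i' y
    exact hcomm _ _ _ _ (by omega) y
  · intro i i' y
    exact hcomm _ _ _ _ (by omega) y
  · exact (f ψ).null_comp (f φ) (-((j : ℤ) + 1)) (fun _ => -((k : ℤ) + 1)) _ _
  · exact (f ψ).null_comp B (-((j : ℤ) + 1)) (fun i => n + i - (k + 1)) _ _
  · exact (f φ).null_comp' B (-((k : ℤ) + 1)) (fun i => n + i - (j + 1)) _ _
  · exact B.null_add (n - (j + 1) - (k + 1)) _ _

/-- The fields of the states of the Fock space. -/
def vertexField (f : Gen g → Fields M) : Poly g →ₗ[ℂ] Fields M :=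
  polyAction (create f) (Fields.one M)

theorem vertexField_one (f : Gen g → Fields M) : vertexField f 1 = Fields.one M :=
  polyAction_one _ _

theorem vertexField_X_mul {f : Gen g → Fields M} (hf : FreeRelations f) (φ : Gen g) (k : ℕ)
    (a : Poly g) : vertexField f (MvPolynomial.X (φ, k) * a)
      = Fields.prod (-((k : ℤ) + 1)) (f φ) (vertexField f a) := by
  rw [vertexField, polyAction_X_mul]
  · rfl
  · intro p q w
    rw [create_commute hf]

theorem vertexField_gen {f : Gen g → Fields M} (hf : FreeRelations f) (φ : Gen g) :
    vertexField f (MvPolynomial.X (φ, 0)) = f φ := by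
  rw [← mul_one (MvPolynomial.X (φ, 0)), vertexField_X_mul hf, vertexField_one]
  refine Fields.ext fun n x => ((f φ).hasSum_create (Fields.one M) 0 n x).unique ?_
  simp only [Fields.one_apply, zero_add, Nat.choose_self, Nat.cast_one, one_smul, pow_zero, one_mul,
    Nat.cast_zero]
  -- The identity field has the single mode `-1`, which selects one term: a creation term for `n <
  -- 0`, an annihilation term for `n ≥ 0`.
  rcases lt_or_ge n 0 with hn | hn
  · obtain ⟨i, rfl⟩ : ∃ i : ℕ, n = -1 - i := ⟨(-1 - n).toNat, by omega⟩
    convert hasSum_single i ?_ using 1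
    · rw [if_pos (by ring), if_neg (by omega), add_zero]
    · intro i' hi'
      rw [if_neg (by omega), if_neg (by omega), map_zero, add_zero]
  · obtain ⟨i, rfl⟩ : ∃ i : ℕ, n = i := ⟨n.toNat, by omega⟩
    convert hasSum_single i ?_ using 1
    · rw [if_neg (by omega), if_pos (by ring), map_zero, zero_add]
    · intro i' hi'
      rw [if_neg (by omega), if_neg (by omega), map_zero, add_zero]

/-- The commutator formula for a generating field and an arbitrary field. -/
theorem exists_commutator {f : Gen g → Fields M} (hf : FreeRelations f) (φ : Gen g)
    (b : Poly g) : ∃ J₀ : ℕ, ∀ J ≥ J₀, ∀ (p q : ℤ) (x : M),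
      f φ p (vertexField f b q x) - vertexField f b q (f φ p x)
        = ∑ j ∈ Finset.range J, ((Ring.choose p j : ℤ) : ℂ) •
          vertexField f (mode φ j b) (p + q - j) x := by
  refine MvPolynomial.induction_on (motive := fun b => ∃ J₀ : ℕ, ∀ J ≥ J₀, ∀ (p q : ℤ) (x : M),
      f φ p (vertexField f b q x) - vertexField f b q (f φ p x)
        = ∑ j ∈ Finset.range J, ((Ring.choose p j : ℤ) : ℂ) •
          vertexField f (mode φ j b) (p + q - j) x) b (fun c => ⟨0, fun J _ p q x => ?_⟩) ?_ ?_
  · rw [MvPolynomial.C_eq_smul_one, map_smul, vertexField_one]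
    simp only [map_smul, mode_nonneg_one, map_zero, smul_zero, Fields.zero_apply,
      Finset.sum_const_zero, Fields.smul_apply, Fields.one_apply]
    by_cases h : q = -1 <;> simp [h]
  · rintro a b ⟨J, hJ⟩ ⟨J', hJ'⟩
    refine ⟨max J J', fun K hK p q x => ?_⟩
    simp only [map_add, Fields.add_apply, smul_add, Finset.sum_add_distrib]
    rw [← hJ K (le_of_max_le_left hK), ← hJ' K (le_of_max_le_right hK)]
    abel
  · rintro b ⟨ψ, k⟩ ⟨J, hJ⟩
    refine ⟨max J (k + 1), fun K hK p q x => ?_⟩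
    have hJ := hJ K (le_of_max_le_left hK)
    have hk : k < K := le_of_max_le_right hK
    rw [mul_comm b]
    simp only [mode_nonneg_X_mul, map_add, map_smul, vertexField_X_mul hf, Fields.add_apply,
      Fields.smul_apply, smul_add, Finset.sum_add_distrib]
    set B := vertexField f b with hB
    have h1 := (((f ψ).hasSum_create B k q x).map (f φ p) ((f φ).continuous p)).sub
      ((f ψ).hasSum_create B k q (f φ p x))
    have h2 := hasSum_sum fun j (_ : j ∈ Finset.range K) =>
      ((f ψ).hasSum_create (vertexField f (mode φ j b)) k (p + q - j) x).const_smul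
        ((Ring.choose p j : ℤ) : ℂ)
    -- The commutator of `φ` and `ψ` is a scalar, and at most one `i` contributes: from the
    -- annihilation half if `p < 0`, from the creation half if `p ≥ k`, and none if `0 ≤ p < k`.
    have h3 : HasSum (fun i : ℕ => ((k + i).choose i : ℂ) •
          (if p + (-((k : ℤ) + 1) - i) + 1 = 0 then pairing φ ψ else 0) • B (q + i) x
        + ((-1) ^ k * ((k + i).choose i : ℂ)) •
          (if p + i + 1 = 0 then pairing φ ψ else 0) • B (q - (k + 1) - i) x)
        (((Ring.choose p k : ℤ) : ℂ) • pairing φ ψ • B (p + q - k) x) := by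
      rcases lt_or_ge p 0 with hp | hp
      · obtain ⟨i, rfl⟩ : ∃ i : ℕ, p = -((i : ℤ) + 1) := ⟨(-1 - p).toNat, by omega⟩
        convert hasSum_single i ?_ using 1
        · rw [if_neg (by omega), if_pos (by ring), zero_smul, smul_zero, zero_add, ringChoose_neg,
            add_comm i k, Nat.choose_symm_add,
            show -((i : ℤ) + 1) + q - k = q - (k + 1) - i by ring]
        · intro i' hi'
          rw [if_neg (by omega), if_neg (by omega)]
          simp
      · obtain ⟨m, rfl⟩ : ∃ m : ℕ, p = m := ⟨p.toNat, by omega⟩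
        rcases lt_or_ge m k with hm | hm
        · rw [Ring.choose_natCast, Nat.choose_eq_zero_of_lt hm]
          convert hasSum_zero using 2 with i
          · rw [if_neg (by omega), if_neg (by omega)]
            simp
          · simp
        · obtain ⟨i, rfl⟩ := Nat.exists_eq_add_of_le hm
          convert hasSum_single i ?_ using 1
          · rw [if_pos (by push_cast; ring), if_neg (by omega), zero_smul, smul_zero, add_zero,
              Ring.choose_natCast, Nat.choose_symm_add, Int.cast_natCast,
              show ((k + i : ℕ) : ℤ) + q - k = q + i by push_cast; ring]
          · intro i' hi'
            rw [if_neg (by push_cast; omega), if_neg (by omega)]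
            simp
    have h4 : ∑ j ∈ Finset.range K, ((Ring.choose p j : ℤ) : ℂ) •
        ((if j = k then pairing φ ψ else 0) • B (p + q - j) x)
        = ((Ring.choose p k : ℤ) : ℂ) • pairing φ ψ • B (p + q - k) x := by
      rw [Finset.sum_eq_single k]
      · rw [if_pos rfl]
      · intro j _ hj
        rw [if_neg hj, zero_smul, smul_zero]
      · intro h
        exact absurd (Finset.mem_range.2 hk) h
    rw [h4]
    refine h1.unique ?_
    convert h2.add h3 using 2 with i
    simp only [Function.comp_apply, map_add, map_smul]
    -- `c1` and `c4` commute `φ` with `ψ`; `c2` and `c3` are the induction hypothesis for `φ` and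
    -- `B`.
    have c1 := hf φ ψ p (-((k : ℤ) + 1) - i) (B (q + i) x)
    have c2 := congrArg (f ψ (-((k : ℤ) + 1) - i)) (hJ p (q + i) x)
    have c3 := hJ p (q - (k + 1) - i) (f ψ i x)
    have c4 := congrArg (B (q - (k + 1) - i)) (hf φ ψ p i x)
    rw [map_sub, map_sum] at c2
    rw [map_sub, map_smul] at c4
    have hsum : ∑ j ∈ Finset.range K, ((Ring.choose p j : ℤ) : ℂ) •
        (((k + i).choose i : ℂ) • f ψ (-((k : ℤ) + 1) - i)
            (vertexField f (mode φ j b) (p + q - j + i) x)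
          + ((-1) ^ k * ((k + i).choose i : ℂ)) •
            vertexField f (mode φ j b) (p + q - j - (k + 1) - i) (f ψ i x))
        = ((k + i).choose i : ℂ) • (∑ j ∈ Finset.range K, f ψ (-((k : ℤ) + 1) - i)
            (((Ring.choose p j : ℤ) : ℂ) • vertexField f (mode φ j b) (p + (q + i) - j) x))
          + ((-1) ^ k * ((k + i).choose i : ℂ)) • ∑ j ∈ Finset.range K,
            ((Ring.choose p j : ℤ) : ℂ) •
              vertexField f (mode φ j b) (p + (q - (k + 1) - i) - j) (f ψ i x) := by
      rw [Finset.smul_sum, Finset.smul_sum, ← Finset.sum_add_distrib]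
      refine Finset.sum_congr rfl fun j _ => ?_
      rw [map_smul, show p + (q + i) - (j : ℤ) = p + q - j + i by ring,
        show p + (q - (k + 1) - i) - (j : ℤ) = p + q - j - (k + 1) - i by ring]
      module
    rw [hsum, ← c1, ← c2, ← c3, ← c4]
    module

end FreeFields

/-! ### Locality of the vertex operators and the Borcherds identity -/

section ModuleStructure

variable {g : ℕ} {M : Type*} [AddCommGroup M] [Module ℂ M] [TopologicalSpace M] [CompleteLinear M]

theorem signedChoose_zero_left (i : ℕ) : signedChoose 0 i = if i = 0 then 1 else 0 := by
  rw [signedChoose, Ring.choose_zero_ite]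
  by_cases h : i = 0 <;> simp [h]

theorem Fields.local_one (b : Fields M) : Fields.Local 0 (Fields.one M) b := by
  intro m
  refine Fields.ext fun n x => (Fields.hasSum_prod _ b 0 n x).unique ?_
  convert hasSum_zero using 2 with i
  · rw [signedChoose_zero_left]
    by_cases h : i = 0
    · subst h
      simp only [Fields.shift_apply, Fields.one_apply]
      by_cases hm : m = -1 <;> simp [hm]
    · simp [h]
  · rfl

theorem Fields.Local.add {N N' : ℤ} {a a' b : Fields M} (h : Fields.Local N a b)
    (h' : Fields.Local N' a' b) : Fields.Local (max N N') (a + a') b := by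
  intro m
  rw [map_add, map_add, LinearMap.add_apply, h.mono (le_max_left N N') m,
    h'.mono (le_max_right N N') m, add_zero]

theorem Fields.Local.smul {N : ℤ} {a b : Fields M} (h : Fields.Local N a b) (c : ℂ) :
    Fields.Local N (c • a) b := by
  intro m
  rw [map_smul, map_smul, LinearMap.smul_apply, h m, smul_zero]

/-- Induction on the factors of `a`. At large order every term of `Fields.hasSum_create_prod`
vanishes: the products with `b` itself, and the finitely many contractions with `mode φ j b`, whose
order is lower by `k + 1 + j`. -/
theorem exists_local {f : Gen g → Fields M} (hf : FreeRelations f) (a : Poly g) :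
    ∀ b : Poly g, ∃ N : ℤ, Fields.Local N (vertexField f a) (vertexField f b) := by
  refine MvPolynomial.induction_on (motive := fun a => ∀ b : Poly g, ∃ N : ℤ,
    Fields.Local N (vertexField f a) (vertexField f b)) a ?_ ?_ ?_
  · intro c b
    rw [MvPolynomial.C_eq_smul_one, map_smul, vertexField_one]
    exact ⟨0, (Fields.local_one _).smul c⟩
  · intro a a' h h' b
    obtain ⟨N, hN⟩ := h b
    obtain ⟨N', hN'⟩ := h' b
    rw [map_add]
    exact ⟨_, hN.add hN'⟩
  · rintro a ⟨φ, k⟩ h b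
    obtain ⟨J, hJ⟩ := exists_commutator hf φ b
    obtain ⟨N, hN⟩ := h b
    choose N' hN' using fun j : ℕ => h (mode φ j b)
    rw [mul_comm, vertexField_X_mul hf]
    refine ⟨max N (∑ j ∈ Finset.range J, (|N' j| + j) + (k + 1)), fun m => ?_⟩
    refine Fields.ext fun n x => ?_
    have hK := Fields.hasSum_create_prod (f φ) (vertexField f a) (vertexField f b)
      (fun j => vertexField f (mode φ j b)) J (hJ J le_rfl) k
      (max N (∑ j ∈ Finset.range J, (|N' j| + j) + (k + 1))) m n x
    obtain ⟨L, hL⟩ : ∃ L, L = max N (∑ j ∈ Finset.range J, (|N' j| + (j : ℤ)) + (k + 1)) := ⟨_, rfl⟩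
    rw [← hL] at hK ⊢
    rw [Finset.sum_eq_zero, sub_zero] at hK
    · refine hK.unique ?_
      have hNL : N ≤ L := hL ▸ le_max_left _ _
      convert hasSum_zero using 2 with i
      · rw [hN.mono hNL, hN.mono hNL, Fields.zero_apply, Fields.zero_apply]
        simp
      · rfl
    · intro j hj
      have h1 : |N' j| + j ≤ ∑ j ∈ Finset.range J, (|N' j| + (j : ℤ)) :=
        Finset.single_le_sum (f := fun j : ℕ => |N' j| + (j : ℤ)) (fun j _ => by positivity) hj
      have h2 := le_abs_self (N' j)
      have h3 := le_max_right N (∑ j ∈ Finset.range J, (|N' j| + (j : ℤ)) + (k + 1))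
      rw [(hN' j).mono (by omega)]
      simp

theorem Fields.one_prod (b : Fields M) (l : ℤ) :
    Fields.prod l (Fields.one M) b = if l = -1 then b else 0 := by
  refine Fields.ext fun n x => (Fields.hasSum_prod _ b l n x).unique ?_
  have h0 : ∀ i : ℕ, Fields.one M (i : ℤ) x = 0 := fun i => by
    rw [Fields.one_apply, if_neg (by omega)]
  simp only [h0, map_zero, smul_zero, sub_zero, Fields.one_apply]
  by_cases hl : l = -1
  · subst hl
    rw [if_pos rfl]
    convert hasSum_single 0 ?_ using 1
    · simp [signedChoose_zero_right]
    · intro i hi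
      rw [if_neg (by omega), smul_zero]
  · rw [if_neg hl]
    convert hasSum_zero using 2 with i
    · by_cases h : l - i = -1
      · obtain ⟨l', rfl⟩ : ∃ l' : ℕ, l = l' := ⟨l.toNat, by omega⟩
        rw [signedChoose, Ring.choose_natCast, Nat.choose_eq_zero_of_lt (by omega)]
        simp
      · rw [if_neg h, smul_zero]
    · rfl

/-- The sum over the creation part of the associativity formula. -/
theorem hasSum_create_taylor (φ : Fields M) (c : ℕ → Fields M) (k J : ℕ) (n : ℤ) (x : M) :
    HasSum (fun i : ℕ => ((k + i).choose i : ℂ) • φ (-((k : ℤ) + 1) - i)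
          (∑ j ∈ Finset.range J, ((Ring.choose (i : ℤ) j : ℤ) : ℂ) • c j (i + n - j) x)
      + ((-1) ^ k * ((k + i).choose i : ℂ)) •
          ∑ j ∈ Finset.range J, ((Ring.choose (-((k : ℤ) + 1) - i) j : ℤ) : ℂ) •
            c j (-((k : ℤ) + 1) - i + n - j) (φ i x))
      (∑ j ∈ Finset.range J, ((k + j).choose j : ℂ) •
        Fields.prod (-(((k + j : ℕ) : ℤ) + 1)) φ (c j) n x) := by
  have main : ∀ j : ℕ, HasSum (fun i : ℕ =>
      (((k + i).choose i : ℂ) * (i.choose j : ℂ)) • φ (-((k : ℤ) + 1) - i) (c j (i + n - j) x)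
      + ((-1) ^ k * ((k + i).choose i : ℂ) * ((Ring.choose (-((k : ℤ) + 1) - i) j : ℤ) : ℂ)) •
            c j (-((k : ℤ) + 1) - i + n - j) (φ i x))
      (((k + j).choose j : ℂ) • Fields.prod (-(((k + j : ℕ) : ℤ) + 1)) φ (c j) n x) := by
    intro j
    have s1 : Summable fun i : ℕ => (((k + i).choose i : ℂ) * (i.choose j : ℂ)) •
        φ (-((k : ℤ) + 1) - i) (c j (i + n - j) x) := by
      refine exists_hasSum_nat (tendsto_zero_iff.2 fun V hV => ?_)
      obtain ⟨N, hN⟩ := φ.exists_nat hV (-((k : ℤ) + 1))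
      exact eventually_atTop.2 ⟨N, fun i hi => V.smul_mem _ (hN i hi _)⟩
    have s2 : Summable fun i : ℕ => ((-1) ^ k * ((k + i).choose i : ℂ) *
        ((Ring.choose (-((k : ℤ) + 1) - i) j : ℤ) : ℂ)) •
            c j (-((k : ℤ) + 1) - i + n - j) (φ i x) := by
      refine exists_hasSum_nat (tendsto_zero_iff.2 fun V hV => ?_)
      obtain ⟨N, hN⟩ := (c j).exists_nat hV (-((k : ℤ) + 1) + n - j)
      refine eventually_atTop.2 ⟨N, fun i hi => V.smul_mem _ ?_⟩
      rw [show -((k : ℤ) + 1) - i + n - j = -((k : ℤ) + 1) + n - j - i by ring]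
      exact hN i hi _
    -- The factor `i.choose j` vanishes for `i < j`; shifting `i` by `j` produces the creation
    -- series of order `k + j`.
    have h1 := (hasSum_nat_add_iff' j).2 s1.hasSum
    rw [Finset.sum_eq_zero (s := Finset.range j), sub_zero] at h1
    swap
    · intro i hi
      rw [Nat.choose_eq_zero_of_lt (Finset.mem_range.1 hi)]
      simp
    refine (?_ : ((k + j).choose j : ℂ) • Fields.prod (-(((k + j : ℕ) : ℤ) + 1)) φ (c j) n x = _)
      ▸ s1.hasSum.add s2.hasSum
    refine ((φ.hasSum_create (c j) (k + j) n x).const_smul ((k + j).choose j : ℂ)).unique ?_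
    convert h1.add s2.hasSum using 2 with i
    rw [choose_mul_choose_add, show -((k : ℤ) + 1) - i = -(((k + i : ℕ) : ℤ) + 1) by push_cast; ring,
      ringChoose_neg, smul_add, smul_smul, smul_smul,
      show ((i + j : ℕ) : ℤ) + n - j = n + i by push_cast; ring,
      show -((k : ℤ) + 1) - (i + j : ℕ) = -(((k + j : ℕ) : ℤ) + 1) - i by push_cast; ring,
      show -(((k + i : ℕ) : ℤ) + 1) + n - j = n - ((k + j : ℕ) + 1) - i by push_cast; ring]
    congr 2
    rw [pow_add]
    linear_combination (-(-1) ^ k * (-1) ^ j) * choose_mul_choose_left k i j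
  convert hasSum_sum fun j (_ : j ∈ Finset.range J) => main j using 2 with i
  rw [map_sum, Finset.smul_sum, Finset.smul_sum, ← Finset.sum_add_distrib]
  refine Finset.sum_congr rfl fun j _ => ?_
  rw [map_smul, smul_smul, smul_smul, Ring.choose_natCast, Int.cast_natCast]

/-- The Borcherds identity. -/
theorem vertexField_nprod {f : Gen g → Fields M} (hf : FreeRelations f) (a : Poly g) :
    ∀ (b : Poly g) (l : ℤ), vertexField f ((fockY g a).1 l b)
      = Fields.prod l (vertexField f a) (vertexField f b) := by
  refine MvPolynomial.induction_on (motive := fun a => ∀ (b : Poly g) (l : ℤ),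
    vertexField f ((fockY g a).1 l b)
      = Fields.prod l (vertexField f a) (vertexField f b)) a ?_ ?_ ?_
  · intro c b l
    rw [MvPolynomial.C_eq_smul_one, map_smul, map_smul, map_smul, vertexField_one,
      LinearMap.smul_apply, Fields.one_prod, Submodule.coe_smul, Pi.smul_apply,
      LinearMap.smul_apply, fockY_one, map_smul]
    by_cases h : l = -1 <;> simp [h]
  · intro a a' h h' b l
    have e : (fockY g (a + a')).1 l b = (fockY g a).1 l b + (fockY g a').1 l b := by
      rw [map_add]
      rfl
    rw [e, map_add, h, h', map_add (vertexField f), map_add, LinearMap.add_apply]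
  · rintro a ⟨φ, k⟩ h b l
    obtain ⟨J₁, hJ₁⟩ := exists_commutator hf φ b
    obtain ⟨J₂, hJ₂⟩ := fockY_X_mul φ k a b l
    obtain ⟨N, hN⟩ := exists_local hf a b
    -- One cut-off serves the commutators with `b`, the finite expansion on the Fock space, and the
    -- vanishing of the products of order at least `l + J`.
    let J := max (max J₁ J₂) (N - l).toNat
    have hJ1 : J₁ ≤ J := (le_max_left _ _).trans (le_max_left _ _)
    have hJ2 : J₂ ≤ J := (le_max_right _ _).trans (le_max_left _ _)
    have hJN : N ≤ l + J := by
      have := Int.toNat_le.1 (le_max_right (max J₁ J₂) (N - l).toNat)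
      change N - l ≤ (J : ℤ) at this
      omega
    rw [mul_comm, hJ₂ J hJ2, map_sum, vertexField_X_mul hf]
    simp only [map_add, map_smul, h, vertexField_X_mul hf]
    refine Fields.ext fun n x => ?_
    rw [Finset.sum_add_distrib, Fields.add_apply, Fields.sum_apply, Fields.sum_apply,
      ← eq_sub_iff_add_eq]
    have hK := Fields.hasSum_create_prod (f φ) (vertexField f a) (vertexField f b)
      (fun j => vertexField f (mode φ j b)) J (hJ₁ J hJ1) k l 0 n x
    simp only [Fields.shift_zero] at hK
    -- The annihilation terms from the Fock space are the contractions in `hK`. What remains are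
    -- products with shifted `a`, which locality expands in unshifted ones and
    -- `hasSum_create_taylor` resums.
    have hT := hasSum_create_taylor (f φ)
      (fun j => Fields.prod (l + j) (vertexField f a) (vertexField f b)) k J n x
    refine hT.unique ?_
    convert hK using 2 with i
    · rw [hN.prod_shift J l hJN, hN.prod_shift J l hJN, zero_add, zero_sub, ← neg_add_eq_sub,
        neg_add_eq_sub]
    · exact Finset.sum_congr rfl fun _ _ => rfl

/-- The module structure over the `β`-`γ` system defined by its free fields. -/
def moduleStructure (f : Gen g → Fields M) : Fock g →ₗ[ℂ] ℤ → Module.End ℂ M where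
  toFun a := (vertexField f (a : Poly g)).1
  map_add' a b := congrArg Subtype.val ((vertexField f).map_add (a : Poly g) (b : Poly g))
  map_smul' c a := congrArg Subtype.val ((vertexField f).map_smul c (a : Poly g))

/-- The signed binomial coefficients at `-2` are `i + 1`. For `n ≠ 0` the only surviving index has
`i + 1 = |n|`; for `n = 0` nothing survives. -/
theorem Fields.prod_neg_two_one (a : Fields M) (n : ℤ) (x : M) :
    Fields.prod (-2) a (Fields.one M) n x = (-(n : ℂ)) • a (n - 1) x := by
  refine (Fields.hasSum_prod a (Fields.one M) (-2) n x).unique ?_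
  have hc : ∀ i : ℕ, signedChoose (-2) i = (i : ℂ) + 1 := by
    intro i
    have := signedChoose_neg 1 i
    rw [show -(((1 : ℕ) : ℤ) + 1) = -2 by norm_num] at this
    rw [this, add_comm 1 i, Nat.choose_succ_self_right]
    push_cast
    ring
  simp only [hc, Fields.one_apply]
  rcases lt_trichotomy n 0 with hn | rfl | hn
  · obtain ⟨i, rfl⟩ : ∃ i : ℕ, n = -((i : ℤ) + 1) := ⟨(-1 - n).toNat, by omega⟩
    convert hasSum_single i ?_ using 1
    · rw [if_pos (by ring), if_neg (by omega), smul_zero, sub_zero,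
        show -((i : ℤ) + 1) - 1 = -2 - i by ring]
      push_cast
      rw [neg_neg]
    · intro i' hi'
      rw [if_neg (by omega), if_neg (by omega), map_zero, smul_zero, smul_zero, sub_zero]
  · convert hasSum_zero using 2 with i
    · rw [if_neg (by omega), if_neg (by omega), map_zero, smul_zero, smul_zero, sub_zero]
    · simp
  · obtain ⟨i, rfl⟩ : ∃ i : ℕ, n = (i : ℤ) + 1 := ⟨(n - 1).toNat, by omega⟩
    convert hasSum_single i ?_ using 1
    · rw [if_neg (by omega), if_pos (by ring), map_zero, smul_zero, zero_sub, add_sub_cancel_right,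
        ← neg_smul]
      congr 1
      push_cast
      norm_num
    · intro i' hi'
      rw [if_neg (by omega), if_neg (by omega), map_zero, smul_zero, smul_zero, sub_zero]

theorem moduleStructure_isLinearTopologicalModule {f : Gen g → Fields M} (hf : FreeRelations f) :
    IsLinearTopologicalModule (moduleStructure f) where
  completeLinear := CompleteLinear.isCompleteLinear M
  field a := (vertexField f (a : Poly g)).2
  vacuum n := by
    change vertexField f (1 : Poly g) n = _
    rw [vertexField_one]
    rfl
  borcherds a b l n x := by
    have h := ((vertexField f (a : Poly g)).hasSum_prodMode (vertexField f (b : Poly g)) l n x)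
    have e : moduleStructure f (VertexOperations.nprod a l b) n x
        = Fields.prod l (vertexField f (a : Poly g)) (vertexField f (b : Poly g)) n x :=
      (congrArg (fun y => vertexField f y n x) (nprod_eq (g := g) a b l)).trans
        (congrArg (fun y : Fields M => y n x) (vertexField_nprod hf a b l))
    rw [e]
    exact h.tendsto_sum_nat
  derivative a n := by
    refine LinearMap.ext fun x => ?_
    have e : moduleStructure f (translation a) n x
        = Fields.prod (-2) (vertexField f (a : Poly g)) (vertexField f (1 : Poly g)) n x :=
      (congrArg (fun y => vertexField f y n x) (nprod_eq (g := g) a 1 (-2))).trans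
        (congrArg (fun y : Fields M => y n x) (vertexField_nprod hf a 1 (-2)))
    rw [e, vertexField_one, Fields.prod_neg_two_one]
    rfl

theorem moduleStructure_genState {f : Gen g → Fields M} (hf : FreeRelations f) (φ : Gen g)
    (n : ℤ) : moduleStructure f (genState φ) n = f φ n := by
  change vertexField f (MvPolynomial.X (φ, 0)) n = _
  rw [vertexField_gen hf]

end ModuleStructure

/-! ### Morphisms and submodules -/

section Morphisms

variable {g : ℕ} {M N : Type*} [AddCommGroup M] [Module ℂ M] [TopologicalSpace M]
  [AddCommGroup N] [Module ℂ N] [TopologicalSpace N]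

/-- Products with generators build every state from the vacuum, so a module structure is determined
by the fields of the generators. -/
theorem nprod_genState (φ : Gen g) (k : ℕ) (a : Poly g) :
    VertexOperations.nprod (V := Fock g) (genState φ) (-((k : ℤ) + 1)) a
      = (MvPolynomial.X (φ, k) * a : Poly g) := by
  refine (nprod_eq (g := g) (MvPolynomial.X (φ, 0)) a _).trans ?_
  obtain ⟨J, hJ⟩ := fockY_X_mul φ 0 1 a (-((k : ℤ) + 1))
  have h := hJ (max J (k + 1)) (le_max_left _ _)
  rw [mul_one] at h
  rw [h, Finset.sum_eq_single k]
  · simp only [fockY_one]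
    rw [if_pos (by ring), if_neg (by omega)]
    simp
    rfl
  · intro i _ hi
    simp only [fockY_one]
    rw [if_neg (by omega), if_neg (by omega)]
    simp
  · intro hk
    exact absurd (Finset.mem_range.2 (le_max_right J (k + 1))) hk

/-- A continuous linear map that intertwines the modes of the generators intertwines the modes of
all states. -/
theorem intertwines {Y : Fock g →ₗ[ℂ] ℤ → Module.End ℂ M} {Z : Fock g →ₗ[ℂ] ℤ → Module.End ℂ N}
    (hY : IsLinearTopologicalModule Y) (hZ : IsLinearTopologicalModule Z) (T : M →ₗ[ℂ] N)
    (hT : Continuous T) (h : ∀ φ n x, T (Y (genState φ) n x) = Z (genState φ) n (T x)) (a : Fock g) :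
    ∀ n x, T (Y a n x) = Z a n (T x) := by
  have := hZ.completeLinear.t2
  refine MvPolynomial.induction_on (motive := fun a : Poly g =>
    ∀ n x, T (Y (a : Fock g) n x) = Z (a : Fock g) n (T x)) a ?_ ?_ ?_
  · intro c n x
    rw [MvPolynomial.C_eq_smul_one]
    have e1 := congrFun (Y.map_smul c (1 : Fock g)) n
    have e2 := congrFun (Z.map_smul c (1 : Fock g)) n
    have v1 := hY.vacuum n
    have v2 := hZ.vacuum n
    change Y (1 : Fock g) n = _ at v1
    change Z (1 : Fock g) n = _ at v2
    change T (Y (c • (1 : Fock g)) n x) = Z (c • (1 : Fock g)) n (T x)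
    rw [e1, e2, Pi.smul_apply, Pi.smul_apply, v1, v2]
    by_cases hn : n = -1 <;> simp [hn]
  · intro a b ha hb n x
    have e1 := LinearMap.congr_fun (congrFun (Y.map_add a b) n) x
    have e2 := LinearMap.congr_fun (congrFun (Z.map_add a b) n) (T x)
    refine (congrArg T e1).trans (Eq.trans ?_ e2.symm)
    change T (Y a n x + Y b n x) = Z a n (T x) + Z b n (T x)
    rw [map_add, ha, hb]
  · rintro a ⟨φ, k⟩ ha n x
    rw [mul_comm, ← nprod_genState]
    -- Both sides are limits of the same Borcherds sums, because `T` is continuous and already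
    -- intertwines every term.
    refine tendsto_nhds_unique
      ((hT.tendsto _).comp (hY.borcherds (genState φ) a (-((k : ℤ) + 1)) n x)) ?_
    convert hZ.borcherds (genState φ) a (-((k : ℤ) + 1)) n (T x) using 2 with K
    rw [Function.comp_apply, map_sum]
    refine Finset.sum_congr rfl fun i _ => ?_
    simp only [normalProductTerm, map_sub, map_smul]
    rw [h, ha, ha, h]

/-- The identity map intertwines the generators, hence all states. -/
theorem structure_unique {Y Y' : Fock g →ₗ[ℂ] ℤ → Module.End ℂ M}
    (hY : IsLinearTopologicalModule Y) (hY' : IsLinearTopologicalModule Y')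
    (h : ∀ φ n, Y (genState φ) n = Y' (genState φ) n) : Y = Y' :=
  LinearMap.ext fun a => funext fun n => LinearMap.ext fun x =>
    intertwines hY hY' LinearMap.id continuous_id (fun φ n x => by simp [h]) a n x

end Morphisms

/-! ### Closed submodules inherit the module structure -/

section Restriction

variable {V M : Type*} [AddCommGroup V] [Module ℂ V] [AddCommGroup M] [Module ℂ M]
  [TopologicalSpace M]

theorem IsCompleteLinear.submodule (hM : IsCompleteLinear M) {S : Submodule ℂ M}
    (hS : IsClosed (S : Set M)) : IsCompleteLinear S := by
  have := hM.isTopologicalAddGroup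
  have := hM.isLinearTopology
  have := hM.t2
  have hnhds : ∀ U ∈ 𝓝 (0 : S), ∃ W : Submodule ℂ M, (W : Set M) ∈ 𝓝 (0 : M) ∧
      ∀ x : S, (x : M) ∈ W → x ∈ U := by
    intro U hU
    rw [nhds_subtype_eq_comap, mem_comap] at hU
    obtain ⟨U', hU', hU'U⟩ := hU
    obtain ⟨W, hW, hWU⟩ := exists_submodule_subset hU'
    exact ⟨W, hW, fun x hx => hU'U (hWU hx)⟩
  have hpre : ∀ W : Submodule ℂ M, (W : Set M) ∈ 𝓝 (0 : M) →
      (W.comap S.subtype : Set S) ∈ 𝓝 (0 : S) := by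
    intro W hW
    rw [nhds_subtype_eq_comap]
    exact preimage_mem_comap hW
  refine ⟨inferInstance, ?_, inferInstance, fun v hv => ?_⟩
  · refine (isLinearTopology_iff_hasBasis_submodule (R := ℂ) (M := S)).2
      ⟨fun U => ⟨fun hU => ?_, fun ⟨W, hW, hWU⟩ => mem_of_superset hW hWU⟩⟩
    obtain ⟨W, hW, hWU⟩ := hnhds U hU
    exact ⟨W.comap S.subtype, hpre W hW, fun x hx => hWU x hx⟩
  · obtain ⟨x, hx⟩ := hM.complete (fun i => v i) (by
      intro U hU
      obtain ⟨W, hW, hWU⟩ := exists_submodule_subset hU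
      obtain ⟨N, hN⟩ := hv _ (hpre W hW)
      exact ⟨N, fun i hi j hj => hWU (hN i hi j hj)⟩)
    have hxS : x ∈ S := hS.mem_of_tendsto hx (Eventually.of_forall fun i => (v i).2)
    exact ⟨⟨x, hxS⟩, tendsto_subtype_rng.2 hx⟩

theorem generated_isClosed (Y : V →ₗ[ℂ] ℤ → Module.End ℂ M) (v : M) :
    IsClosed (generated Y v : Set M) := by
  rw [generated, Submodule.coe_sInf]
  exact isClosed_biInter fun S hS => hS.1.1

theorem generatedAction_isLinearTopologicalModule [VertexOperations V] {Y : V →ₗ[ℂ] ℤ → Module.End ℂ M}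
    (hY : IsLinearTopologicalModule Y) (v : M) :
    IsLinearTopologicalModule (generatedAction Y v) where
  completeLinear := hY.completeLinear.submodule (generated_isClosed Y v)
  field a := by
    refine ⟨fun n => ?_, fun U hU => ?_⟩
    · exact (((hY.field a).1 n).comp continuous_subtype_val).subtype_mk _
    · rw [nhds_subtype_eq_comap, mem_comap] at hU
      obtain ⟨U', hU', hU'U⟩ := hU
      obtain ⟨N, hN⟩ := (hY.field a).2 U' hU'
      exact ⟨N, fun n hn x => hU'U (hN n hn x)⟩
  vacuum n := by
    refine LinearMap.ext fun x => Subtype.ext ?_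
    change Y VertexOperations.vac n x = _
    rw [hY.vacuum n]
    by_cases h : n = -1 <;> simp [h]
  borcherds a b l n x := by
    refine tendsto_subtype_rng.2 ?_
    convert hY.borcherds a b l n x using 2 with K
    · rw [← Submodule.coe_subtype, map_sum]
      rfl
    · rfl
  derivative a n := by
    refine LinearMap.ext fun x => Subtype.ext ?_
    change Y (translation a) n x = _
    rw [hY.derivative a n]
    rfl

end Restriction

/-! ### The topology of a decreasing sequence of subspaces -/

section FiltrationTopology

variable {M : Type*} [AddCommGroup M] [Module ℂ M] {U : ℕ → Submodule ℂ M}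

/-- Monotonicity of `U` makes the sets `x + U n` a basis rather than a subbasis. -/
theorem filtration_nhds_hasBasis (hU : Antitone U) (x : M) :
    (@nhds M (filtrationTopology U) x).HasBasis (fun _ : ℕ => True) (fun n => {y | y - x ∈ U n}) := by
  have h : @nhds M (filtrationTopology U) x = ⨅ n, 𝓟 {y | y - x ∈ U n} := by
    rw [filtrationTopology, nhds_iInf]
    refine iInf_congr fun n => ?_
    let _ : TopologicalSpace (M ⧸ U n) := ⊥
    have : DiscreteTopology (M ⧸ U n) := ⟨rfl⟩
    rw [nhds_induced, nhds_discrete, comap_pure]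
    congr 1
    ext y
    exact Submodule.Quotient.eq (U n)
  rw [h]
  exact hasBasis_iInf_principal
    (directed_of_isDirected_le fun m n hmn y hy => hU hmn hy)

theorem filtration_isTopologicalAddGroup (U : ℕ → Submodule ℂ M) :
    @IsTopologicalAddGroup M (filtrationTopology U) _ := by
  refine topologicalAddGroup_iInf fun n => ?_
  let _ : TopologicalSpace (M ⧸ U n) := ⊥
  have : DiscreteTopology (M ⧸ U n) := ⟨rfl⟩
  exact topologicalAddGroup_induced (U n).mkQ

variable [t : TopologicalSpace M]

theorem filtration_mem_nhds_zero (ht : t = filtrationTopology U) (hU : Antitone U) {V : Set M} :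
    V ∈ 𝓝 (0 : M) ↔ ∃ n, (U n : Set M) ⊆ V := by
  subst ht
  rw [(filtration_nhds_hasBasis hU 0).mem_iff]
  simp only [sub_zero, true_and]
  rfl

theorem filtration_tendsto (ht : t = filtrationTopology U) (hU : Antitone U) {v : ℕ → M} {x : M} :
    Tendsto v atTop (𝓝 x) ↔ ∀ n, ∃ N, ∀ i ≥ N, v i - x ∈ U n := by
  subst ht
  rw [(filtration_nhds_hasBasis hU x).tendsto_right_iff]
  simp only [eventually_atTop, true_implies]
  rfl

theorem filtration_completeLinear (ht : t = filtrationTopology U) (hU : Antitone U)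
    (h0 : ∀ x, (∀ n, x ∈ U n) → x = 0)
    (hc : ∀ v ∈ cauchySeqs U, ∃ x, ∀ n, ∃ N, ∀ i ≥ N, v i - x ∈ U n) : CompleteLinear M := by
  have hg : IsTopologicalAddGroup M := by
    subst ht
    exact filtration_isTopologicalAddGroup U
  have hb : (𝓝 (0 : M)).HasBasis (fun _ : ℕ => True) (fun n => (U n : Set M)) :=
    ⟨fun V => by simpa using filtration_mem_nhds_zero ht hU⟩
  have hl : IsLinearTopology ℂ M := by
    refine (isLinearTopology_iff_hasBasis_submodule (R := ℂ) (M := M)).2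
      ⟨fun V => ⟨fun hV => ?_, fun ⟨W, hW, hWV⟩ => mem_of_superset hW hWV⟩⟩
    obtain ⟨n, hn⟩ := (filtration_mem_nhds_zero ht hU).1 hV
    exact ⟨U n, hb.mem_of_mem trivial, hn⟩
  have h2 : T2Space M := by
    have : T1Space M := by
      refine IsTopologicalAddGroup.t1Space M ?_
      rw [← closure_eq_iff_isClosed]
      refine Set.Subset.antisymm (fun x hx => h0 x fun n => ?_) subset_closure
      have hcl := submodule_isClosed (hb.mem_of_mem (i := n) trivial)
      exact hcl.closure_subset_iff.2 (by simp) hx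
    infer_instance
  exact { toIsTopologicalAddGroup := hg
          toIsLinearTopology := hl
          toT2Space := h2
          complete := fun v hv => by
            obtain ⟨x, hx⟩ := hc v fun n => hv _ (hb.mem_of_mem trivial)
            exact ⟨x, (filtration_tendsto ht hU).2 hx⟩ }

end FiltrationTopology

/-! ### Completions -/

section Completion

variable {M : Type*} [AddCommGroup M] [Module ℂ M] {U : ℕ → Submodule ℂ M}

/-- Membership does not depend on the representative: two representatives differ by a sequence that
is eventually in every `U n`. -/
theorem Completion.mk_mem {v : cauchySeqs U} {n : ℕ} :
    Completion.mk U v ∈ Completion.closureFiltration U n ↔ ∃ N, ∀ i ≥ N, (v : ℕ → M) i ∈ U n := by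
  refine ⟨fun ⟨w, hw, h⟩ => ?_, fun h => ⟨v, h, rfl⟩⟩
  have h1 : w - v ∈ ⨅ n, eventuallyIn U (U n) := (Submodule.Quotient.eq _).1 h
  have h2 := (eventuallyIn U (U n)).sub_mem hw ((Submodule.mem_iInf _).1 h1 n)
  rw [sub_sub_cancel] at h2
  exact h2

theorem Completion.mk_surjective (U : ℕ → Submodule ℂ M) : Function.Surjective (Completion.mk U) :=
  Submodule.mkQ_surjective _

/-- The linear map `Completion.of`. -/
def Completion.ofLinear (U : ℕ → Submodule ℂ M) : M →ₗ[ℂ] Completion U where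
  toFun := Completion.of U
  map_add' _ _ := rfl
  map_smul' _ _ := rfl

theorem Completion.of_mem {m : M} {n : ℕ} :
    Completion.of U m ∈ Completion.closureFiltration U n ↔ m ∈ U n :=
  Completion.mk_mem.trans ⟨fun ⟨N, hN⟩ => hN N le_rfl, fun h => ⟨0, fun _ _ => h⟩⟩

theorem Completion.closureFiltration_antitone (hU : Antitone U) :
    Antitone (Completion.closureFiltration U) := by
  rintro m n hmn _ ⟨v, ⟨N, hN⟩, rfl⟩
  exact ⟨v, ⟨N, fun i hi => hU hmn (hN i hi)⟩, rfl⟩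

theorem Completion.eventually_sub_of_mem (v : cauchySeqs U) (n : ℕ) :
    ∃ N, ∀ i ≥ N, Completion.mk U v - Completion.of U ((v : ℕ → M) i)
      ∈ Completion.closureFiltration U n := by
  obtain ⟨N, hN⟩ := v.2 n
  refine ⟨N, fun i hi => ?_⟩
  rw [Completion.of, ← map_sub]
  exact Completion.mk_mem.2 ⟨N, fun j hj => hN j hj i hi⟩

theorem Completion.exists_sub_of_mem (x : Completion U) (n : ℕ) :
    ∃ m, x - Completion.of U m ∈ Completion.closureFiltration U n := by
  obtain ⟨v, rfl⟩ := Completion.mk_surjective U x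
  obtain ⟨N, hN⟩ := Completion.eventually_sub_of_mem v n
  exact ⟨_, hN N le_rfl⟩

theorem Completion.eq_zero_of_forall_mem (x : Completion U)
    (h : ∀ n, x ∈ Completion.closureFiltration U n) : x = 0 := by
  obtain ⟨v, rfl⟩ := Completion.mk_surjective U x
  refine (Submodule.Quotient.mk_eq_zero _).2 ((Submodule.mem_iInf _).2 fun n => ?_)
  exact Completion.mk_mem.1 (h n)

theorem Completion.completeLinear (hU : Antitone U) : CompleteLinear (Completion U) := by
  refine filtration_completeLinear rfl (Completion.closureFiltration_antitone hU)
    Completion.eq_zero_of_forall_mem fun x hx => ?_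
  have hU' := Completion.closureFiltration_antitone hU
  -- A diagonal choice: the `i`-th term is approximated by an element of `M` up to the `i`-th
  -- neighbourhood. The approximants are Cauchy in `M`, and their class is the limit.
  choose m hm using fun i => Completion.exists_sub_of_mem (x i) i
  have key : ∀ n i, n ≤ i → x i - Completion.of U (m i) ∈ Completion.closureFiltration U n :=
    fun n i hi => hU' hi (hm i)
  have hmc : m ∈ cauchySeqs U := by
    intro n
    obtain ⟨N, hN⟩ := hx n
    refine ⟨max n N, fun i hi j hj => Completion.of_mem.1 ?_⟩
    have h1 := key n i (le_of_max_le_left hi)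
    have h2 := key n j (le_of_max_le_left hj)
    have h3 := hN i (le_of_max_le_right hi) j (le_of_max_le_right hj)
    have h4 := Submodule.add_mem _ (Submodule.sub_mem _ h3 h1) h2
    have h5 : Completion.of U (m i - m j) = Completion.of U (m i) - Completion.of U (m j) :=
      map_sub (Completion.ofLinear U) _ _
    rw [h5]
    convert h4 using 1
    abel
  refine ⟨Completion.mk U ⟨m, hmc⟩, fun n => ?_⟩
  obtain ⟨N, hN⟩ := Completion.eventually_sub_of_mem ⟨m, hmc⟩ n
  refine ⟨max n N, fun i hi => ?_⟩
  have h := Submodule.sub_mem _ (key n i (le_of_max_le_left hi)) (hN i (le_of_max_le_right hi))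
  convert h using 1
  simp

theorem Completion.mem_nhds_zero (hU : Antitone U) {V : Set (Completion U)} :
    V ∈ 𝓝 (0 : Completion U) ↔ ∃ n, (Completion.closureFiltration U n : Set (Completion U)) ⊆ V :=
  filtration_mem_nhds_zero rfl (Completion.closureFiltration_antitone hU)

theorem Completion.tendsto_of (hU : Antitone U) (v : cauchySeqs U) :
    Tendsto (fun i => Completion.of U ((v : ℕ → M) i)) atTop (𝓝 (Completion.mk U v)) := by
  refine (filtration_tendsto rfl (Completion.closureFiltration_antitone hU)).2 fun n => ?_
  obtain ⟨N, hN⟩ := Completion.eventually_sub_of_mem v n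
  exact ⟨N, fun i hi => by rw [← neg_sub]; exact Submodule.neg_mem _ (hN i hi)⟩

/-- The image of `M` is dense in the completion. -/
theorem Completion.induction_closed (hU : Antitone U) {S : Set (Completion U)} (hS : IsClosed S)
    (h : ∀ m, Completion.of U m ∈ S) (x : Completion U) : x ∈ S := by
  obtain ⟨v, rfl⟩ := Completion.mk_surjective U x
  exact hS.mem_of_tendsto (Completion.tendsto_of hU v) (Eventually.of_forall fun i => h _)

theorem Completion.hom_ext (hU : Antitone U) {N : Type*} [AddCommGroup N] [Module ℂ N]
    [TopologicalSpace N] [T2Space N] {S T : Completion U →ₗ[ℂ] N} (hS : Continuous S)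
    (hT : Continuous T) (h : ∀ m, S (Completion.of U m) = T (Completion.of U m)) : S = T :=
  LinearMap.ext fun x => Completion.induction_closed hU (isClosed_eq hS hT) h x

section Lift

variable {N : Type*} [AddCommGroup N] [Module ℂ N] [TopologicalSpace N] [CompleteLinear N]

theorem exists_tendsto_of_cauchy (T : M →ₗ[ℂ] N)
    (hT : ∀ W : Submodule ℂ N, (W : Set N) ∈ 𝓝 (0 : N) → ∃ n, ∀ m ∈ U n, T m ∈ W)
    (v : cauchySeqs U) : ∃ y, Tendsto (fun i => T ((v : ℕ → M) i)) atTop (𝓝 y) := by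
  refine CompleteLinear.complete _ fun V hV => ?_
  obtain ⟨W, hW, hWV⟩ := exists_submodule_subset hV
  obtain ⟨n, hn⟩ := hT W hW
  obtain ⟨K, hK⟩ := v.2 n
  refine ⟨K, fun i hi j hj => hWV ?_⟩
  rw [← map_sub]
  exact hn _ (hK i hi j hj)

/-- A linear map that is continuous for the topology of the filtration extends to the
completion. -/
theorem Completion.exists_lift (hU : Antitone U) (T : M →ₗ[ℂ] N)
    (hT : ∀ W : Submodule ℂ N, (W : Set N) ∈ 𝓝 (0 : N) → ∃ n, ∀ m ∈ U n, T m ∈ W) :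
    ∃ S : Completion U →ₗ[ℂ] N, Continuous S ∧ ∀ m, S (Completion.of U m) = T m := by
  have := Completion.completeLinear hU
  choose L hL using exists_tendsto_of_cauchy T hT
  let L' : cauchySeqs U →ₗ[ℂ] N :=
    { toFun := L
      map_add' := fun v w => by
        refine tendsto_nhds_unique (hL (v + w)) ?_
        refine ((hL v).add (hL w)).congr fun i => ?_
        exact (map_add T _ _).symm
      map_smul' := fun c v => by
        refine tendsto_nhds_unique (hL (c • v)) ?_
        refine ((hL v).const_smul c).congr fun i => ?_
        exact (map_smul T _ _).symm }
  have hmem : ∀ W : Submodule ℂ N, (W : Set N) ∈ 𝓝 (0 : N) → ∃ n, ∀ v : cauchySeqs U,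
      (∃ K, ∀ i ≥ K, (v : ℕ → M) i ∈ U n) → L v ∈ W := by
    intro W hW
    obtain ⟨n, hn⟩ := hT W hW
    refine ⟨n, fun v ⟨K, hK⟩ => ?_⟩
    exact (submodule_isClosed hW).mem_of_tendsto (hL v)
      (eventually_atTop.2 ⟨K, fun i hi => hn _ (hK i hi)⟩)
  -- On a null sequence the limit lies in every open subspace, so it is zero in the Hausdorff
  -- target.
  have hker : (⨅ n, eventuallyIn U (U n)) ≤ LinearMap.ker L' := by
    intro v hv
    have h0 : ∀ V : Submodule ℂ N, (V : Set N) ∈ 𝓝 (0 : N) → L v ∈ V := fun V hV => by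
      obtain ⟨n, hn⟩ := hmem V hV
      exact hn v ((Submodule.mem_iInf _).1 hv n)
    have h1 : Tendsto (fun _ : ℕ => L v) atTop (𝓝 0) :=
      tendsto_zero_iff.2 fun V hV => Eventually.of_forall fun _ => h0 V hV
    exact tendsto_nhds_unique tendsto_const_nhds h1
  let S : Completion U →ₗ[ℂ] N := (⨅ n, eventuallyIn U (U n)).liftQ L' hker
  have hS : ∀ v, S (Completion.mk U v) = L v := fun v => Submodule.liftQ_apply _ _ _
  refine ⟨S, linear_continuous S fun V hV => ?_, fun m => ?_⟩
  · obtain ⟨n, hn⟩ := hmem V hV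
    refine mem_of_superset ((Completion.mem_nhds_zero hU).2 ⟨n, subset_rfl⟩) ?_
    rintro _ ⟨v, hv, rfl⟩
    change S (Completion.mk U v) ∈ V
    rw [hS]
    exact hn v hv
  · exact (hS _).trans (tendsto_nhds_unique (hL _) tendsto_const_nhds)

end Lift

end Completion

/-! ### Free fields from a representation of the Weyl algebra -/

section Weyl

variable {g : ℕ} {M : Type*} [AddCommGroup M] [Module ℂ M]

/-- The canonical commutation relations `[D_p, D_q] = [X_p, X_q] = 0`, `[D_p, X_q] = δ_{pq}`. -/
structure IsWeyl (D X : Idx g × ℕ → Module.End ℂ M) : Prop where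
  comm_D : ∀ p q x, D p (D q x) = D q (D p x)
  comm_X : ∀ p q x, X p (X q x) = X q (X p x)
  comm_DX : ∀ p q x, D p (X q x) = X q (D p x) + (if p = q then (1 : ℂ) else 0) • x

/-- The modes of the free fields with annihilation operators `D` and creation operators `X`. -/
def weylMode (D X : Idx g × ℕ → Module.End ℂ M) : Gen g → ℤ → Module.End ℂ M
  | Sum.inl i, Int.ofNat k => D (Sum.inr i, k)
  | Sum.inl i, Int.negSucc k => (-(2 * Real.pi * Complex.I) : ℂ) • X (Sum.inl i, k)
  | Sum.inr i, Int.ofNat k => D (Sum.inl i, k)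
  | Sum.inr i, Int.negSucc k => (2 * Real.pi * Complex.I : ℂ) • X (Sum.inr i, k)

theorem IsWeyl.weylMode_comm {D X : Idx g × ℕ → Module.End ℂ M} (h : IsWeyl D X) (φ ψ : Gen g)
    (m n : ℤ) (x : M) : weylMode D X φ m (weylMode D X ψ n x) - weylMode D X ψ n (weylMode D X φ m x)
      = (if m + n + 1 = 0 then pairing φ ψ else 0) • x := by
  -- Indices satisfy `m + n + 1 = 0` only for an annihilation mode `k` and a creation mode `-l-1`
  -- with `k = l`.
  have e1 : ∀ k l : ℕ, ¬ ((k : ℤ) + l + 1 = 0) := fun k l => by omega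
  have e2 : ∀ k l : ℕ, ¬ (Int.negSucc k + Int.negSucc l + 1 = 0) := fun k l => by omega
  have e3 : ∀ k l : ℕ, ((k : ℤ) + Int.negSucc l + 1 = 0) ↔ k = l := fun k l => by omega
  have e4 : ∀ k l : ℕ, (Int.negSucc k + (l : ℤ) + 1 = 0) ↔ k = l := fun k l => by omega
  rcases φ with i | i <;> rcases ψ with j | j <;> rcases m with k | k <;> rcases n with l | l <;>
    simp only [weylMode, pairing, Int.ofNat_eq_natCast, e1, e2, e3, e4, LinearMap.smul_apply, map_smul,
      h.comm_DX, if_false, zero_smul, ite_self, smul_add] <;>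
    first
    | rw [h.comm_D, sub_self]
    | (rw [h.comm_X, smul_comm, sub_self])
    | (split_ifs <;> simp_all)

/-- It is enough that `D p` preserves `U n` for `n > p.2`, because the `U n` decrease. As `X p` maps
everything into `U p.2`, the creation modes tend to zero uniformly. -/
theorem weylMode_isField [TopologicalSpace M] {U : ℕ → Submodule ℂ M}
    (hU : ∀ V : Set M, V ∈ 𝓝 (0 : M) ↔ ∃ n, (U n : Set M) ⊆ V) (hU' : Antitone U)
    [IsTopologicalAddGroup M] [IsLinearTopology ℂ M]
    {D X : Idx g × ℕ → Module.End ℂ M} (hD : ∀ p n, p.2 < n → ∀ x ∈ U n, D p x ∈ U n)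
    (hX : ∀ p n, ∀ x ∈ U n, X p x ∈ U n) (hX' : ∀ p x, X p x ∈ U p.2) (φ : Gen g) :
    IsField (weylMode D X φ) := by
  have cD : ∀ p, Continuous (D p) := fun p => linear_continuous _ fun V hV => by
    obtain ⟨n, hn⟩ := (hU _).1 hV
    refine (hU _).2 ⟨max n (p.2 + 1), fun x hx => hn (hU' (le_max_left _ (p.2 + 1)) ?_)⟩
    exact hD p _ (lt_of_lt_of_le (Nat.lt_succ_self _) (le_max_right _ _)) x hx
  have cX : ∀ p, Continuous (X p) := fun p => linear_continuous _ fun V hV => by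
    obtain ⟨n, hn⟩ := (hU _).1 hV
    exact (hU _).2 ⟨n, fun x hx => hn (hX p n x hx)⟩
  have := continuousConstSMul_of_linear (M := M)
  refine ⟨fun n => ?_, fun V hV => ?_⟩
  · rcases φ with i | i <;> rcases n with k | k
    · exact cD _
    · exact (cX _).const_smul _
    · exact cD _
    · exact (cX _).const_smul _
  · obtain ⟨n, hn⟩ := (hU _).1 hV
    refine ⟨n + 1, fun m hm x => hn ?_⟩
    obtain ⟨k, rfl⟩ : ∃ k : ℕ, m = k + 1 := ⟨(m - 1).toNat, by omega⟩
    rw [show -((k : ℤ) + 1) = Int.negSucc k by omega]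
    have hk : n ≤ k := by omega
    rcases φ with i | i
    · exact (U n).smul_mem _ (hU' hk (hX' (Sum.inl i, k) x))
    · exact (U n).smul_mem _ (hU' hk (hX' (Sum.inr i, k) x))

end Weyl

/-! ### The smooth functions -/

section SmoothFunctions

variable {g : ℕ}

theorem Smooth.ext {f h : Smooth g} (hfh : ∀ x, f.1 x = h.1 x) : f = h :=
  Subtype.ext (funext hfh)

theorem Loop.exists_bound (x : Loop g) : ∃ n, ∀ j k, n ≤ k → x (j, k) = 0 := by
  refine ⟨x.support.sup Prod.snd + 1, fun j k hk => ?_⟩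
  by_contra hx
  have := Finset.le_sup (f := Prod.snd) (Finsupp.mem_support_iff.2 hx)
  simp only at this
  omega

theorem Loop.exists_bound_range {m : ℕ} (L : (Fin m → ℝ) →ₗ[ℝ] Loop g) :
    ∃ n, ∀ y j k, n ≤ k → L y (j, k) = 0 := by
  choose b hb using fun i : Fin m => Loop.exists_bound (L (fun j => if i = j then 1 else 0))
  refine ⟨Finset.univ.sup b, fun y j k hk => ?_⟩
  rw [LinearMap.pi_apply_eq_sum_univ L y, Finsupp.finsetSum_apply]
  refine Finset.sum_eq_zero fun i _ => ?_
  rw [Finsupp.smul_apply, hb i j k ((Finset.le_sup (Finset.mem_univ i)).trans hk), smul_zero]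

theorem restrictionKernel_antitone : Antitone (restrictionKernel g) :=
  fun _ _ hmn _ hf x hx => hf x fun j k hk => hx j k (hmn.trans hk)

theorem restrictionKernel_eq_zero (f : Smooth g) (hf : ∀ n, f ∈ restrictionKernel g n) : f = 0 :=
  Smooth.ext fun x => by
    obtain ⟨n, hn⟩ := Loop.exists_bound x
    exact hf n x hn

/-- A Cauchy sequence is eventually constant on each subspace of the filtration, and these constant
values glue to a limit. Every finite-dimensional subspace lies in one of them, so the limit is
smooth. -/
instance : CompleteLinear (Smooth g) := by
  refine filtration_completeLinear rfl restrictionKernel_antitone restrictionKernel_eq_zero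
    fun v hv => ?_
  choose N hN using hv
  choose b hb using Loop.exists_bound (g := g)
  have key : ∀ n i x, N n ≤ i → (∀ j k, n ≤ k → x (j, k) = 0) →
      (v i).1 x = (v (N (b x))).1 x := by
    intro n i x hi hx
    have h1 := hN n i hi (max i (N (b x))) (hi.trans (le_max_left _ _)) x hx
    have h2 := hN (b x) (N (b x)) le_rfl (max i (N (b x))) (le_max_right _ _) x (hb x)
    exact (sub_eq_zero.1 h1).trans (sub_eq_zero.1 h2).symm
  have hs : IsSmooth (g := g) fun x => (v (N (b x))).1 x := by
    intro m L
    obtain ⟨n, hn⟩ := Loop.exists_bound_range L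
    have : (fun y => (v (N (b (L y)))).1 (L y)) = fun y => (v (N n)).1 (L y) :=
      funext fun y => (key n (N n) (L y) le_rfl (hn y)).symm
    rw [this]
    exact (v (N n)).2 m L
  exact ⟨⟨_, hs⟩, fun n => ⟨N n, fun i hi x hx => sub_eq_zero.2 (key n i x hi hx)⟩⟩

/-- For `p.2 < n` the direction `basisVec p` lies in the subspace on which `f` vanishes. -/
theorem partialOp_mem {p : Idx g × ℕ} {n : ℕ} (hp : p.2 < n) {f : Smooth g}
    (hf : f ∈ restrictionKernel g n) : partialOp p f ∈ restrictionKernel g n := by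
  intro x hx
  have : (fun s : ℝ => f.1 (x + s • basisVec p)) = fun _ => 0 := by
    funext s
    refine hf _ fun j k hk => ?_
    rw [Finsupp.add_apply, hx j k hk, Finsupp.smul_apply, basisVec, Finsupp.single_apply, if_neg]
    · simp
    · rintro rfl
      exact absurd hp (not_lt.2 hk)
  change deriv (fun s : ℝ => f.1 (x + s • basisVec p)) 0 = 0
  rw [this, deriv_const]

theorem coordOp_mem (p : Idx g × ℕ) {n : ℕ} {f : Smooth g}
    (hf : f ∈ restrictionKernel g n) : coordOp p f ∈ restrictionKernel g n := fun x hx => by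
  change (x p : ℂ) * f.1 x = 0
  rw [hf x hx, mul_zero]

theorem coordOp_mem_snd (p : Idx g × ℕ) (f : Smooth g) :
    coordOp p f ∈ restrictionKernel g p.2 := fun x hx => by
  change (x p : ℂ) * f.1 x = 0
  rw [hx p.1 p.2 le_rfl, Complex.ofReal_zero, zero_mul]

theorem Smooth.hasDerivAt (f : Smooth g) (p : Idx g × ℕ) (x : Loop g) :
    HasDerivAt (fun s : ℝ => f.1 (x + s • basisVec p)) ((partialOp p f).1 x) 0 :=
  (((IsSmooth.line f.2 x (basisVec p)).differentiable (by simp)) 0).hasDerivAt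

/-- Both sides are second derivatives of the pullback of `f` to `ℝ³` along the vectors `x`,
`basisVec p`, `basisVec q`, where symmetry of the second derivative applies. -/
theorem partialOp_comm (p q : Idx g × ℕ) (f : Smooth g) :
    partialOp p (partialOp q f) = partialOp q (partialOp p f) := by
  refine Smooth.ext fun x => ?_
  let L : (Fin 3 → ℝ) →ₗ[ℝ] Loop g := Fintype.linearCombination ℝ ![x, basisVec p, basisVec q]
  let F : (Fin 3 → ℝ) → ℂ := fun y => f.1 (L y)
  have hF : ContDiff ℝ ∞ F := f.2 3 L
  have hd : ∀ y, DifferentiableAt ℝ F y := hF.differentiable (by simp)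
  have hF' : ContDiff ℝ ∞ (fderiv ℝ F) := hF.fderiv_right (by simp)
  have hd' : ∀ y, DifferentiableAt ℝ (fderiv ℝ F) y := hF'.differentiable (by simp)
  let e : Fin 3 → (Fin 3 → ℝ) := fun i => Pi.single i 1
  have hL : ∀ i, L (e i) = ![x, basisVec p, basisVec q] i := fun i => by
    simp [L, e, Fintype.linearCombination_apply, Pi.single_apply]
  have first : ∀ (r : Idx g × ℕ) (i : Fin 3), L (e i) = basisVec r → ∀ y,
      (partialOp r f).1 (L y) = fderiv ℝ F y (e i) := by
    intro r i hr y
    rw [← (hd y).lineDeriv_eq_fderiv]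
    change deriv _ 0 = deriv _ 0
    congr 1
    funext s
    simp only [F, map_add, map_smul, hr]
  have second : ∀ (r s : Idx g × ℕ) (i j : Fin 3), L (e i) = basisVec r → L (e j) = basisVec s →
      (partialOp r (partialOp s f)).1 x = fderiv ℝ (fderiv ℝ F) (e 0) (e i) (e j) := by
    intro r s i j hr hs
    have h1 : DifferentiableAt ℝ (fun y => fderiv ℝ F y (e j)) (e 0) :=
      (hd' _).clm_apply (differentiableAt_const _)
    have h2 : fderiv ℝ (fun y => fderiv ℝ F y (e j)) (e 0) (e i)
        = fderiv ℝ (fderiv ℝ F) (e 0) (e i) (e j) := by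
      rw [fderiv_clm_apply (hd' _) (differentiableAt_const _)]
      simp
    rw [← h2, ← h1.lineDeriv_eq_fderiv]
    change deriv _ 0 = deriv _ 0
    congr 1
    funext t
    have h0 : L (e 0) = x := hL 0
    refine Eq.trans ?_ (first s j hs (e 0 + t • e i))
    rw [map_add, map_smul, hr, h0]
  rw [second p q 1 2 (hL 1) (hL 2), second q p 2 1 (hL 2) (hL 1)]
  have hsym : IsSymmSndFDerivAt ℝ F (e 0) :=
    hF.contDiffAt.isSymmSndFDerivAt (by simp; exact WithTop.coe_le_coe.2 le_top)
  exact hsym _ _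

theorem isWeyl_smooth : IsWeyl (partialOp (g := g)) coordOp where
  comm_D := partialOp_comm
  comm_X p q f := Smooth.ext fun x => mul_left_comm _ _ _
  comm_DX p q f := Smooth.ext fun x => by
    have h1 : HasDerivAt (fun s : ℝ => (((x + s • basisVec p) q : ℝ) : ℂ))
        (if p = q then 1 else 0) 0 := by
      have h2 : HasDerivAt (fun s : ℝ => ((x q + s * (if p = q then 1 else 0) : ℝ) : ℂ))
          (((if p = q then 1 else 0 : ℝ)) : ℂ) 0 := by
        refine HasDerivAt.ofReal_comp ?_
        simpa using ((hasDerivAt_id (0 : ℝ)).mul_const (if p = q then 1 else 0 : ℝ)).const_add (x q)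
      convert h2 using 1
      · funext s
        simp [basisVec, Finsupp.single_apply]
      · split_ifs <;> simp
    refine (h1.mul (f.hasDerivAt p x)).deriv.trans ?_
    change _ = (x q : ℂ) * (partialOp p f).1 x + (if p = q then (1 : ℂ) else 0) * f.1 x
    simp [add_comm]

theorem smoothMode_eq : smoothMode (g := g) = weylMode partialOp coordOp := by
  funext φ n
  rcases φ with i | i <;> rcases n with k | k <;> rfl

/-- The free fields on the space of smooth functions. -/
def smoothFields (φ : Gen g) : Fields (Smooth g) :=
  ⟨smoothMode φ, by
    rw [smoothMode_eq]
    exact weylMode_isField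
      (fun V => filtration_mem_nhds_zero rfl restrictionKernel_antitone)
      restrictionKernel_antitone (fun p n hp f hf => partialOp_mem hp hf)
      (fun p n f hf => coordOp_mem p hf) coordOp_mem_snd φ⟩

theorem smoothFields_freeRelations : FreeRelations (smoothFields (g := g)) := by
  intro φ ψ m n x
  change smoothMode φ m (smoothMode ψ n x) - smoothMode ψ n (smoothMode φ m x) = _
  rw [smoothMode_eq]
  exact isWeyl_smooth.weylMode_comm φ ψ m n x

theorem existsUnique_smoothStructure (g : ℕ) :
    ∃! Z : Fock g →ₗ[ℂ] ℤ → Module.End ℂ (Smooth g), IsSmoothStructure Z := by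
  refine ⟨moduleStructure smoothFields,
    ⟨moduleStructure_isLinearTopologicalModule smoothFields_freeRelations,
      moduleStructure_genState smoothFields_freeRelations⟩, fun Z hZ => ?_⟩
  refine structure_unique hZ.1
    (moduleStructure_isLinearTopologicalModule smoothFields_freeRelations) fun φ n => ?_
  rw [hZ.2, moduleStructure_genState smoothFields_freeRelations]
  rfl

end SmoothFunctions

/-! ### The action of the Heisenberg algebra on the smooth functions -/

section Heisenberg

attribute [local instance] LieRing.ofAssociativeRing LieAlgebra.ofAssociativeAlgebra

variable {g : ℕ}

theorem laurent_eventually_coeff (f : LaurentSeries ℂ) : ∃ K : ℕ, ∀ n : ℤ, n < -K → f.coeff n = 0 := by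
  refine ⟨f.order.natAbs, fun n hn => HahnSeries.coeff_eq_zero_of_lt_order ?_⟩
  omega

/-- The coefficients of the `e_j t^(-k-1)`. -/
def negPart : (Idx g → LaurentSeries ℂ) →ₗ[ℂ] (Idx g × ℕ) →₀ ℂ where
  toFun u := Finsupp.ofSupportFinite (fun p => (u p.1).coeff (-(p.2 : ℤ) - 1)) (by
    choose K hK using fun j => laurent_eventually_coeff (u j)
    refine (Finset.finite_toSet (Finset.univ ×ˢ Finset.range (Finset.univ.sup K))).subset ?_
    rintro ⟨j, k⟩ hp
    rw [Finset.coe_product, Set.mem_prod]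
    refine ⟨by simp, Finset.mem_coe.2 (Finset.mem_range.2 ?_)⟩
    by_contra hk
    refine hp (hK j _ ?_)
    have := Finset.le_sup (f := K) (Finset.mem_univ j)
    simp only
    omega)
  map_add' u v := Finsupp.ext fun p => by
    change ((u + v) p.1).coeff _ = _
    rw [Pi.add_apply, HahnSeries.coeff_add]
    rfl
  map_smul' c u := Finsupp.ext fun p => by
    change ((c • u) p.1).coeff _ = _
    rw [Pi.smul_apply, HahnSeries.coeff_smul]
    rfl

theorem negPart_apply (u : Idx g → LaurentSeries ℂ) (p : Idx g × ℕ) :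
    negPart u p = (u p.1).coeff (-(p.2 : ℤ) - 1) := rfl

/-- The coefficients of the coordinate functions in the action of `e_j t^k`, `k ≥ 0`. -/
def coordCoeff (u : Idx g → LaurentSeries ℂ) : Idx g × ℕ → ℂ
  | (Sum.inl i, k) => 2 * Real.pi * Complex.I * (u (Sum.inr i)).coeff k
  | (Sum.inr i, k) => -(2 * Real.pi * Complex.I) * (u (Sum.inl i)).coeff k

theorem coordCoeff_zero : coordCoeff (0 : Idx g → LaurentSeries ℂ) = 0 := by
  funext ⟨j, k⟩
  rcases j with i | i <;> simp [coordCoeff]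

theorem coordCoeff_add (u v : Idx g → LaurentSeries ℂ) :
    coordCoeff (u + v) = coordCoeff u + coordCoeff v := by
  funext ⟨j, k⟩
  rcases j with i | i <;> simp only [coordCoeff, Pi.add_apply, HahnSeries.coeff_add, mul_add]

theorem coordCoeff_smul (c : ℂ) (u : Idx g → LaurentSeries ℂ) :
    coordCoeff (c • u) = c • coordCoeff u := by
  funext ⟨j, k⟩
  rcases j with i | i <;> simp [coordCoeff, mul_left_comm]

theorem coeff_piSingle (j j' : Idx g) (n k : ℤ) (c : ℂ) :
    ((Pi.single j (HahnSeries.single n c) : Idx g → LaurentSeries ℂ) j').coeff k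
      = if j' = j ∧ k = n then c else 0 := by
  by_cases hj : j' = j
  · subst hj
    rw [Pi.single_eq_same, HahnSeries.coeff_single]
    simp
  · rw [Pi.single_eq_of_ne hj]
    simp [hj]

theorem negPart_heisVec (p : Idx g × ℕ) :
    negPart (heisVec p.1 (-(p.2 : ℤ) - 1)).1 = Finsupp.single p 1 := by
  ext q
  rw [negPart_apply, heisVec, coeff_piSingle, Finsupp.single_apply]
  refine if_congr ?_ rfl rfl
  rw [Prod.ext_iff]
  constructor <;> rintro ⟨h1, h2⟩ <;> exact ⟨h1.symm, by omega⟩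

theorem coordCoeff_heisVec (p : Idx g × ℕ) :
    coordCoeff (heisVec p.1 (-(p.2 : ℤ) - 1)).1 = 0 := by
  funext ⟨j, k⟩
  rcases j with i | i <;> simp only [coordCoeff, heisVec, coeff_piSingle] <;>
    rw [if_neg (by omega)] <;> simp

theorem negPart_heisCoord (p : Idx g × ℕ) : negPart (heisCoord p.1 p.2).1 = 0 := by
  ext q
  obtain ⟨j, k⟩ := p
  rw [negPart_apply]
  rcases j with i | i
  · change ((2 * Real.pi * Complex.I : ℂ)⁻¹ • (heisVec (Sum.inr i) (k : ℤ)).1 q.1).coeff _ = 0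
    rw [HahnSeries.coeff_smul, heisVec, coeff_piSingle, if_neg (by omega), smul_zero]
  · change ((-(2 * Real.pi * Complex.I) : ℂ)⁻¹ • (heisVec (Sum.inl i) (k : ℤ)).1 q.1).coeff _ = 0
    rw [HahnSeries.coeff_smul, heisVec, coeff_piSingle, if_neg (by omega), smul_zero]

theorem coordCoeff_heisCoord (p : Idx g × ℕ) : coordCoeff (heisCoord p.1 p.2).1 = Pi.single p 1 := by
  have hpi : (2 * Real.pi * Complex.I : ℂ) ≠ 0 := Complex.two_pi_I_ne_zero
  obtain ⟨j, k⟩ := p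
  funext ⟨j', k'⟩
  rcases j with i | i
  · have : coordCoeff (heisCoord (Sum.inl i) k).1
        = (2 * Real.pi * Complex.I : ℂ)⁻¹ • coordCoeff (heisVec (Sum.inr i) (k : ℤ)).1 :=
      coordCoeff_smul _ _
    rw [this, Pi.smul_apply]
    rcases j' with i' | i' <;> simp only [coordCoeff, heisVec, coeff_piSingle] <;>
      rw [Pi.single_apply]
    · by_cases hik : i' = i ∧ k' = k
      · obtain ⟨rfl, rfl⟩ := hik
        rw [if_pos ⟨rfl, rfl⟩, if_pos rfl, mul_one, smul_eq_mul,
          inv_mul_cancel₀ hpi]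
      · rw [if_neg (by simpa using hik), if_neg (by simpa using hik), mul_zero,
          smul_zero]
    · simp
  · have : coordCoeff (heisCoord (Sum.inr i) k).1
        = (-(2 * Real.pi * Complex.I) : ℂ)⁻¹ • coordCoeff (heisVec (Sum.inl i) (k : ℤ)).1 :=
      coordCoeff_smul _ _
    rw [this, Pi.smul_apply]
    rcases j' with i' | i' <;> simp only [coordCoeff, heisVec, coeff_piSingle] <;>
      rw [Pi.single_apply]
    · simp
    · by_cases hik : i' = i ∧ k' = k
      · obtain ⟨rfl, rfl⟩ := hik
        rw [if_pos ⟨rfl, rfl⟩, if_pos rfl, mul_one, smul_eq_mul,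
          inv_mul_cancel₀ (neg_ne_zero.2 hpi)]
      · rw [if_neg (by simpa using hik), if_neg (by simpa using hik), mul_zero,
          smul_zero]

/-- The exponents `k` and `-k-1` are paired. Supports are bounded below, so every large cut-off
works and several series can share one. -/
theorem coeff_neg_one_mul (f h : LaurentSeries ℂ) : ∃ K₀ : ℕ, ∀ K ≥ K₀,
    (f * h).coeff (-1) = ∑ k ∈ Finset.range K,
      (f.coeff (-(k : ℤ) - 1) * h.coeff k + f.coeff k * h.coeff (-(k : ℤ) - 1)) := by
  obtain ⟨K₁, h₁⟩ := laurent_eventually_coeff f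
  obtain ⟨K₂, h₂⟩ := laurent_eventually_coeff h
  refine ⟨max K₁ K₂, fun K hK => ?_⟩
  have hK1 := (le_max_left _ _).trans hK
  have hK2 := (le_max_right _ _).trans hK
  have e1 : (f * h).coeff (-1)
      = ∑ n ∈ Finset.Ico (-(K : ℤ)) K, f.coeff n * h.coeff (-1 - n) := by
    rw [HahnSeries.coeff_mul]
    refine Finset.sum_of_injOn Prod.fst ?_ ?_ ?_ ?_
    · rintro ⟨a, b⟩ hab ⟨a', b'⟩ hab' (rfl : a = a')
      simp only [Finset.mem_coe, Finset.mem_antidiagonal] at hab hab'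
      rw [Prod.mk.injEq]
      exact ⟨rfl, by omega⟩
    · rintro ⟨a, b⟩ hab
      simp only [Finset.mem_coe, Finset.mem_antidiagonal, HahnSeries.mem_support] at hab
      have ha : ¬ a < -K₁ := fun h => hab.1 (h₁ a h)
      have hb : ¬ b < -K₂ := fun h => hab.2.1 (h₂ b h)
      simp only [Finset.mem_coe, Finset.mem_Ico]
      omega
    · intro n hn hn'
      by_contra hne
      refine hn' ⟨(n, -1 - n), ?_, rfl⟩
      simp only [Finset.mem_coe, Finset.mem_antidiagonal, HahnSeries.mem_support]
      exact ⟨left_ne_zero_of_mul hne, right_ne_zero_of_mul hne, by ring⟩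
    · rintro ⟨a, b⟩ hab
      simp only [Finset.mem_antidiagonal] at hab
      rw [← hab.2.2, add_sub_cancel_left]
  rw [e1, Finset.sum_add_distrib]
  have e2 : Finset.Ico (-(K : ℤ)) K = Finset.Ico (-(K : ℤ)) 0 ∪ Finset.Ico 0 (K : ℤ) := by
    rw [Finset.Ico_union_Ico_eq_Ico] <;> omega
  rw [e2, Finset.sum_union (Finset.Ico_disjoint_Ico_consecutive _ _ _)]
  congr 1
  · refine Finset.sum_bij' (fun n _ => (-n - 1).toNat) (fun k _ => -(k : ℤ) - 1) ?_ ?_ ?_ ?_ ?_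
    · intro n hn
      simp only [Finset.mem_Ico, Finset.mem_range] at hn ⊢
      omega
    · intro n hn
      simp only [Finset.mem_Ico, Finset.mem_range] at hn ⊢
      omega
    · intro n hn
      simp only [Finset.mem_Ico] at hn ⊢
      omega
    · intro n hn
      omega
    · intro n hn
      simp only [Finset.mem_Ico] at hn
      rw [Int.toNat_of_nonneg (by omega)]
      congr 2 <;> ring
  · refine Finset.sum_bij' (fun n _ => n.toNat) (fun k _ => (k : ℤ)) ?_ ?_ ?_ ?_ ?_
    · intro n hn
      simp only [Finset.mem_Ico, Finset.mem_range] at hn ⊢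
      omega
    · intro n hn
      simp only [Finset.mem_Ico, Finset.mem_range] at hn ⊢
      omega
    · intro n hn
      simp only [Finset.mem_Ico] at hn ⊢
      omega
    · intro n hn
      simp
    · intro n hn
      simp only [Finset.mem_Ico] at hn
      rw [Int.toNat_of_nonneg (by omega)]
      congr 2
      ring

/-- When a loop is split into a derivative direction and a linear function, the residue form becomes
the commutator of the operators `∂_N + l`. This makes `heisRep` a Lie homomorphism and computes all
commutators on the induced module. -/
theorem two_pi_I_mul_resForm (u v : Idx g → LaurentSeries ℂ) :
    2 * Real.pi * Complex.I * resForm u v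
      = (negPart u).sum (fun p r => r * coordCoeff v p)
        - (negPart v).sum (fun p r => r * coordCoeff u p) := by
  choose K hK using fun i : Fin g => coeff_neg_one_mul (u (Sum.inl i)) (v (Sum.inr i))
  choose K' hK' using fun i : Fin g => coeff_neg_one_mul (u (Sum.inr i)) (v (Sum.inl i))
  choose A hA using fun j => laurent_eventually_coeff (u j)
  choose B hB using fun j => laurent_eventually_coeff (v j)
  let L := Finset.univ.sup K ⊔ Finset.univ.sup K' ⊔ Finset.univ.sup A ⊔ Finset.univ.sup B
  have hL : ∀ i, K i ≤ L := fun i => (Finset.le_sup (f := K) (Finset.mem_univ i)).trans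
    (le_sup_left.trans (le_sup_left.trans le_sup_left))
  have hL' : ∀ i, K' i ≤ L := fun i => (Finset.le_sup (f := K') (Finset.mem_univ i)).trans
    (le_sup_right.trans (le_sup_left.trans le_sup_left))
  have hLA : ∀ j, A j ≤ L := fun i => (Finset.le_sup (f := A) (Finset.mem_univ i)).trans
    (le_sup_right.trans le_sup_left)
  have hLB : ∀ j, B j ≤ L := fun i => (Finset.le_sup (f := B) (Finset.mem_univ i)).trans le_sup_right
  have hsum : ∀ (w w' : Idx g → LaurentSeries ℂ),
      (∀ j, ∃ C ≤ L, ∀ n : ℤ, n < -(C : ℤ) → (w j).coeff n = 0) →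
      (negPart w).sum (fun p r => r * coordCoeff w' p)
        = ∑ i : Fin g, ∑ k ∈ Finset.range L, 2 * Real.pi * Complex.I *
          ((w (Sum.inl i)).coeff (-(k : ℤ) - 1) * (w' (Sum.inr i)).coeff k
            - (w (Sum.inr i)).coeff (-(k : ℤ) - 1) * (w' (Sum.inl i)).coeff k) := by
    intro w w' hw
    rw [Finsupp.sum_of_support_subset (s := Finset.univ ×ˢ Finset.range L), Finset.sum_product,
      Fintype.sum_sum_type]
    · simp only [negPart_apply, coordCoeff]
      rw [← Finset.sum_add_distrib]
      refine Finset.sum_congr rfl fun i _ => ?_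
      rw [← Finset.sum_add_distrib]
      refine Finset.sum_congr rfl fun k _ => ?_
      ring
    · rintro ⟨j, k⟩ hp
      refine Finset.mem_product.2 ⟨Finset.mem_univ _, Finset.mem_range.2 ?_⟩
      obtain ⟨C, hC, h⟩ := hw j
      by_contra hk
      refine Finsupp.mem_support_iff.1 hp ((negPart_apply _ _).trans (h _ ?_))
      simp only at hk ⊢
      omega
    · simp
  rw [hsum u v fun j => ⟨A j, hLA j, hA j⟩, hsum v u fun j => ⟨B j, hLB j, hB j⟩, resForm,
    Finset.mul_sum, ← Finset.sum_sub_distrib]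
  refine Finset.sum_congr rfl fun i _ => ?_
  rw [hK i L (hL i), hK' i L (hL' i), ← Finset.sum_sub_distrib, ← Finset.sum_sub_distrib,
    Finset.mul_sum]
  refine Finset.sum_congr rfl fun k _ => ?_
  ring

/-- Multiplication by a linear function. -/
def mulOp (l : Loop g →ₗ[ℝ] ℂ) : Module.End ℂ (Smooth g) where
  toFun f := ⟨fun x => l x * f.1 x, fun m L =>
    (LinearMap.toContinuousLinearMap (l.comp L)).contDiff.mul (f.2 m L)⟩
  map_add' _ _ := Smooth.ext fun _ => mul_add _ _ _
  map_smul' _ _ := Smooth.ext fun _ => mul_left_comm _ _ _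

theorem partialOp_mulOp (p : Idx g × ℕ) (l : Loop g →ₗ[ℝ] ℂ) (f : Smooth g) :
    partialOp p (mulOp l f) = mulOp l (partialOp p f) + l (basisVec p) • f := by
  refine Smooth.ext fun x => ?_
  have h1 : HasDerivAt (fun s : ℝ => l (x + s • basisVec p)) (l (basisVec p)) 0 := by
    have := ((hasDerivAt_id (0 : ℝ)).smul_const (l (basisVec p))).const_add (l x)
    simpa using this
  refine (h1.mul (f.hasDerivAt p x)).deriv.trans ?_
  change _ = l x * (partialOp p f).1 x + l (basisVec p) * f.1 x
  simp [add_comm]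

/-- The derivative in a complex direction. -/
abbrev dirOp (N : (Idx g × ℕ) →₀ ℂ) : Module.End ℂ (Smooth g) :=
  Finsupp.linearCombination ℂ (partialOp (g := g)) N

theorem dirOp_mulOp (N : (Idx g × ℕ) →₀ ℂ) (l : Loop g →ₗ[ℝ] ℂ) (f : Smooth g) :
    dirOp N (mulOp l f) = mulOp l (dirOp N f) + (N.sum fun p r => r * l (basisVec p)) • f := by
  induction N using Finsupp.induction_linear with
  | zero => simp [dirOp]
  | add N N' h h' =>
    rw [dirOp, map_add, Finsupp.sum_add_index' (by simp) (by intros; ring)]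
    simp only [LinearMap.add_apply, map_add, h, h', add_smul]
    abel
  | single p r =>
    rw [dirOp, Finsupp.linearCombination_single, Finsupp.sum_single_index (by simp)]
    simp only [LinearMap.smul_apply, partialOp_mulOp, map_smul, smul_add, mul_smul]

theorem dirOp_comm (N N' : (Idx g × ℕ) →₀ ℂ) (f : Smooth g) :
    dirOp N (dirOp N' f) = dirOp N' (dirOp N f) := by
  induction N using Finsupp.induction_linear with
  | zero => simp [dirOp]
  | add N₁ N₂ h h' =>
    rw [dirOp, map_add, LinearMap.add_apply, h, h', LinearMap.add_apply, map_add]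
  | single p r =>
    induction N' using Finsupp.induction_linear with
    | zero => simp [dirOp]
    | add N₁ N₂ h h' =>
      have e : ∀ f, dirOp (N₁ + N₂) f = dirOp N₁ f + dirOp N₂ f := fun f => by
        rw [dirOp, map_add, LinearMap.add_apply]
      rw [e, e, map_add, h, h']
    | single q s =>
      simp only [dirOp, Finsupp.linearCombination_single, LinearMap.smul_apply, map_smul]
      rw [partialOp_comm, smul_comm]

/-- The linear function `∑ a_p x_p`. -/
abbrev linFun (a : Idx g × ℕ → ℂ) : Loop g →ₗ[ℝ] ℂ := Finsupp.linearCombination ℝ a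

theorem linFun_basisVec (a : Idx g × ℕ → ℂ) (p : Idx g × ℕ) : linFun a (basisVec p) = a p := by
  rw [linFun, basisVec, Finsupp.linearCombination_single, one_smul]

theorem mulOp_linFun_add (a b : Idx g × ℕ → ℂ) :
    mulOp (linFun (a + b)) = mulOp (linFun a) + mulOp (linFun b) := by
  refine LinearMap.ext fun f => Smooth.ext fun x => ?_
  change linFun (a + b) x * f.1 x = linFun a x * f.1 x + linFun b x * f.1 x
  rw [← add_mul]
  congr 1
  simp [linFun, Finsupp.linearCombination_apply, smul_add, Finsupp.sum_add]

theorem mulOp_linFun_smul (c : ℂ) (a : Idx g × ℕ → ℂ) :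
    mulOp (linFun (c • a)) = c • mulOp (linFun a) := by
  refine LinearMap.ext fun f => Smooth.ext fun x => ?_
  change linFun (c • a) x * f.1 x = c * (linFun a x * f.1 x)
  rw [← mul_assoc]
  congr 1
  simp [linFun, Finsupp.linearCombination_apply, Finsupp.mul_sum, mul_left_comm]

theorem mulOp_linFun_zero : mulOp (linFun (0 : Idx g × ℕ → ℂ)) = 0 := by
  have := mulOp_linFun_smul 0 (0 : Idx g × ℕ → ℂ)
  rwa [zero_smul, zero_smul] at this

theorem mulOp_linFun_single (p : Idx g × ℕ) : mulOp (linFun (Pi.single p 1)) = coordOp p := by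
  refine LinearMap.ext fun f => Smooth.ext fun x => ?_
  change linFun (Pi.single p 1) x * f.1 x = (x p : ℂ) * f.1 x
  congr 1
  rw [linFun, Finsupp.linearCombination_apply, Finsupp.sum, Finset.sum_eq_single p]
  · simp
  · intro q _ hq
    simp [Pi.single_eq_of_ne hq]
  · intro hp
    simp [Finsupp.notMem_support_iff.1 hp]

/-- The representation of the Heisenberg algebra on the smooth functions. -/
def heisRep : Heis g →ₗ⁅ℂ⁆ Module.End ℂ (Smooth g) where
  toFun h := dirOp (negPart h.1) + mulOp (linFun (coordCoeff h.1))
    + (2 * Real.pi * Complex.I * h.2) • LinearMap.id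
  map_add' h h' := by
    change dirOp (negPart (h.1 + h'.1)) + mulOp (linFun (coordCoeff (h.1 + h'.1)))
      + (2 * Real.pi * Complex.I * (h.2 + h'.2)) • LinearMap.id = _
    rw [map_add, dirOp, map_add, coordCoeff_add, mulOp_linFun_add, mul_add, add_smul]
    abel
  map_smul' c h := by
    change dirOp (negPart (c • h.1)) + mulOp (linFun (coordCoeff (c • h.1)))
      + (2 * Real.pi * Complex.I * (c * h.2)) • LinearMap.id = _
    rw [map_smul, dirOp, map_smul, coordCoeff_smul, mulOp_linFun_smul, RingHom.id_apply, smul_add,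
      smul_add, smul_smul, mul_left_comm]
  map_lie' := by
    intro h h'
    refine LinearMap.ext fun f => ?_
    have h0 : negPart (⁅h, h'⁆ : Heis g).1 = 0 := map_zero negPart
    have h1 : coordCoeff (⁅h, h'⁆ : Heis g).1 = 0 := coordCoeff_zero
    have h3 : (⁅h, h'⁆ : Heis g).2 = resForm h.1 h'.1 := rfl
    have h4 : ∀ l l' : Loop g →ₗ[ℝ] ℂ, ∀ f, mulOp l (mulOp l' f) = mulOp l' (mulOp l f) :=
      fun l l' f => Smooth.ext fun x => mul_left_comm _ _ _
    simp only [h0, h1, mulOp_linFun_zero, h3, dirOp, map_zero, zero_add, add_zero, two_pi_I_mul_resForm,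
      Ring.lie_def]
    simp only [LinearMap.sub_apply, Module.End.mul_apply, LinearMap.add_apply, LinearMap.smul_apply,
      LinearMap.id_apply, map_add, map_smul, dirOp_mulOp, linFun_basisVec]
    rw [dirOp_comm (negPart h'.1) (negPart h.1), h4 (linFun (coordCoeff h'.1))]
    module

theorem heisRep_apply (h : Heis g) (f : Smooth g) : heisRep h f = dirOp (negPart h.1) f
    + mulOp (linFun (coordCoeff h.1)) f + (2 * Real.pi * Complex.I * h.2) • f := rfl

theorem heisRep_heisVec (p : Idx g × ℕ) :
    heisRep (heisVec p.1 (-(p.2 : ℤ) - 1)) = partialOp p := by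
  refine LinearMap.ext fun f => ?_
  rw [heisRep_apply, negPart_heisVec, coordCoeff_heisVec, mulOp_linFun_zero]
  simp [heisVec]

theorem heisCoord_snd (p : Idx g × ℕ) : (heisCoord p.1 p.2).2 = 0 := by
  obtain ⟨j, k⟩ := p
  rcases j with i | i <;> exact mul_zero _

theorem heisRep_heisCoord (p : Idx g × ℕ) : heisRep (heisCoord p.1 p.2) = coordOp p := by
  refine LinearMap.ext fun f => ?_
  rw [heisRep_apply, negPart_heisCoord, coordCoeff_heisCoord, mulOp_linFun_single, heisCoord_snd]
  simp

theorem heisRep_central (c : ℂ) (f : Smooth g) :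
    heisRep (heisCentral c) f = (2 * Real.pi * Complex.I * c) • f := by
  change dirOp (negPart 0) f + mulOp (linFun (coordCoeff 0)) f + _ = _
  rw [map_zero, coordCoeff_zero, mulOp_linFun_zero]
  simp [heisCentral]

/-- Such a `u` has no derivative part and acts as multiplication by a linear form in the coordinates
`x_{j,-k-1}` with `k ≥ n`, which vanish on the subspace. -/
theorem heisRep_mem {u : Idx g → LaurentSeries ℂ} {n : ℕ}
    (hu : ∀ j, ∀ k < (n : ℤ), (u j).coeff k = 0) (f : Smooth g) :
    heisRep ((u, 0) : Heis g) f ∈ restrictionKernel g n := by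
  have h0 : negPart u = 0 := by
    ext p
    exact hu p.1 _ (by omega)
  intro x hx
  have h1 : linFun (coordCoeff u) x = 0 := by
    rw [linFun, Finsupp.linearCombination_apply]
    refine Finset.sum_eq_zero fun p _ => ?_
    by_cases hp : n ≤ p.2
    · change x p • coordCoeff u p = 0
      rw [hx p.1 p.2 hp, zero_smul]
    · have : coordCoeff u p = 0 := by
        obtain ⟨j, k⟩ := p
        rcases j with i | i <;> simp only [coordCoeff] <;> rw [hu _ _ (by simp at hp; omega), mul_zero]
      change x p • coordCoeff u p = 0
      rw [this, smul_zero]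
  have h2 : heisRep ((u, 0) : Heis g) f = mulOp (linFun (coordCoeff u)) f := by
    change dirOp (negPart u) f + _ + (2 * Real.pi * Complex.I * 0) • f = _
    rw [h0]
    simp
  rw [h2]
  change linFun (coordCoeff u) x * f.1 x = 0
  rw [h1, zero_mul]

/-- `x_p + ∂/∂x_p` annihilates the Gaussian. -/
theorem coordOp_add_partialOp_gaussian (p : Idx g × ℕ) :
    coordOp p (gaussian g) + partialOp p (gaussian g) = 0 := by
  refine Smooth.ext fun x => ?_
  classical
  -- This finite set contains the support of every point of the line, so the exponent is a quadratic
  -- polynomial in `s`.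
  let S := insert p x.support
  have hsum : ∀ s : ℝ, ((x + s • basisVec p).sum fun _ r => (r : ℂ) ^ 2)
      = (x.sum fun _ r => (r : ℂ) ^ 2) + (2 * (s : ℂ) * x p + (s : ℂ) ^ 2) := by
    intro s
    rw [Finsupp.sum_of_support_subset (s := S), Finsupp.sum_of_support_subset (s := S)]
    · have hp : (2 * (s : ℂ) * x p + (s : ℂ) ^ 2)
          = ∑ q ∈ S, if q = p then (2 * (s : ℂ) * x p + (s : ℂ) ^ 2) else 0 := by
        rw [Finset.sum_ite_eq', if_pos (Finset.mem_insert_self _ _)]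
      rw [hp, ← Finset.sum_add_distrib]
      refine Finset.sum_congr rfl fun q _ => ?_
      by_cases hq : q = p
      · subst hq
        simp [basisVec]
        ring
      · simp [basisVec, hq]
    · exact Finset.subset_insert _ _
    · simp
    · intro q hq
      by_contra hqS
      rw [Finset.mem_insert, not_or] at hqS
      refine Finsupp.mem_support_iff.1 hq ?_
      simp [basisVec, Ne.symm hqS.1, Finsupp.notMem_support_iff.1 hqS.2]
    · simp
  have hd : HasDerivAt (fun s : ℝ => Complex.exp (-(1 / 2) *
      ((x + s • basisVec p).sum fun _ r => (r : ℂ) ^ 2)))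
      (Complex.exp (-(1 / 2) * (x.sum fun _ r => (r : ℂ) ^ 2)) * (-(x p : ℂ))) 0 := by
    simp only [hsum]
    have h1 : HasDerivAt (fun s : ℝ => (s : ℂ)) 1 0 := Complex.ofRealCLM.hasDerivAt
    have h2 := (((h1.const_mul 2).mul_const (x p : ℂ)).add (h1.pow 2)).const_add
      (x.sum fun _ r => (r : ℂ) ^ 2)
    have h3 := (h2.const_mul (-(1 / 2))).cexp
    convert h3 using 1
    · rfl
    · norm_num
      ring
  have e := ((gaussian g).hasDerivAt p x).unique hd
  change (x p : ℂ) * (gaussian g).1 x + (partialOp p (gaussian g)).1 x = 0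
  rw [e]
  change (x p : ℂ) * Complex.exp _ + _ = 0
  ring

end Heisenberg

/-! ### The induced module -/

section InducedModule

variable {g : ℕ}

attribute [local instance] LieRing.ofAssociativeRing LieAlgebra.ofAssociativeAlgebra

/-- The canonical map to the universal enveloping algebra. -/
abbrev uι (g : ℕ) : Heis g →ₗ⁅ℂ⁆ UHeis g := UniversalEnvelopingAlgebra.ι ℂ

/-- The elements of the loop space as elements of the Heisenberg algebra. -/
def heisLoop (u : Idx g → LaurentSeries ℂ) : Heis g := (u, 0)

/-- By the universal property the map of the Lie algebra into `S` lifts to `U(𝔥)`, and its composite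
with the inclusion of `S` is the identity. -/
theorem UHeis.induction (S : Subalgebra ℂ (UHeis g))
    (h : ∀ x, uι g x ∈ S) (u : UHeis g) : u ∈ S := by
  let f : Heis g →ₗ⁅ℂ⁆ S :=
    { toFun := fun x => ⟨uι g x, h x⟩
      map_add' := fun x y => Subtype.ext (map_add (uι g) x y)
      map_smul' := fun c x => Subtype.ext (map_smul (uι g) c x)
      map_lie' := fun {x y} => Subtype.ext (LieHom.map_lie (uι g) x y) }
  have e : S.val.comp (UniversalEnvelopingAlgebra.lift ℂ f) = AlgHom.id ℂ (UHeis g) := by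
    apply UniversalEnvelopingAlgebra.hom_ext
    ext x
    change ((UniversalEnvelopingAlgebra.lift ℂ f (uι g x) : S) : UHeis g)
      = uι g x
    rw [uι, UniversalEnvelopingAlgebra.lift_ι_apply]
    rfl
  have := AlgHom.congr_fun e u
  change ((UniversalEnvelopingAlgebra.lift ℂ f u : S) : UHeis g) = u at this
  rw [← this]
  exact Subtype.prop _

/-- The action of the Heisenberg algebra on the induced module. -/
def heisOp : Heis g →ₗ[ℂ] Module.End ℂ (Induced g) :=
  (Algebra.lsmul ℂ ℂ (Induced g)).toLinearMap.comp
    (uι g).toLinearMap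

theorem heisOp_apply (h : Heis g) (m : Induced g) : heisOp h m = heisAct h m := rfl

/-- The cyclic vector of the induced module. -/
def cyclicVec (g : ℕ) : Induced g := Submodule.Quotient.mk (1 ⊗ₜ 1)

theorem mk_tmul (u : UHeis g) (c : ℂ) :
    (Submodule.Quotient.mk (u ⊗ₜ c) : Induced g) = c • (u • cyclicVec g) := by
  rw [cyclicVec, ← Submodule.Quotient.mk_smul, ← Submodule.Quotient.mk_smul,
    TensorProduct.smul_tmul', TensorProduct.smul_tmul', smul_eq_mul, mul_one,
    TensorProduct.smul_tmul, smul_eq_mul, mul_one]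

theorem mk_mul_ι_tmul (u : UHeis g) (y : subS g) (c : ℂ) :
    (Submodule.Quotient.mk ((u * uι g (y : Heis g)) ⊗ₜ c) : Induced g)
      = charS y • Submodule.Quotient.mk (u ⊗ₜ c) := by
  rw [← Submodule.Quotient.mk_smul, Submodule.Quotient.eq, ← TensorProduct.tmul_smul, smul_eq_mul]
  exact Submodule.subset_span ⟨u, y, c, rfl⟩

theorem heisCentral_mem (c : ℂ) : heisCentral c ∈ subS g :=
  Submodule.subset_span (Or.inr ⟨c, rfl⟩)

theorem heis_lie (x y : Heis g) : ⁅x, y⁆ = heisCentral (resForm x.1 y.1) := rfl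

theorem heisOp_central (c : ℂ) (m : Induced g) :
    heisOp (heisCentral c) m = (2 * Real.pi * Complex.I * c) • m := by
  -- The centre of `𝔥` stays central in `U(𝔥)`, so the defining relation, which multiplies on the
  -- right, also controls the left action.
  have hcomm : ∀ u : UHeis g, uι g (heisCentral c) * u
      = u * uι g (heisCentral c) := by
    intro u
    have := UHeis.induction (Subalgebra.centralizer ℂ
      {uι g (heisCentral c : Heis g)}) (fun x => by
        rw [Subalgebra.mem_centralizer_iff]
        rintro _ rfl
        rw [← sub_eq_zero, ← Ring.lie_def, ← LieHom.map_lie, heis_lie]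
        have : resForm (heisCentral c : Heis g).1 x.1 = 0 := by simp [heisCentral, resForm]
        rw [this]
        exact map_zero (uι g)) u
    exact (Subalgebra.mem_centralizer_iff ℂ).1 this _ rfl
  obtain ⟨z, rfl⟩ := Submodule.Quotient.mk_surjective _ m
  induction z using TensorProduct.induction_on with
  | zero => rw [Submodule.Quotient.mk_zero, map_zero, smul_zero]
  | add a b ha hb => rw [Submodule.Quotient.mk_add, map_add, ha, hb, smul_add]
  | tmul u c' =>
    have h := mk_mul_ι_tmul u ⟨heisCentral c, heisCentral_mem c⟩ c'
    rw [← hcomm] at h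
    exact h

theorem heisOp_comm (x y : Heis g) (m : Induced g) : heisOp x (heisOp y m)
    = heisOp y (heisOp x m) + (2 * Real.pi * Complex.I * resForm x.1 y.1) • m := by
  rw [← heisOp_central, ← heis_lie, heisOp_apply, heisOp_apply, heisOp_apply, heisOp_apply,
    heisOp_apply, heisAct, heisAct, heisAct, heisAct, heisAct, LieHom.map_lie, Ring.lie_def,
    sub_smul, mul_smul, mul_smul]
  abel

/-- The action of `e_j t^(-k-1)`. -/
abbrev actD (p : Idx g × ℕ) : Module.End ℂ (Induced g) := heisOp (heisVec p.1 (-(p.2 : ℤ) - 1))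

/-- The action of the coordinates. -/
abbrev actX (p : Idx g × ℕ) : Module.End ℂ (Induced g) := heisOp (heisCoord p.1 p.2)

theorem actD_heisOp (p : Idx g × ℕ) (y : Heis g) (m : Induced g) :
    actD p (heisOp y m) = heisOp y (actD p m) + coordCoeff y.1 p • m := by
  rw [heisOp_comm, two_pi_I_mul_resForm, negPart_heisVec, coordCoeff_heisVec,
    Finsupp.sum_single_index (by simp)]
  simp

theorem actX_heisOp (p : Idx g × ℕ) (y : Heis g) (m : Induced g) :
    actX p (heisOp y m) = heisOp y (actX p m) - negPart y.1 p • m := by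
  rw [heisOp_comm, two_pi_I_mul_resForm, negPart_heisCoord, coordCoeff_heisCoord,
    Finsupp.sum_zero_index, zero_sub, neg_smul, ← sub_eq_add_neg, Finsupp.sum,
    Finset.sum_eq_single p]
  · simp
  · intro q _ hq
    simp [Pi.single_eq_of_ne hq]
  · intro hp
    simp [Finsupp.notMem_support_iff.1 hp]

theorem isWeyl_induced : IsWeyl (actD (g := g)) actX where
  comm_D p q m := by rw [actD_heisOp, coordCoeff_heisVec, Pi.zero_apply, zero_smul, add_zero]
  comm_X p q m := by
    rw [actX_heisOp, negPart_heisCoord, Finsupp.zero_apply, zero_smul, sub_zero]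
  comm_DX p q m := by
    rw [actD_heisOp, coordCoeff_heisCoord, Pi.single_apply]

theorem heisOp_heisMode (φ : Gen g) (n : ℤ) : heisOp (heisMode φ n) = weylMode actD actX φ n := by
  have hpi : (2 * Real.pi * Complex.I : ℂ) ≠ 0 := Complex.two_pi_I_ne_zero
  rcases φ with i | i <;> rcases n with k | k
  · rfl
  · change heisOp (-heisVec (Sum.inr i) (k : ℤ)) = (-(2 * Real.pi * Complex.I) : ℂ) •
      heisOp ((2 * Real.pi * Complex.I : ℂ)⁻¹ • heisVec (Sum.inr i) (k : ℤ))
    rw [map_smul, smul_smul, neg_mul, mul_inv_cancel₀ hpi, map_neg, neg_one_smul]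
  · rfl
  · change heisOp (-heisVec (Sum.inl i) (k : ℤ)) = (2 * Real.pi * Complex.I : ℂ) •
      heisOp ((-(2 * Real.pi * Complex.I) : ℂ)⁻¹ • heisVec (Sum.inl i) (k : ℤ))
    rw [map_smul, smul_smul, inv_neg, mul_neg, mul_inv_cancel₀ hpi, map_neg, neg_one_smul]

/-- `x_p + ∂_p` lies in `𝔰` and acts by zero on the cyclic vector, so on it derivatives can be
traded for coordinates. -/
theorem actD_cyclicVec (p : Idx g × ℕ) : actD p (cyclicVec g) = -actX p (cyclicVec g) := by
  have hy : heisCoord p.1 p.2 + heisVec p.1 (-(p.2 : ℤ) - 1) ∈ subS g :=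
    Submodule.subset_span (Or.inl ⟨p, rfl⟩)
  have h := mk_mul_ι_tmul 1 ⟨_, hy⟩ 1
  have h0 : charS (⟨_, hy⟩ : subS g) = 0 := by
    have : (heisCoord p.1 p.2 + heisVec p.1 (-(p.2 : ℤ) - 1)).2
        = (heisCoord p.1 p.2).2 + (heisVec p.1 (-(p.2 : ℤ) - 1)).2 := rfl
    rw [charS, this, heisCoord_snd]
    simp [heisVec]
  rw [h0, zero_smul, one_mul, mk_tmul, one_smul] at h
  have h' : heisOp (heisCoord p.1 p.2 + heisVec p.1 (-(p.2 : ℤ) - 1)) (cyclicVec g) = 0 := h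
  rw [map_add, LinearMap.add_apply, add_comm] at h'
  exact eq_neg_of_add_eq_zero_left h'

/-! #### Decomposition of the elements of the Heisenberg algebra -/

theorem coeff_eq_zero_of_coordCoeff {w : Idx g → LaurentSeries ℂ} {n : ℕ}
    (h : ∀ p, negPart w p = 0) (h' : ∀ p : Idx g × ℕ, p.2 < n → coordCoeff w p = 0) (j : Idx g)
    (k : ℤ) (hk : k < n) : (w j).coeff k = 0 := by
  have hpi : (2 * Real.pi * Complex.I : ℂ) ≠ 0 := Complex.two_pi_I_ne_zero
  rcases k with k | k
  · rcases j with i | i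
    · exact (mul_eq_zero.1 (h' (Sum.inr i, k) (Int.ofNat_lt.1 hk))).resolve_left (neg_ne_zero.2 hpi)
    · exact (mul_eq_zero.1 (h' (Sum.inl i, k) (Int.ofNat_lt.1 hk))).resolve_left hpi
  · have := h (j, k)
    rwa [negPart_apply, show -(k : ℤ) - 1 = Int.negSucc k by omega] at this

/-- `coordCoeff` as a linear map. -/
def coordCoeffLinear : (Idx g → LaurentSeries ℂ) →ₗ[ℂ] Idx g × ℕ → ℂ where
  toFun := coordCoeff
  map_add' := coordCoeff_add
  map_smul' := coordCoeff_smul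

/-- The projection of the Heisenberg algebra to the loop space. -/
def heisFst : Heis g →ₗ[ℂ] Idx g → LaurentSeries ℂ := LinearMap.fst ℂ _ ℂ

/-- The projection of the Heisenberg algebra to the center. -/
def heisSnd : Heis g →ₗ[ℂ] ℂ := LinearMap.snd ℂ _ ℂ

/-- Infinitely many nonnegative coefficients may occur, and a finite combination of coordinates
reaches only those below `n`; the tail `w` is later absorbed in `U_n`. -/
theorem heis_decomposition (u : Idx g → LaurentSeries ℂ) (n : ℕ) :
    ∃ w : Idx g → LaurentSeries ℂ, (∀ j, ∀ k < (n : ℤ), (w j).coeff k = 0) ∧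
      heisLoop u = heisLoop w
        + (Finsupp.linearCombination ℂ (fun p : Idx g × ℕ => heisVec p.1 (-(p.2 : ℤ) - 1)) (negPart u)
        + ∑ p ∈ Finset.univ ×ˢ Finset.range n, coordCoeff u p • heisCoord p.1 p.2) := by
  set R₁ : Heis g :=
    Finsupp.linearCombination ℂ (fun p : Idx g × ℕ => heisVec p.1 (-(p.2 : ℤ) - 1)) (negPart u)
    with hR₁
  set R₂ : Heis g := ∑ p ∈ Finset.univ ×ˢ Finset.range n, coordCoeff u p • heisCoord p.1 p.2
    with hR₂
  have n1 : negPart (heisFst R₁) = negPart u := by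
    rw [hR₁, Finsupp.linearCombination_apply, Finsupp.sum, map_sum, map_sum]
    simp only [map_smul]
    refine (Finset.sum_congr rfl fun p _ => congrArg (negPart u p • ·) (negPart_heisVec p)).trans ?_
    simp only [Finsupp.smul_single, smul_eq_mul, mul_one]
    exact Finsupp.sum_single (negPart u)
  have n2 : negPart (heisFst R₂) = 0 := by
    rw [hR₂, map_sum, map_sum]
    simp only [map_smul]
    refine Finset.sum_eq_zero fun p _ => ?_
    exact (congrArg (coordCoeff u p • ·) (negPart_heisCoord p)).trans (smul_zero _)
  have c1 : coordCoeffLinear (heisFst R₁) = 0 := by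
    rw [hR₁, Finsupp.linearCombination_apply, Finsupp.sum, map_sum, map_sum]
    simp only [map_smul]
    refine Finset.sum_eq_zero fun p _ => ?_
    exact (congrArg (negPart u p • ·) (coordCoeff_heisVec p)).trans (smul_zero _)
  have c2 : ∀ q : Idx g × ℕ, q.2 < n → coordCoeffLinear (heisFst R₂) q = coordCoeff u q := by
    intro q hq
    rw [hR₂, map_sum, map_sum]
    simp only [map_smul]
    rw [Finset.sum_apply, Finset.sum_eq_single q]
    · refine (congrArg (fun v => coordCoeff u q • v q) (coordCoeff_heisCoord q)).trans ?_
      simp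
    · intro p _ hp
      refine (congrArg (fun v => coordCoeff u p • v q) (coordCoeff_heisCoord p)).trans ?_
      simp [Pi.single_eq_of_ne hp.symm]
    · intro h
      exact absurd (Finset.mem_product.2 ⟨Finset.mem_univ _, Finset.mem_range.2 hq⟩) h
  have s1 : heisSnd R₁ = 0 := by
    rw [hR₁, Finsupp.linearCombination_apply, Finsupp.sum, map_sum]
    exact Finset.sum_eq_zero fun p _ => (map_smul heisSnd _ _).trans (smul_zero _)
  have s2 : heisSnd R₂ = 0 := by
    rw [hR₂, map_sum]
    exact Finset.sum_eq_zero fun p _ => (map_smul heisSnd _ _).trans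
      ((congrArg _ (heisCoord_snd p)).trans (smul_zero _))
  refine ⟨u - (heisFst R₁ + heisFst R₂), ?_, ?_⟩
  · refine coeff_eq_zero_of_coordCoeff (fun p => ?_) (fun p hp => ?_)
    · rw [map_sub, map_add, n1, n2, add_zero, sub_self, Finsupp.zero_apply]
    · change coordCoeffLinear (u - (heisFst R₁ + heisFst R₂)) p = 0
      rw [map_sub, map_add, c1, zero_add, Pi.sub_apply, c2 p hp]
      exact sub_self _
  · refine Prod.ext (x := heisLoop u) ?_ ?_
    · exact (sub_add_cancel u (heisFst R₁ + heisFst R₂)).symm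
    · change (0 : ℂ) = 0 + (heisSnd R₁ + heisSnd R₂)
      rw [s1, s2, add_zero, add_zero]

theorem heisOp_decomposition (u : Idx g → LaurentSeries ℂ) (n : ℕ) :
    ∃ w : Idx g → LaurentSeries ℂ, (∀ j, ∀ k < (n : ℤ), (w j).coeff k = 0) ∧
      ∀ m, heisOp (heisLoop u) m = heisOp (heisLoop w) m
        + (((negPart u).sum fun p r => r • actD p m)
        + ∑ p ∈ Finset.univ ×ˢ Finset.range n, coordCoeff u p • actX p m) := by
  obtain ⟨w, hw, h⟩ := heis_decomposition u n
  refine ⟨w, hw, fun m => ?_⟩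
  rw [h, map_add, map_add, LinearMap.add_apply, LinearMap.add_apply, map_sum,
    Finsupp.linearCombination_apply, Finsupp.sum, map_sum, LinearMap.sum_apply, LinearMap.sum_apply]
  simp only [map_smul, LinearMap.smul_apply]
  rfl

theorem heisCoord_eq (p : Idx g × ℕ) : heisCoord p.1 p.2 = heisLoop (heisCoord p.1 p.2).1 :=
  Prod.ext rfl (heisCoord_snd p)

theorem heisCoord_coeff (p : Idx g × ℕ) (j : Idx g) (k : ℤ) (hk : k < p.2) :
    ((heisCoord p.1 p.2).1 j).coeff k = 0 := by
  refine coeff_eq_zero_of_coordCoeff (fun q => ?_) (fun q hq => ?_) j k hk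
  · rw [negPart_heisCoord, Finsupp.zero_apply]
  · rw [coordCoeff_heisCoord, Pi.single_eq_of_ne]
    rintro rfl
    exact lt_irrefl _ hq

/-! #### Generation by the cyclic vector -/

theorem cyclicVec_generates (S : Submodule ℂ (Induced g)) (h0 : cyclicVec g ∈ S)
    (hS : ∀ h : Heis g, ∀ m ∈ S, heisOp h m ∈ S) (m : Induced g) : m ∈ S := by
  let A : Subalgebra ℂ (UHeis g) :=
    { carrier := {u | ∀ m ∈ S, u • m ∈ S}
      mul_mem' := fun {a b} ha hb m hm => by rw [mul_smul]; exact ha _ (hb _ hm)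
      add_mem' := fun {a b} ha hb m hm => by rw [add_smul]; exact S.add_mem (ha _ hm) (hb _ hm)
      algebraMap_mem' := fun c m hm => by rw [algebraMap_smul]; exact S.smul_mem c hm }
  obtain ⟨z, rfl⟩ := Submodule.Quotient.mk_surjective _ m
  induction z using TensorProduct.induction_on with
  | zero => exact S.zero_mem
  | add a b ha hb => exact S.add_mem ha hb
  | tmul u c =>
    rw [mk_tmul]
    exact S.smul_mem _ (UHeis.induction A hS u _ h0)

/-- The cyclic vector generates the induced module under the action of `W[[t]]`. -/
theorem cyclicVec_generates_nonneg (S : Submodule ℂ (Induced g)) (h0 : cyclicVec g ∈ S)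
    (hS : ∀ u : Idx g → LaurentSeries ℂ, (∀ j, ∀ k < (0 : ℤ), (u j).coeff k = 0) →
      ∀ m ∈ S, heisOp (heisLoop u) m ∈ S) (m : Induced g) : m ∈ S := by
  -- The smallest such subspace `Q` replaces `S`: its minimality is what yields stability under the
  -- `actD p`.
  let P : Submodule ℂ (Induced g) → Prop := fun S => cyclicVec g ∈ S ∧
    ∀ u : Idx g → LaurentSeries ℂ, (∀ j, ∀ k < (0 : ℤ), (u j).coeff k = 0) →
      ∀ m ∈ S, heisOp (heisLoop u) m ∈ S
  let Q : Submodule ℂ (Induced g) := sInf {S | P S}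
  have hQ0 : cyclicVec g ∈ Q := (Submodule.mem_sInf).2 fun S hS => hS.1
  have hQ1 : ∀ u : Idx g → LaurentSeries ℂ, (∀ j, ∀ k < (0 : ℤ), (u j).coeff k = 0) →
      ∀ m ∈ Q, heisOp (heisLoop u) m ∈ Q := fun u hu m hm =>
    (Submodule.mem_sInf).2 fun S hS => hS.2 u hu m ((Submodule.mem_sInf).1 hm S hS)
  have hQX : ∀ p, ∀ m ∈ Q, actX p m ∈ Q := by
    intro p m hm
    rw [actX, heisCoord_eq]
    exact hQ1 _ (fun j k hk => heisCoord_coeff p j k (by omega)) m hm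
  have hQD : ∀ p, ∀ m ∈ Q, actD p m ∈ Q := by
    intro p m hm
    -- The vectors of `Q` that `actD p` sends into `Q` again form a subspace with property `P`,
    -- since commutators with `actD p` are scalars; minimality makes it all of `Q`.
    have hP : P (Q ⊓ Q.comap (actD p)) := by
      refine ⟨⟨hQ0, ?_⟩, fun u hu m hm => ⟨hQ1 u hu m hm.1, ?_⟩⟩
      · change actD p (cyclicVec g) ∈ Q
        rw [actD_cyclicVec]
        exact Q.neg_mem (hQX p _ hQ0)
      · change actD p (heisOp _ m) ∈ Q
        rw [actD_heisOp]
        exact Q.add_mem (hQ1 u hu _ hm.2) (Q.smul_mem _ hm.1)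
    exact ((Submodule.mem_sInf).1 hm _ hP).2
  have hQ : ∀ h : Heis g, ∀ m ∈ Q, heisOp h m ∈ Q := by
    rintro ⟨u, c⟩ m hm
    have e : ((u, c) : Heis g) = heisLoop u + heisCentral c :=
      Prod.ext (by exact (add_zero u).symm) (by exact (zero_add c).symm)
    obtain ⟨w, hw, h⟩ := heisOp_decomposition u 0
    rw [show heisOp ((u, c) : Heis g) m = heisOp (heisLoop u + heisCentral c) m from
      congrArg (fun y => heisOp y m) e, map_add, LinearMap.add_apply, heisOp_central, h]
    refine Q.add_mem (Q.add_mem (hQ1 w hw m hm) (Q.add_mem ?_ ?_)) (Q.smul_mem _ hm)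
    · exact Q.sum_mem fun p _ => Q.smul_mem _ (hQD p m hm)
    · exact Q.sum_mem fun p _ => Q.smul_mem _ (hQX p m hm)
  exact (Submodule.mem_sInf).1 (cyclicVec_generates Q hQ0 hQ m) S ⟨h0, hS⟩

/-! #### The filtration -/

theorem inducedFiltration_antitone : Antitone (inducedFiltration g) := by
  intro n n' hn
  refine Submodule.span_mono ?_
  rintro _ ⟨u, m, hu, rfl⟩
  exact ⟨u, m, fun j k hk => hu j k (by omega), rfl⟩

theorem heisOp_mem_filtration {u : Idx g → LaurentSeries ℂ} {n : ℕ}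
    (hu : ∀ j, ∀ k < (n : ℤ), (u j).coeff k = 0) (m : Induced g) :
    heisOp (heisLoop u) m ∈ inducedFiltration g n :=
  Submodule.subset_span ⟨u, m, hu, rfl⟩

theorem actX_mem_snd (p : Idx g × ℕ) (m : Induced g) : actX p m ∈ inducedFiltration g p.2 := by
  rw [actX, heisCoord_eq]
  exact heisOp_mem_filtration (heisCoord_coeff p) m

theorem actX_mem (p : Idx g × ℕ) (n : ℕ) : ∀ m ∈ inducedFiltration g n,
    actX p m ∈ inducedFiltration g n := by
  intro m hm
  refine Submodule.span_induction ?_ ?_ ?_ ?_ hm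
  · rintro _ ⟨u, m, hu, rfl⟩
    change actX p (heisOp (heisLoop u) m) ∈ _
    rw [actX_heisOp]
    have : negPart u p = 0 := hu p.1 _ (by omega)
    change _ - negPart u p • m ∈ _
    rw [this, zero_smul, sub_zero]
    exact heisOp_mem_filtration hu _
  · rw [map_zero]
    exact Submodule.zero_mem _
  · intro x y _ _ hx hy
    rw [map_add]
    exact Submodule.add_mem _ hx hy
  · intro c x _ hx
    rw [map_smul]
    exact Submodule.smul_mem _ c hx

theorem coordCoeff_eq_zero {u : Idx g → LaurentSeries ℂ} {n : ℕ}
    (hu : ∀ j, ∀ k < (n : ℤ), (u j).coeff k = 0) {p : Idx g × ℕ} (hp : p.2 < n) :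
    coordCoeff u p = 0 := by
  obtain ⟨j, k⟩ := p
  rcases j with i | i <;> simp only [coordCoeff] <;> rw [hu _ _ (Int.ofNat_lt.2 hp), mul_zero]

/-- For `p.2 < n` the operator `actD p` commutes with the action of `tⁿ W[[t]]`. -/
theorem actD_mem (p : Idx g × ℕ) (n : ℕ) (hp : p.2 < n) : ∀ m ∈ inducedFiltration g n,
    actD p m ∈ inducedFiltration g n := by
  intro m hm
  refine Submodule.span_induction ?_ ?_ ?_ ?_ hm
  · rintro _ ⟨u, m, hu, rfl⟩
    change actD p (heisOp (heisLoop u) m) ∈ _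
    rw [actD_heisOp]
    change _ + coordCoeff u p • m ∈ _
    rw [coordCoeff_eq_zero hu hp, zero_smul, add_zero]
    exact heisOp_mem_filtration hu _
  · rw [map_zero]
    exact Submodule.zero_mem _
  · intro x y _ _ hx hy
    rw [map_add]
    exact Submodule.add_mem _ hx hy
  · intro c x _ hx
    rw [map_smul]
    exact Submodule.smul_mem _ c hx

/-- Modulo `U_n` every element of the induced module is a polynomial in finitely many coordinates
applied to the cyclic vector. -/
theorem exists_polynomial (n : ℕ) (m : Induced g) : ∃ a : MvPolynomial (Idx g × Fin n) ℂ,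
    m - polyAction (fun p : Idx g × Fin n => actX (p.1, (p.2 : ℕ))) (cyclicVec g) a
      ∈ inducedFiltration g n := by
  set L : Idx g × Fin n → Module.End ℂ (Induced g) := fun p => actX (p.1, (p.2 : ℕ)) with hL
  have hcomm : ∀ p q w, L p (L q w) = L q (L p w) := fun p q w => isWeyl_induced.comm_X _ _ w
  -- Polynomial vectors plus `U_n` contain the cyclic vector and are stable under `W[[t]]`, since
  -- modulo `tⁿ` only coordinates of index below `n` act.
  let S := LinearMap.range (polyAction L (cyclicVec g)) ⊔ inducedFiltration g n
  have hSX : ∀ p : Idx g × ℕ, p.2 < n → ∀ m ∈ S, actX p m ∈ S := by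
    intro p hp m hm
    obtain ⟨_, ⟨a, rfl⟩, z, hz, rfl⟩ := Submodule.mem_sup.1 hm
    refine Submodule.mem_sup.2 ⟨_, ⟨MvPolynomial.X (p.1, ⟨p.2, hp⟩) * a, rfl⟩, _,
      actX_mem p n z hz, ?_⟩
    rw [polyAction_X_mul hcomm, map_add]
  have hm : m ∈ S := by
    refine cyclicVec_generates_nonneg S
      (Submodule.mem_sup_left ⟨1, polyAction_one L (cyclicVec g)⟩) (fun u hu m hm => ?_) m
    obtain ⟨w, hw, h⟩ := heisOp_decomposition u n
    have h0 : negPart u = 0 := by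
      ext p
      exact hu p.1 _ (by omega)
    rw [h, h0, Finsupp.sum_zero_index, zero_add]
    refine S.add_mem (Submodule.mem_sup_right (heisOp_mem_filtration hw m)) ?_
    refine S.sum_mem fun p hp => S.smul_mem _ (hSX p ?_ m hm)
    exact Finset.mem_range.1 (Finset.mem_product.1 hp).2
  obtain ⟨_, ⟨a, rfl⟩, z, hz, rfl⟩ := Submodule.mem_sup.1 hm
  exact ⟨a, by rwa [add_sub_cancel_left]⟩

/-! #### The map to the smooth functions -/

/-- The homomorphism of the universal enveloping algebra defined by `heisRep`. -/
def uRep (g : ℕ) : UHeis g →ₐ[ℂ] Module.End ℂ (Smooth g) :=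
  UniversalEnvelopingAlgebra.lift ℂ heisRep

theorem uRep_ι (h : Heis g) : uRep g (uι g h) = heisRep h :=
  UniversalEnvelopingAlgebra.lift_ι_apply ℂ heisRep h

theorem heisRep_gaussian (y : subS g) : heisRep (y : Heis g) (gaussian g) = charS y • gaussian g := by
  obtain ⟨y, hy⟩ := y
  change heisRep y (gaussian g) = (2 * Real.pi * Complex.I * heisSnd y) • gaussian g
  refine Submodule.span_induction ?_ ?_ ?_ ?_ hy
  · rintro _ (⟨p, rfl⟩ | ⟨c, rfl⟩)
    · have e : heisSnd (heisCoord p.1 p.2 + heisVec p.1 (-(p.2 : ℤ) - 1)) = 0 := by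
        rw [map_add]
        change (heisCoord p.1 p.2).2 + 0 = 0
        rw [heisCoord_snd, add_zero]
      rw [e, mul_zero, zero_smul, map_add, LinearMap.add_apply, heisRep_heisCoord, heisRep_heisVec,
        coordOp_add_partialOp_gaussian]
    · exact heisRep_central c _
  · simp
  · intro x y _ _ hx hy
    rw [map_add, LinearMap.add_apply, hx, hy, map_add, mul_add, add_smul]
  · intro c x _ hx
    rw [map_smul, LinearMap.smul_apply, hx, map_smul, smul_smul, smul_eq_mul, mul_left_comm]

/-- Homomorphisms of the induced module to the smooth functions that map the cyclic vector to the
Gaussian. -/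
structure IsInducedMap (F : Induced g →ₗ[ℂ] Smooth g) : Prop where
  map_heisOp : ∀ h m, F (heisOp h m) = heisRep h (F m)
  map_cyclicVec : F (cyclicVec g) = gaussian g

/-- Frobenius reciprocity: `𝔰` acts on the Gaussian through `charS`, so `u ⊗ c ↦ c • u (gaussian g)`
respects the relations of the induced module. -/
theorem exists_inducedMap (g : ℕ) : ∃ F : Induced g →ₗ[ℂ] Smooth g, IsInducedMap F := by
  let G : UHeis g ⊗[ℂ] ℂ →ₗ[ℂ] Smooth g := TensorProduct.lift
    (LinearMap.mk₂ ℂ (fun u c => c • uRep g u (gaussian g))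
      (fun u v c => by rw [map_add, LinearMap.add_apply, smul_add])
      (fun d u c => by rw [map_smul, LinearMap.smul_apply, smul_comm])
      (fun u c d => add_smul _ _ _)
      (fun d u c => by rw [smul_eq_mul, mul_smul]))
  have hG : ∀ u c, G (u ⊗ₜ c) = c • uRep g u (gaussian g) := fun u c => rfl
  have hGu : ∀ (u : UHeis g) (z : UHeis g ⊗[ℂ] ℂ), G (u • z) = uRep g u (G z) := by
    intro u z
    induction z using TensorProduct.induction_on with
    | zero => simp
    | add a b ha hb => rw [smul_add, map_add, ha, hb, map_add, map_add]
    | tmul v c =>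
      rw [TensorProduct.smul_tmul', hG, hG, smul_eq_mul, map_mul, map_smul]
      rfl
  have hker : (inducedRel g).restrictScalars ℂ ≤ LinearMap.ker G := by
    intro z hz
    rw [LinearMap.mem_ker]
    refine Submodule.span_induction (p := fun z _ => G z = 0) ?_ ?_ ?_ ?_ hz
    · rintro _ ⟨u, y, c, rfl⟩
      rw [map_sub, hG, hG, map_mul, Module.End.mul_apply, uRep_ι, heisRep_gaussian, map_smul,
        smul_smul, mul_comm, sub_self]
    · exact map_zero G
    · intro x y _ _ hx hy
      rw [map_add, hx, hy, add_zero]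
    · intro u x _ hx
      rw [hGu, hx, map_zero]
  let F : Induced g →ₗ[ℂ] Smooth g := (((inducedRel g).restrictScalars ℂ).liftQ G hker).comp
    (Submodule.Quotient.restrictScalarsEquiv ℂ (inducedRel g)).symm.toLinearMap
  have hF : ∀ z, F (Submodule.Quotient.mk z) = G z := fun z => rfl
  refine ⟨F, fun h m => ?_, ?_⟩
  · obtain ⟨z, rfl⟩ := Submodule.Quotient.mk_surjective _ m
    rw [heisOp_apply, heisAct, ← Submodule.Quotient.mk_smul, hF, hF, hGu, uRep_ι]
  · rw [cyclicVec, hF, hG, map_one, one_smul]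
    rfl

end InducedModule

/-! ### The completed induced module -/

theorem Completion.map_mem {M N : Type*} [AddCommGroup M] [Module ℂ M] {U : ℕ → Submodule ℂ M}
    (hU : Antitone U) [AddCommGroup N] [Module ℂ N] [TopologicalSpace N]
    {S : Completion U →ₗ[ℂ] N} (hS : Continuous S) {n : ℕ} {V : Set N} (hV : IsClosed V)
    (h : ∀ m ∈ U n, S (Completion.of U m) ∈ V) :
    ∀ x ∈ Completion.closureFiltration U n, S x ∈ V := by
  rintro _ ⟨v, ⟨K, hK⟩, rfl⟩
  exact hV.mem_of_tendsto ((hS.tendsto _).comp (Completion.tendsto_of hU v))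
    (eventually_atTop.2 ⟨K, fun i hi => h _ (hK i hi)⟩)

theorem Completion.exists_extension {M : Type*} [AddCommGroup M] [Module ℂ M]
    {U : ℕ → Submodule ℂ M} (hU : Antitone U) (T : Module.End ℂ M)
    (hT : ∀ n, ∃ n', ∀ m ∈ U n', T m ∈ U n) :
    ∃ S : Module.End ℂ (Completion U), Continuous S ∧
      ∀ m, S (Completion.of U m) = Completion.of U (T m) := by
  have := Completion.completeLinear hU
  refine Completion.exists_lift hU ((Completion.ofLinear U).comp T) fun W hW => ?_
  obtain ⟨n, hn⟩ := (Completion.mem_nhds_zero hU).1 hW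
  obtain ⟨n', hn'⟩ := hT n
  exact ⟨n', fun m hm => hn (Completion.of_mem.2 (hn' m hm))⟩

section CompletedInduced

variable {g : ℕ}

instance : CompleteLinear (CompletedInduced g) :=
  Completion.completeLinear inducedFiltration_antitone

/-- The canonical map to the completion of the induced module. -/
abbrev indOf : Induced g →ₗ[ℂ] CompletedInduced g := Completion.ofLinear (inducedFiltration g)

/-- The subspaces that define the topology of the completed induced module. -/
abbrev indClosure (g n : ℕ) : Submodule ℂ (CompletedInduced g) :=
  Completion.closureFiltration (inducedFiltration g) n

theorem indClosure_isClosed (n : ℕ) : IsClosed (indClosure g n : Set (CompletedInduced g)) :=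
  submodule_isClosed ((Completion.mem_nhds_zero inducedFiltration_antitone).2 ⟨n, subset_rfl⟩)

theorem exists_extension_actD (p : Idx g × ℕ) : ∃ S : Module.End ℂ (CompletedInduced g),
    Continuous S ∧ ∀ m, S (indOf m) = indOf (actD p m) :=
  Completion.exists_extension inducedFiltration_antitone (actD p) fun n =>
    ⟨max n (p.2 + 1), fun m hm => inducedFiltration_antitone (le_max_left n (p.2 + 1))
      (actD_mem p _ (lt_of_lt_of_le (Nat.lt_succ_self _) (le_max_right _ _)) m hm)⟩

theorem exists_extension_actX (p : Idx g × ℕ) : ∃ S : Module.End ℂ (CompletedInduced g),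
    Continuous S ∧ ∀ m, S (indOf m) = indOf (actX p m) :=
  Completion.exists_extension inducedFiltration_antitone (actX p) fun n => ⟨n, actX_mem p n⟩

/-- The extension of `actD` to the completion. -/
def hatD (p : Idx g × ℕ) : Module.End ℂ (CompletedInduced g) := (exists_extension_actD p).choose

/-- The extension of `actX` to the completion. -/
def hatX (p : Idx g × ℕ) : Module.End ℂ (CompletedInduced g) := (exists_extension_actX p).choose

theorem hatD_continuous (p : Idx g × ℕ) : Continuous (hatD p) :=
  (exists_extension_actD p).choose_spec.1

theorem hatD_of (p : Idx g × ℕ) (m : Induced g) : hatD p (indOf m) = indOf (actD p m) :=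
  (exists_extension_actD p).choose_spec.2 m

theorem hatX_continuous (p : Idx g × ℕ) : Continuous (hatX p) :=
  (exists_extension_actX p).choose_spec.1

theorem hatX_of (p : Idx g × ℕ) (m : Induced g) : hatX p (indOf m) = indOf (actX p m) :=
  (exists_extension_actX p).choose_spec.2 m

theorem indOf_hom_ext {N : Type*} [AddCommGroup N] [Module ℂ N] [TopologicalSpace N] [T2Space N]
    {S T : CompletedInduced g →ₗ[ℂ] N} (hS : Continuous S) (hT : Continuous T)
    (h : ∀ m, S (indOf m) = T (indOf m)) : S = T :=
  Completion.hom_ext inducedFiltration_antitone hS hT h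

theorem isWeyl_completed : IsWeyl (hatD (g := g)) hatX where
  comm_D p q := LinearMap.congr_fun <| indOf_hom_ext (S := (hatD p).comp (hatD q))
    (T := (hatD q).comp (hatD p)) ((hatD_continuous p).comp (hatD_continuous q))
    ((hatD_continuous q).comp (hatD_continuous p)) fun m => by
      simp only [LinearMap.comp_apply, hatD_of]
      rw [isWeyl_induced.comm_D]
  comm_X p q := LinearMap.congr_fun <| indOf_hom_ext (S := (hatX p).comp (hatX q))
    (T := (hatX q).comp (hatX p)) ((hatX_continuous p).comp (hatX_continuous q))
    ((hatX_continuous q).comp (hatX_continuous p)) fun m => by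
      simp only [LinearMap.comp_apply, hatX_of]
      rw [isWeyl_induced.comm_X]
  comm_DX p q := LinearMap.congr_fun <| indOf_hom_ext (S := (hatD p).comp (hatX q))
    (T := (hatX q).comp (hatD p) + (if p = q then (1 : ℂ) else 0) • LinearMap.id)
    ((hatD_continuous p).comp (hatX_continuous q))
    (((hatX_continuous q).comp (hatD_continuous p)).add (continuous_id.const_smul _)) fun m => by
      simp only [LinearMap.comp_apply, LinearMap.add_apply, LinearMap.smul_apply, LinearMap.id_apply,
        hatX_of, hatD_of]
      rw [isWeyl_induced.comm_DX, map_add, map_smul]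

/-- The free fields on the completed induced module. -/
def completedFields (φ : Gen g) : Fields (CompletedInduced g) :=
  ⟨weylMode hatD hatX φ, weylMode_isField
    (fun _ => Completion.mem_nhds_zero inducedFiltration_antitone)
    (Completion.closureFiltration_antitone inducedFiltration_antitone)
    (fun p n hp => Completion.map_mem inducedFiltration_antitone (hatD_continuous p)
      (indClosure_isClosed n) fun m hm => by
        change hatD p (indOf m) ∈ indClosure g n
        rw [hatD_of]
        exact Completion.of_mem.2 (actD_mem p n hp m hm))
    (fun p n => Completion.map_mem inducedFiltration_antitone (hatX_continuous p)
      (indClosure_isClosed n) fun m hm => by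
        change hatX p (indOf m) ∈ indClosure g n
        rw [hatX_of]
        exact Completion.of_mem.2 (actX_mem p n m hm))
    (fun p => Completion.induction_closed inducedFiltration_antitone
      ((indClosure_isClosed p.2).preimage (hatX_continuous p)) fun m => by
        change hatX p (indOf m) ∈ indClosure g p.2
        rw [hatX_of]
        exact Completion.of_mem.2 (actX_mem_snd p m)) φ⟩

theorem completedFields_freeRelations : FreeRelations (completedFields (g := g)) :=
  fun φ ψ m n x => isWeyl_completed.weylMode_comm φ ψ m n x

theorem weylMode_of (φ : Gen g) (n : ℤ) (m : Induced g) :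
    weylMode hatD hatX φ n (indOf m) = indOf (weylMode actD actX φ n m) := by
  rcases φ with i | i <;> rcases n with k | k <;>
    simp only [weylMode, LinearMap.smul_apply, hatD_of, hatX_of, map_smul]

theorem existsUnique_inducedStructure (g : ℕ) :
    ∃! Y : Fock g →ₗ[ℂ] ℤ → Module.End ℂ (CompletedInduced g), IsInducedStructure Y := by
  refine ⟨moduleStructure completedFields,
    ⟨moduleStructure_isLinearTopologicalModule completedFields_freeRelations, fun φ n m => ?_⟩,
    fun Y hY => ?_⟩
  · rw [moduleStructure_genState completedFields_freeRelations]
    exact (weylMode_of φ n m).trans (by rw [← heisOp_heisMode]; rfl)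
  · refine structure_unique hY.1
      (moduleStructure_isLinearTopologicalModule completedFields_freeRelations) fun φ n => ?_
    refine indOf_hom_ext ((hY.1.field _).1 n) (((moduleStructure_isLinearTopologicalModule
      completedFields_freeRelations).field _).1 n) fun m => ?_
    rw [moduleStructure_genState completedFields_freeRelations]
    exact (hY.2 φ n m).trans ((weylMode_of φ n m).trans (by rw [← heisOp_heisMode]; rfl)).symm

end CompletedInduced

/-! ### The comparison of the completed induced module with the smooth functions -/

section Comparison

variable {g : ℕ}

theorem gaussian_ne_zero (x : Loop g) : (gaussian g).1 x ≠ 0 := Complex.exp_ne_zero _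

variable {F : Induced g →ₗ[ℂ] Smooth g}

theorem IsInducedMap.map_actX (hF : IsInducedMap F) (p : Idx g × ℕ) (m : Induced g) :
    F (actX p m) = coordOp p (F m) := by
  rw [hF.map_heisOp, heisRep_heisCoord]

theorem IsInducedMap.map_actD (hF : IsInducedMap F) (p : Idx g × ℕ) (m : Induced g) :
    F (actD p m) = partialOp p (F m) := by
  rw [hF.map_heisOp, heisRep_heisVec]

theorem IsInducedMap.map_mem (hF : IsInducedMap F) {n : ℕ} :
    ∀ m ∈ inducedFiltration g n, F m ∈ restrictionKernel g n := by
  have : inducedFiltration g n ≤ (restrictionKernel g n).comap F := by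
    refine Submodule.span_le.2 ?_
    rintro _ ⟨u, m, hu, rfl⟩
    change F (heisOp (heisLoop u) m) ∈ restrictionKernel g n
    rw [hF.map_heisOp]
    exact heisRep_mem hu _
  exact this

theorem IsInducedMap.map_polyAction (hF : IsInducedMap F) {n : ℕ}
    (a : MvPolynomial (Idx g × Fin n) ℂ) (x : Loop g) :
    (F (polyAction (fun p : Idx g × Fin n => actX (p.1, (p.2 : ℕ))) (cyclicVec g) a)).1 x
      = MvPolynomial.eval (fun p : Idx g × Fin n => (x (p.1, (p.2 : ℕ)) : ℂ)) a
        * (gaussian g).1 x := by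
  set L : Idx g × Fin n → Module.End ℂ (Induced g) := fun p => actX (p.1, (p.2 : ℕ)) with hL
  have hcomm : ∀ p q w, L p (L q w) = L q (L p w) := fun p q w => isWeyl_induced.comm_X _ _ w
  refine MvPolynomial.induction_on (motive := fun a => (F (polyAction L (cyclicVec g) a)).1 x
      = MvPolynomial.eval (fun p : Idx g × Fin n => (x (p.1, (p.2 : ℕ)) : ℂ)) a
        * (gaussian g).1 x) a ?_ ?_ ?_
  · intro c
    rw [MvPolynomial.eval_C, MvPolynomial.C_eq_smul_one, map_smul, polyAction_one, map_smul,
      hF.map_cyclicVec]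
    rfl
  · intro a b ha hb
    rw [map_add, map_add, map_add, add_mul, ← ha, ← hb]
    rfl
  · intro a p ha
    rw [mul_comm, polyAction_X_mul hcomm, hL, hF.map_actX, map_mul, MvPolynomial.eval_X, mul_assoc,
      ← ha]
    rfl

/-- The heart of the comparison. Modulo `U_n` the element is a polynomial in finitely many
coordinates applied to the cyclic vector; its image is that polynomial times the Gaussian, which
never vanishes, so the polynomial is zero at all real points and hence zero. -/
theorem IsInducedMap.mem_of_map_mem (hF : IsInducedMap F) {n : ℕ} {m : Induced g}
    (hm : F m ∈ restrictionKernel g n) : m ∈ inducedFiltration g n := by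
  obtain ⟨a, ha⟩ := exists_polynomial n m
  have h1 : F (polyAction (fun p : Idx g × Fin n => actX (p.1, (p.2 : ℕ))) (cyclicVec g) a)
      ∈ restrictionKernel g n := by
    have := Submodule.sub_mem _ hm (hF.map_mem _ ha)
    rwa [map_sub, sub_sub_cancel] at this
  have h0 : a = 0 := by
    refine MvPolynomial.funext_set (fun _ => Set.range ((↑) : ℝ → ℂ))
      (fun _ => Set.infinite_range_of_injective Complex.ofReal_injective) fun y hy => ?_
    choose r hr using fun p => hy p (Set.mem_univ p)
    let e : (Idx g × Fin n) ↪ Idx g × ℕ := ⟨fun p => (p.1, (p.2 : ℕ)), fun p q hpq => by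
      rw [Prod.mk.injEq] at hpq
      exact Prod.ext hpq.1 (Fin.ext hpq.2)⟩
    -- The real point with the prescribed coordinates of index below `n` and all others zero, so it
    -- lies in the subspace to which functions are restricted.
    let x : Loop g := (Finsupp.equivFunOnFinite.symm r).embDomain e
    have hx : ∀ p : Idx g × Fin n, x (p.1, (p.2 : ℕ)) = r p := fun p =>
      Finsupp.embDomain_apply_self e (Finsupp.equivFunOnFinite.symm r) p
    have h2 := h1 x fun j k hk => by
      refine Finsupp.embDomain_of_notMem_range _ _ _ ?_
      rintro ⟨p, hp⟩
      have := congrArg Prod.snd hp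
      change (p.2 : ℕ) = k at this
      omega
    rw [hF.map_polyAction, mul_eq_zero, or_iff_left (gaussian_ne_zero x)] at h2
    rw [map_zero, ← h2]
    congr 2
    funext p
    rw [hx, hr]
  rwa [h0, map_zero, sub_zero] at ha

variable (F) in
/-- The continuous extensions of the homomorphisms of the induced module. -/
structure IsCompletedMap (G : CompletedInduced g →ₗ[ℂ] Smooth g) : Prop where
  continuous : Continuous G
  map_of : ∀ m, G (indOf m) = F m

theorem IsInducedMap.exists_completedMap (hF : IsInducedMap F) : ∃ G, IsCompletedMap F G := by
  obtain ⟨G, hG, hG'⟩ := Completion.exists_lift inducedFiltration_antitone F fun W hW => by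
    obtain ⟨n, hn⟩ := (filtration_mem_nhds_zero rfl restrictionKernel_antitone).1 hW
    exact ⟨n, fun m hm => hn (hF.map_mem m hm)⟩
  exact ⟨G, hG, hG'⟩

variable {G : CompletedInduced g →ₗ[ℂ] Smooth g}

theorem restrictionKernel_isClosed (n : ℕ) : IsClosed (restrictionKernel g n : Set (Smooth g)) :=
  submodule_isClosed ((filtration_mem_nhds_zero rfl restrictionKernel_antitone).2 ⟨n, subset_rfl⟩)

/-- Density of the induced module carries the equality of filtrations over to the completion; it
makes `G` a homeomorphism onto its image. -/
theorem IsCompletedMap.mem_iff (hF : IsInducedMap F) (hG : IsCompletedMap F G) {n : ℕ}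
    {x : CompletedInduced g} : G x ∈ restrictionKernel g n ↔ x ∈ indClosure g n := by
  have h1 : ∀ x ∈ indClosure g n, G x ∈ restrictionKernel g n :=
    Completion.map_mem inducedFiltration_antitone hG.continuous (restrictionKernel_isClosed n)
      fun m hm => (hG.map_of m).symm ▸ hF.map_mem m hm
  refine ⟨fun hx => ?_, h1 x⟩
  obtain ⟨m, hm⟩ := Completion.exists_sub_of_mem x n
  have h2 := Submodule.sub_mem _ hx (h1 _ hm)
  rw [map_sub, sub_sub_cancel] at h2
  have h3 : F m ∈ restrictionKernel g n := hG.map_of m ▸ h2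
  have h4 := Submodule.add_mem _ hm (Completion.of_mem.2 (hF.mem_of_map_mem h3))
  rwa [sub_add_cancel] at h4

theorem IsCompletedMap.injective (hF : IsInducedMap F) (hG : IsCompletedMap F G) :
    Function.Injective G := by
  refine (injective_iff_map_eq_zero G).2 fun x hx => Completion.eq_zero_of_forall_mem x fun n => ?_
  rw [← hG.mem_iff hF, hx]
  exact Submodule.zero_mem _

/-- If images converge to `f`, then `mem_iff` makes their preimages Cauchy, and completeness
supplies a preimage of `f`. -/
theorem IsCompletedMap.isClosed_range (hF : IsInducedMap F) (hG : IsCompletedMap F G) :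
    IsClosed (LinearMap.range G : Set (Smooth g)) := by
  refine isClosed_of_closure_subset fun f hf => ?_
  have happrox : ∀ n, ∃ x, G x - f ∈ restrictionKernel g n := by
    intro n
    have hn := (filtration_nhds_hasBasis restrictionKernel_antitone f).mem_of_mem (i := n) trivial
    obtain ⟨_, hy, x, rfl⟩ := mem_closure_iff_nhds.1 hf _ hn
    exact ⟨x, hy⟩
  choose x hx using happrox
  have hx' : ∀ n i, n ≤ i → G (x i) - f ∈ restrictionKernel g n :=
    fun n i hi => restrictionKernel_antitone hi (hx i)
  obtain ⟨y, hy⟩ := CompleteLinear.complete x fun V hV => by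
    obtain ⟨n, hn⟩ := (Completion.mem_nhds_zero inducedFiltration_antitone).1 hV
    refine ⟨n, fun i hi j hj => hn ?_⟩
    have h := Submodule.sub_mem _ (hx' n i hi) (hx' n j hj)
    rw [sub_sub_sub_cancel_right, ← map_sub] at h
    exact (hG.mem_iff hF).1 h
  refine ⟨y, tendsto_nhds_unique ((hG.continuous.tendsto y).comp hy) ?_⟩
  exact (filtration_tendsto rfl restrictionKernel_antitone).2 fun n => ⟨n, hx' n⟩

theorem IsInducedMap.map_weylMode (hF : IsInducedMap F) (φ : Gen g) (n : ℤ) (m : Induced g) :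
    F (weylMode actD actX φ n m) = weylMode partialOp coordOp φ n (F m) := by
  rcases φ with i | i <;> rcases n with k | k <;>
    simp only [weylMode, LinearMap.smul_apply, map_smul, hF.map_actD, hF.map_actX]

variable {Y : Fock g →ₗ[ℂ] ℤ → Module.End ℂ (CompletedInduced g)}
  {Z : Fock g →ₗ[ℂ] ℤ → Module.End ℂ (Smooth g)}

theorem IsCompletedMap.map_modes (hF : IsInducedMap F) (hG : IsCompletedMap F G)
    (hY : IsInducedStructure Y) (hZ : IsSmoothStructure Z) (a : Fock g) (n : ℤ)
    (x : CompletedInduced g) : G (Y a n x) = Z a n (G x) := by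
  refine intertwines hY.1 hZ.1 G hG.continuous (fun φ n => ?_) a n x
  refine LinearMap.congr_fun <| indOf_hom_ext (S := G.comp (Y (genState φ) n))
    (T := (Z (genState φ) n).comp G) (hG.continuous.comp ((hY.1.field _).1 n))
    (((hZ.1.field _).1 n).comp hG.continuous) fun m => ?_
  have e : Y (genState φ) n (indOf m) = indOf (weylMode actD actX φ n m) :=
    (hY.2 φ n m).trans (by rw [← heisOp_heisMode]; rfl)
  rw [LinearMap.comp_apply, LinearMap.comp_apply, e, hG.map_of, hG.map_of, hF.map_weylMode, hZ.2,
    smoothMode_eq]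

/-- The coordinates are nonzero multiples of creation modes of the generators. -/
theorem genState_actX (hY : IsInducedStructure Y) {S : Submodule ℂ (CompletedInduced g)}
    (hS : ∀ a n, ∀ x ∈ S, Y a n x ∈ S) (p : Idx g × ℕ) (m : Induced g) (hm : indOf m ∈ S) :
    indOf (actX p m) ∈ S := by
  have hpi : (2 * Real.pi * Complex.I : ℂ) ≠ 0 := Complex.two_pi_I_ne_zero
  have e : ∀ φ n, indOf (weylMode actD actX φ n m) ∈ S := by
    intro φ n
    have h := hS (genState φ) n _ hm
    rwa [show Y (genState φ) n (indOf m) = indOf (weylMode actD actX φ n m) from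
      (hY.2 φ n m).trans (by rw [← heisOp_heisMode]; rfl)] at h
  obtain ⟨j, k⟩ := p
  rcases j with i | i
  · have h := e (Sum.inl i) (Int.negSucc k)
    rw [weylMode, LinearMap.smul_apply, map_smul] at h
    exact (S.smul_mem_iff (neg_ne_zero.2 hpi)).1 h
  · have h := e (Sum.inr i) (Int.negSucc k)
    rw [weylMode, LinearMap.smul_apply, map_smul] at h
    exact (S.smul_mem_iff hpi).1 h

/-- The cyclic vector generates the completed induced module. -/
theorem closedSubmodule_eq_top (hY : IsInducedStructure Y) {S : Submodule ℂ (CompletedInduced g)}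
    (hS : IsClosedSubmodule Y S) (h0 : indOf (cyclicVec g) ∈ S) (x : CompletedInduced g) :
    x ∈ S := by
  refine Completion.induction_closed inducedFiltration_antitone hS.1 (fun m => ?_) x
  change indOf m ∈ S
  rw [← SetLike.mem_coe, ← hS.1.closure_eq]
  refine mem_closure_iff_nhds_basis
    (filtration_nhds_hasBasis (Completion.closureFiltration_antitone inducedFiltration_antitone)
      (indOf m)) |>.2 fun n _ => ?_
  -- Polynomials in the coordinates applied to the cyclic vector lie in `S` and, by
  -- `exists_polynomial`, approximate `m` modulo every `U_n`.
  obtain ⟨a, ha⟩ := exists_polynomial n m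
  set L : Idx g × Fin n → Module.End ℂ (Induced g) := fun p => actX (p.1, (p.2 : ℕ)) with hL
  have hcomm : ∀ p q w, L p (L q w) = L q (L p w) := fun p q w => isWeyl_induced.comm_X _ _ w
  refine ⟨indOf (polyAction L (cyclicVec g) a), ?_, ?_⟩
  · refine MvPolynomial.induction_on
      (motive := fun a => indOf (polyAction L (cyclicVec g) a) ∈ S) a ?_ ?_ ?_
    · intro c
      rw [MvPolynomial.C_eq_smul_one, map_smul, polyAction_one, map_smul]
      exact S.smul_mem c h0
    · intro a b ha hb
      rw [map_add, map_add]
      exact S.add_mem ha hb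
    · intro a p ha
      rw [mul_comm, polyAction_X_mul hcomm]
      exact genState_actX hY hS.2 _ _ ha
  · change indOf _ - indOf m ∈ indClosure g n
    rw [← map_sub, ← neg_sub, map_neg]
    exact Submodule.neg_mem _ (Completion.of_mem.2 ha)

/-- The preimage under `G` of a closed submodule containing the Gaussian is a closed submodule
containing the cyclic vector, hence everything. Conversely the range is itself a closed submodule
containing the Gaussian. -/
theorem IsCompletedMap.range_eq (hF : IsInducedMap F) (hG : IsCompletedMap F G)
    (hY : IsInducedStructure Y) (hZ : IsSmoothStructure Z) :
    LinearMap.range G = generated Z (gaussian g) := by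
  have hgen : gaussian g = G (indOf (cyclicVec g)) := by rw [hG.map_of, hF.map_cyclicVec]
  refine le_antisymm ?_ ?_
  · rintro _ ⟨x, rfl⟩
    refine Submodule.mem_sInf.2 fun S hS => ?_
    refine closedSubmodule_eq_top hY (S := S.comap G)
      ⟨hS.1.1.preimage hG.continuous, fun a n y hy => ?_⟩ ?_ x
    · rw [Submodule.mem_comap, hG.map_modes hF hY hZ]
      exact hS.1.2 a n _ hy
    · rw [Submodule.mem_comap, ← hgen]
      exact hS.2
  · refine sInf_le ⟨⟨hG.isClosed_range hF, ?_⟩, hgen ▸ LinearMap.mem_range_self G _⟩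
    rintro a n _ ⟨x, rfl⟩
    exact ⟨Y a n x, hG.map_modes hF hY hZ a n x⟩

theorem isomorphic_generatedAction (hY : IsInducedStructure Y) (hZ : IsSmoothStructure Z) :
    Isomorphic Y (generatedAction Z (gaussian g)) := by
  obtain ⟨F, hF⟩ := exists_inducedMap g
  obtain ⟨G, hG⟩ := hF.exists_completedMap
  have hr := hG.range_eq hF hY hZ
  have hmem : ∀ x, G x ∈ generated Z (gaussian g) := fun x => hr ▸ LinearMap.mem_range_self G x
  let T : CompletedInduced g →ₗ[ℂ] generated Z (gaussian g) := G.codRestrict _ hmem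
  have hT : Continuous T := hG.continuous.subtype_mk hmem
  have hbij : Function.Bijective T := by
    refine ⟨fun x y hxy => hG.injective hF (congrArg Subtype.val hxy), fun ⟨f, hf⟩ => ?_⟩
    rw [← hr] at hf
    obtain ⟨x, rfl⟩ := hf
    exact ⟨x, rfl⟩
  let e := LinearEquiv.ofBijective T hbij
  have hgc := ((hZ.1.completeLinear).submodule (generated_isClosed Z (gaussian g)))
  have := hgc.isTopologicalAddGroup
  -- Continuity of the inverse is the passage from `restrictionKernel` to `indClosure` in `mem_iff`.
  have hinv : Continuous e.symm := by
    refine linear_continuous e.symm.toLinearMap fun V hV => ?_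
    obtain ⟨n, hn⟩ := (Completion.mem_nhds_zero inducedFiltration_antitone).1 hV
    have hK : (restrictionKernel g n : Set (Smooth g)) ∈ 𝓝 (0 : Smooth g) :=
      (filtration_mem_nhds_zero rfl restrictionKernel_antitone).2 ⟨n, subset_rfl⟩
    have hK' : ∀ᶠ f : generated Z (gaussian g) in 𝓝 0, (f : Smooth g) ∈ restrictionKernel g n :=
      continuous_subtype_val.tendsto (0 : generated Z (gaussian g)) hK
    filter_upwards [hK'] with f hf
    refine hn ((hG.mem_iff hF).1 ?_)
    have hef : G (e.symm f) = f := congrArg Subtype.val (e.apply_symm_apply f)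
    change G (e.symm f) ∈ _
    rwa [hef]
  refine ⟨{ e with continuous_toFun := hT, continuous_invFun := hinv }, fun a n x => ?_⟩
  exact Subtype.ext (hG.map_modes hF hY hZ a n x)

end Comparison

end BetaGamma

end

theorem mainTheorem7 (g : ℕ) :
    (∃! Y : BetaGamma.Fock g →ₗ[ℂ] ℤ → Module.End ℂ (BetaGamma.CompletedInduced g),
      BetaGamma.IsInducedStructure Y) ∧
    (∃! Z : BetaGamma.Fock g →ₗ[ℂ] ℤ → Module.End ℂ (BetaGamma.Smooth g),
      BetaGamma.IsSmoothStructure Z) ∧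
    ∀ (Y : BetaGamma.Fock g →ₗ[ℂ] ℤ → Module.End ℂ (BetaGamma.CompletedInduced g))
      (Z : BetaGamma.Fock g →ₗ[ℂ] ℤ → Module.End ℂ (BetaGamma.Smooth g)),
      BetaGamma.IsInducedStructure Y → BetaGamma.IsSmoothStructure Z →
        BetaGamma.IsLinearTopologicalModule
            (BetaGamma.generatedAction Z (BetaGamma.gaussian g)) ∧
          BetaGamma.Isomorphic Y (BetaGamma.generatedAction Z (BetaGamma.gaussian g)) :=
  ⟨BetaGamma.existsUnique_inducedStructure g, BetaGamma.existsUnique_smoothStructure g,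
    fun _ _ hY hZ => ⟨BetaGamma.generatedAction_isLinearTopologicalModule hZ.1 _,
      BetaGamma.isomorphic_generatedAction hY hZ⟩⟩
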